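/- Let $W$ be a one-dimensional Brownian motion with respect to a filtration $(\mathcal F_t)_{t\ge 0}$ on a probability space (for instance the filtration generated by $W$), let $T>0$, $\mu,r\in\mathbb R$, $\sigma>0$, $\lambda>0$, and let $M$ be a real number with $$\Big|\frac{\mu-r}{2\lambda\sigma^2}\,e^{-r(T-t)}\Big|\le M\qquad\text{for all } t\in(0,T].$$ Let $\mathcal U$ be the set of all adapted processes $u=(u_t)_{t\in[0,T]}$ with càglàd paths and $|u|\le M$ (almost surely); $u_t$ is the amount of money invested in the risky asset. For $u\in\mathcal U$ the wealth process $X^u$ started from $x\in\mathbb R$ at time $t\in[0,T)$ is given by $$dX^u_s=\big[rX^u_s+u_s(\mu-r)\big]\,ds+u_s\,\sigma\,dW_s,\quad s\in[t,T],\qquad X^u_t=x.$$ Consider the mean-variance criterion for gains and losses, i.e. reward function $\mathcal T(y)=y$, penalty function $F(y)=\max\{0,y\}^2$, and the conditional standard deviation as risk measure: $$J(t,x,u)=\mathbb E\big[X^u_T-xe^{r(T-t)}\,\big|\,\mathcal F_t\big]-\lambda\,F\Big(\mathrm{sd}\big(X^u_T-xe^{r(T-t)}\,\big|\,\mathcal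 F_t\big)\Big),$$ where $X^u$ is started from $x$ at time $t$. A control $\hat u\in\mathcal U$ is called optimal (a Nash equilibrium control law) if for all $t\in[0,T)$, $x\in\mathbb R$, $u\in\mathcal U$ and all sequences $h_n>0$ with $h_n\to 0$, almost surely $$\liminf_{n\to\infty}\frac{J(t,x,\hat u)-J(t,x,u_{h_n})}{h_n}\ \ge\ 0,$$ where $u_h$ equals $u$ on $(t,t+h]$ and $\hat u$ at all other times. Then $$\hat u_t=\frac{\mu-r}{2\lambda\sigma^2}\,e^{-r(T-t)},\qquad t\in(0,T],$$ is an optimal control, and it is the only one: every optimal control coincides with it, almost surely, for all $t\in(0,T]$. The same holds for terminal wealth: $\hat u$ is also the unique optimal control, in the same sense, if the gain $X^u_T-xe^{r(T-t)}$ is replaced by the terminal wealth $X^u_T$ in $J$ (the criterion $\mathbb E[X^u_T\mid\mathcal F_t]-\lambda\,\mathrm{Var}(X^u_T\mid\mathcal F_t)$ of Björk and Murgoci). -/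

import Mathlib

open MeasureTheory ProbabilityTheory Filter Topology Set
open scoped NNReal ENNReal

namespace MeanRisk

variable {Ω : Type*} {mΩ : MeasurableSpace Ω}

/-- `W` is a Brownian motion with respect to the filtration `𝓕`: a real Brownian motion which is
adapted and whose increments after time `s` are independent of `𝓕 s`. The filtration generated by
a Brownian motion is a special case. -/
structure IsBrownianMotion (W : ℝ≥0 → Ω → ℝ) (𝓕 : Filtration ℝ≥0 mΩ) (P : Measure Ω) : Prop where
  isBrownianReal : IsBrownianReal W P
  adapted : ∀ t, Measurable[𝓕 t] (W t)
  indep : ∀ s t, s ≤ t →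
    Indep (MeasurableSpace.comap (fun ω => W t ω - W s ω) (borel ℝ)) (𝓕 s) P

/-- The control space: adapted càglàd processes on `[0, T]` (left-continuous with right limits,
for almost every path) which are bounded by `M`. Values after time `T` play no role. -/
structure IsControl (𝓕 : Filtration ℝ≥0 mΩ) (P : Measure Ω) (T : ℝ≥0) (M : ℝ)
    (u : ℝ≥0 → Ω → ℝ) : Prop where
  adapted : ∀ t ≤ T, Measurable[𝓕 t] (u t)
  bounded : ∀ᵐ ω ∂P, ∀ t ≤ T, |u t ω| ≤ M
  left_continuous : ∀ᵐ ω ∂P, ∀ t, 0 < t → t ≤ T →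
    ContinuousWithinAt (fun s => u s ω) (Iic t) t
  right_limits : ∀ᵐ ω ∂P, ∀ t < T, ∃ l : ℝ, Tendsto (fun s => u s ω) (𝓝[>] t) (𝓝 l)

/-- The `k`-th point of the equidistant partition of `[a, b]` (with `a ≤ b`) into `K` intervals. -/
noncomputable def gridPoint (a b : ℝ≥0) (K k : ℕ) : ℝ≥0 := a + (k : ℝ≥0) / (K : ℝ≥0) * (b - a)

/-- The (non-anticipating) Riemann sum of `H` against `W` over the equidistant partition of
`[a, b]` into `K` intervals. -/
noncomputable def riemannSum (W H : ℝ≥0 → Ω → ℝ) (a b : ℝ≥0) (K : ℕ) (ω : Ω) : ℝ :=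
  ∑ k ∈ Finset.range K, H (gridPoint a b K k) ω *
    (W (gridPoint a b K (k + 1)) ω - W (gridPoint a b K k) ω)

/-- `I` is the stochastic integral `∫_{a+}^b H dW` of an adapted càglàd process `H`: the limit in
probability of the non-anticipating Riemann sums. -/
def IsStochasticIntegral (P : Measure Ω) (W H : ℝ≥0 → Ω → ℝ) (a b : ℝ≥0) (I : Ω → ℝ) : Prop :=
  AEStronglyMeasurable I P ∧ TendstoInMeasure P (fun K => riemannSum W H a b K) atTop I

/-- `X` is the wealth process on `[t, T]` for the control `u` when the wealth at time `t` is `x`,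
i.e. a continuous adapted (up to null sets) solution of
`dX_s = (r X_s + u_s (μ - r)) ds + u_s σ dW_s`, `X_t = x`. -/
structure IsWealthProcess (P : Measure Ω) (𝓕 : Filtration ℝ≥0 mΩ) (W : ℝ≥0 → Ω → ℝ) (T : ℝ≥0)
    (r μ σ : ℝ) (t : ℝ≥0) (x : ℝ) (u X : ℝ≥0 → Ω → ℝ) : Prop where
  adapted : ∀ s ∈ Icc t T, AEStronglyMeasurable[𝓕 s] (X s) P
  continuous : ∀ᵐ ω ∂P, ContinuousOn (fun s => X s ω) (Icc t T)
  sde : ∀ s ∈ Icc t T, ∃ I : Ω → ℝ, IsStochasticIntegral P W u t s I ∧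
    ∀ᵐ ω ∂P, X s ω = x
      + (∫ τ in (t : ℝ)..(s : ℝ), (r * X τ.toNNReal ω + u τ.toNNReal ω * (μ - r))) + σ * I ω

open Classical in
/-- The wealth process `X^u` with wealth `x` at time `t` (it is unique up to indistinguishability
and exists for every control; the value `0` is a placeholder when there is none). -/
noncomputable def wealth (P : Measure Ω) (𝓕 : Filtration ℝ≥0 mΩ) (W : ℝ≥0 → Ω → ℝ) (T : ℝ≥0)
    (r μ σ : ℝ) (t : ℝ≥0) (x : ℝ) (u : ℝ≥0 → Ω → ℝ) : ℝ≥0 → Ω → ℝ :=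
  if h : ∃ X, IsWealthProcess P 𝓕 W T r μ σ t x u X then h.choose else 0

/-- The conditional standard deviation given the σ-algebra `m`. -/
noncomputable def condSD (P : Measure Ω) (m : MeasurableSpace Ω) (Y : Ω → ℝ) (ω : Ω) : ℝ :=
  √(condVar m Y P ω)

/-- The mean-risk functional with reward function `R`, penalty function `F`, risk aversion `lam`,
and the standard deviation as risk measure, applied to `Y` given the information `m`:
`𝔼[R(Y) | m] - lam * F(sd(Y | m))`. -/
noncomputable def meanRisk (P : Measure Ω) (R F : ℝ → ℝ) (lam : ℝ) (m : MeasurableSpace Ω)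
    (Y : Ω → ℝ) (ω : Ω) : ℝ :=
  condExp m P (fun ω' => R (Y ω')) ω - lam * F (condSD P m Y ω)

/-- The value functional `J(t, x, u)` for gains and losses: the mean-risk functional of
`X_T^u - x e^{r(T-t)}`, given the information at time `t` and that the wealth at time `t` is `x`. -/
noncomputable def gainsFunctional (P : Measure Ω) (𝓕 : Filtration ℝ≥0 mΩ) (W : ℝ≥0 → Ω → ℝ)
    (T : ℝ≥0) (r μ σ : ℝ) (R F : ℝ → ℝ) (lam : ℝ)
    (t : ℝ≥0) (x : ℝ) (u : ℝ≥0 → Ω → ℝ) : Ω → ℝ :=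
  meanRisk P R F lam (𝓕 t) (fun ω =>
    wealth P 𝓕 W T r μ σ t x u T ω - x * Real.exp (r * ((T : ℝ) - (t : ℝ))))

/-- The value functional for terminal wealth: the mean-risk functional of `X_T^u`, given the
information at time `t` and that the wealth at time `t` is `x`. -/
noncomputable def terminalWealthFunctional (P : Measure Ω) (𝓕 : Filtration ℝ≥0 mΩ)
    (W : ℝ≥0 → Ω → ℝ) (T : ℝ≥0) (r μ σ : ℝ) (R F : ℝ → ℝ) (lam : ℝ)
    (t : ℝ≥0) (x : ℝ) (u : ℝ≥0 → Ω → ℝ) : Ω → ℝ :=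
  meanRisk P R F lam (𝓕 t) (wealth P 𝓕 W T r μ σ t x u T)

/-- The perturbed control `u_h`: it follows `u` on a period of length `h` after time `t` and
`uhat` otherwise. The period is `(t, t + h]`, which keeps paths left-continuous; the investment at
the single instant `t` does not affect the wealth. -/
noncomputable def perturb (uhat u : ℝ≥0 → Ω → ℝ) (t h : ℝ≥0) : ℝ≥0 → Ω → ℝ :=
  fun s ω => if t < s ∧ s ≤ t + h then u s ω else uhat s ω

/-- `uhat` is a Nash equilibrium control law (an optimal control) for the value functional `J`:
for all `(t, x)` and all controls `u`,
`liminf_{h → 0+} (J(t, x, uhat) - J(t, x, u_h)) / h ≥ 0` almost surely.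
The values of `J` are random variables determined up to null sets that may depend on `h`; so the
limit inferior is taken along arbitrary sequences `h_n → 0+`. -/
structure IsNashEquilibrium (P : Measure Ω) (𝓕 : Filtration ℝ≥0 mΩ) (T : ℝ≥0) (M : ℝ)
    (J : ℝ≥0 → ℝ → (ℝ≥0 → Ω → ℝ) → Ω → ℝ) (uhat : ℝ≥0 → Ω → ℝ) : Prop where
  isControl : IsControl 𝓕 P T M uhat
  equilibrium : ∀ t < T, ∀ x : ℝ, ∀ u, IsControl 𝓕 P T M u →
    ∀ h : ℕ → ℝ≥0, (∀ n, 0 < h n) → Tendsto h atTop (𝓝 0) →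
      ∀ᵐ ω ∂P, (0 : EReal) ≤ liminf (fun n =>
        (((J t x uhat ω - J t x (perturb uhat u t (h n)) ω) / (h n : ℝ) : ℝ) : EReal)) atTop

/-- `c` is, up to indistinguishability on `(0, T]`, the one and only Nash equilibrium control law
for `J`. -/
def IsUniqueNashEquilibrium (P : Measure Ω) (𝓕 : Filtration ℝ≥0 mΩ) (T : ℝ≥0) (M : ℝ)
    (J : ℝ≥0 → ℝ → (ℝ≥0 → Ω → ℝ) → Ω → ℝ) (c : ℝ≥0 → Ω → ℝ) : Prop :=
  IsNashEquilibrium P 𝓕 T M J c ∧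
    ∀ u, IsNashEquilibrium P 𝓕 T M J u → ∀ᵐ ω ∂P, ∀ t, 0 < t → t ≤ T → u t ω = c t ω

end MeanRisk

/-!
The argument takes place in the Hilbert space `PathSpace` of square integrable `L²(P)`-valued paths
on `(0, T]`. An investment strategy `u` enters through its compounded path
`w τ = exp (r (T - τ)) u τ`, and the wealth equation integrates to
`X_T = x exp (r (T - t)) + (μ - r) ∫ w dτ + σ ∫ w dW` (`IsItoIntegral.wealth_ae_eq`). The Itô
integral is the operator `I` on `PathSpace` that is isometric on the closed span of the elementary
adapted integrands; it comes from the equality of the Gram matrices of the elementary integrands and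
of their integrals. Existence of a continuous wealth process rests on a maximal inequality
(`IsItoIntegral.exists_continuous_version`), uniqueness on Gronwall's lemma.

Both functionals are therefore, up to a constant which depends only on `(t, x)`, the conditional
mean-variance criterion of the gain `(μ - r) ∫ w dτ + σ ∫ w dW` over `(t, T]`, and it suffices to
compare the integrals of this criterion over events `A` known at time `t`. The candidate is the
control with constant compounded path `c = (μ - r) / (2 lam σ²)`. This value of `c` is such that for
every variation `δ` of the investments the change of the mean is cancelled by the covariance of
`∫ δ dW` with the gain of the constant path (`IsItoIntegral.setIntegral_variation`).

* Equilibrium: around the constant path only a nonnegative variance and the covariance of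
  the unpredictable part of `∫ δ dτ` with the stochastic integral of `c` over `(t, t + h]` remain.
  The latter is of order `h ^ (3 / 2)`, uniformly over `A`
  (`IsItoIntegral.setIntegral_variation_const_ge`).
* Uniqueness: let `y` be the deviation of an equilibrium from `c`, and switch to `c` on
  `(t, t + h]`. At Lebesgue points `t` in `(a, T]` the equilibrium condition yields, with `ψ` the
  adjoint of `I` applied to `∫_a^T y dτ`, the inequality
  `σ ‖y_t‖² + 2 (μ - r) ⟪y_t, ψ_t⟫ ≤ 0` (`IsItoIntegral.first_order_condition`). Integrating over
  `t` bounds `σ ‖y‖²` by `2 |μ - r| ‖y‖ ‖∫_a^T y dτ‖`. If `y` vanishes after `b`, then the last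
  factor is at most `√(b - a) ‖y‖`, so `y` vanishes after `a` as soon as `b - a` is small, and
  backward induction gives `y = 0` (`IsItoIntegral.seg_deviation_eq_zero`). Left-continuity of the
  paths turns this into indistinguishability.
-/

open MeasureTheory ProbabilityTheory Filter Topology Set
open scoped NNReal ENNReal

set_option linter.unusedSectionVars false

namespace MeanRisk

/-! ### Step functions along equidistant partitions -/

section StepFunctions

variable {F : Type*} [NormedAddCommGroup F]

/-- The `k`-th point of the equidistant partition of `[a, b]` into `K` intervals, as a real
number. -/
noncomputable def realGrid (a b : ℝ) (K k : ℕ) : ℝ := a + k / K * (b - a)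

/-- The step function which on each interval `(g_k, g_{k+1}]` of the equidistant partition of
`[a, b]` takes the value of `f` at the left endpoint `g_k`; it vanishes outside `(a, b]`. -/
noncomputable def stepFun (f : ℝ → F) (a b : ℝ) (K : ℕ) (τ : ℝ) : F :=
  ∑ k ∈ Finset.range K,
    (Ioc (realGrid a b K k) (realGrid a b K (k + 1))).indicator (fun _ => f (realGrid a b K k)) τ

lemma realGrid_mono {a b : ℝ} (hab : a ≤ b) (K : ℕ) : Monotone (realGrid a b K) := by
  intro i j hij
  have h : (i : ℝ) / K ≤ j / K := by gcongr
  have := mul_le_mul_of_nonneg_right h (sub_nonneg.2 hab)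
  simp only [realGrid]
  linarith

lemma realGrid_zero (a b : ℝ) (K : ℕ) : realGrid a b K 0 = a := by simp [realGrid]

lemma realGrid_self (a b : ℝ) {K : ℕ} (hK : K ≠ 0) : realGrid a b K K = b := by
  have : (K : ℝ) ≠ 0 := by exact_mod_cast hK
  simp [realGrid, this]

lemma realGrid_mem {a b : ℝ} (hab : a ≤ b) {K k : ℕ} (hK : K ≠ 0) (hk : k ≤ K) :
    realGrid a b K k ∈ Icc a b := by
  constructor
  · simpa [realGrid_zero] using realGrid_mono hab K (Nat.zero_le k)
  · simpa [realGrid_self a b hK] using realGrid_mono hab K hk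

lemma realGrid_succ_sub (a b : ℝ) (K k : ℕ) :
    realGrid a b K (k + 1) - realGrid a b K k = (b - a) / K := by
  simp only [realGrid, Nat.cast_add, Nat.cast_one]
  ring

lemma stepFun_of_mem_Ioc (f : ℝ → F) {a b : ℝ} (hab : a ≤ b) {K k : ℕ} (hk : k < K) {τ : ℝ}
    (hτ : τ ∈ Ioc (realGrid a b K k) (realGrid a b K (k + 1))) :
    stepFun f a b K τ = f (realGrid a b K k) := by
  rw [stepFun, Finset.sum_eq_single k]
  · simp [hτ]
  · intro j _ hj
    apply indicator_of_notMem
    intro hτ'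
    have := (realGrid_mono hab K).pairwise_disjoint_on_Ioc_succ hj
    exact Set.disjoint_left.1 this (by simpa using hτ') (by simpa using hτ)
  · intro h
    exact absurd (Finset.mem_range.2 hk) h

lemma exists_mem_Ioc_realGrid {a b : ℝ} {K : ℕ} (hK : K ≠ 0) {τ : ℝ}
    (hτ : τ ∈ Ioc a b) : ∃ k < K, τ ∈ Ioc (realGrid a b K k) (realGrid a b K (k + 1)) := by
  classical
  have hex : ∃ k, τ ≤ realGrid a b K (k + 1) := ⟨K - 1, by
    rw [Nat.sub_add_cancel (Nat.one_le_iff_ne_zero.2 hK), realGrid_self a b hK]; exact hτ.2⟩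
  refine ⟨Nat.find hex, ?_, ?_, Nat.find_spec hex⟩
  · have : Nat.find hex ≤ K - 1 := Nat.find_min' hex (by
      rw [Nat.sub_add_cancel (Nat.one_le_iff_ne_zero.2 hK), realGrid_self a b hK]; exact hτ.2)
    omega
  · rcases Nat.eq_zero_or_pos (Nat.find hex) with h | h
    · rw [h, realGrid_zero]; exact hτ.1
    · have := Nat.find_min hex (Nat.sub_lt h one_pos)
      rw [Nat.sub_add_cancel (show 1 ≤ Nat.find hex from h)] at this
      exact not_le.1 this

lemma stepFun_of_notMem (f : ℝ → F) {a b : ℝ} (hab : a ≤ b) (K : ℕ) {τ : ℝ}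
    (hτ : τ ∉ Ioc a b) : stepFun f a b K τ = 0 := by
  apply Finset.sum_eq_zero
  intro k hk
  have hk := Finset.mem_range.1 hk
  apply indicator_of_notMem
  intro h
  have hK : K ≠ 0 := by omega
  exact hτ ⟨(realGrid_mem hab hK hk.le).1.trans_lt h.1, h.2.trans (realGrid_mem hab hK hk).2⟩

lemma stronglyMeasurable_stepFun (f : ℝ → F) (a b : ℝ) (K : ℕ) :
    StronglyMeasurable (stepFun f a b K) := by
  unfold stepFun
  refine Finset.stronglyMeasurable_fun_sum _ fun k _ => ?_
  exact stronglyMeasurable_const.indicator measurableSet_Ioc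

lemma norm_stepFun_le (f : ℝ → F) {a b C : ℝ} (hab : a ≤ b) (hf : ∀ τ ∈ Icc a b, ‖f τ‖ ≤ C)
    (K : ℕ) (τ : ℝ) : ‖stepFun f a b K τ‖ ≤ C := by
  have hC : 0 ≤ C := (norm_nonneg _).trans (hf a (left_mem_Icc.2 hab))
  by_cases hτ : τ ∈ Ioc a b
  · rcases eq_or_ne K 0 with rfl | hK
    · simpa [stepFun] using hC
    obtain ⟨k, hk, h⟩ := exists_mem_Ioc_realGrid hK hτ
    rw [stepFun_of_mem_Ioc f hab hk h]
    exact hf _ (realGrid_mem hab hK hk.le)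
  · rw [stepFun_of_notMem f hab K hτ]; simpa using hC

lemma tendsto_stepFun {f : ℝ → F} {a b : ℝ} (hab : a ≤ b)
    (hf : ∀ τ ∈ Ioc a b, ContinuousWithinAt f (Iic τ) τ) (τ : ℝ) :
    Tendsto (fun K => stepFun f a b K τ) atTop (𝓝 ((Ioc a b).indicator f τ)) := by
  by_cases hτ : τ ∈ Ioc a b
  · rw [indicator_of_mem hτ]
    -- the partition point just before `τ`
    have key : ∀ K : ℕ, ∃ p : ℝ, K ≠ 0 →
        p ≤ τ ∧ τ - (b - a) / K ≤ p ∧ stepFun f a b K τ = f p := by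
      intro K
      by_cases hK : K = 0
      · exact ⟨0, fun h => absurd hK h⟩
      obtain ⟨k, hk, h⟩ := exists_mem_Ioc_realGrid hK hτ
      refine ⟨realGrid a b K k, fun _ => ⟨h.1.le, ?_, stepFun_of_mem_Ioc f hab hk h⟩⟩
      have := realGrid_succ_sub a b K k
      linarith [h.2]
    choose p hp using key
    have hlim : Tendsto p atTop (𝓝[Iic τ] τ) := by
      refine tendsto_nhdsWithin_iff.2 ⟨?_, ?_⟩
      · have h0 : Tendsto (fun K : ℕ => τ - (b - a) / K) atTop (𝓝 τ) := by
          simpa using (tendsto_const_nhds (x := τ)).sub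
            (tendsto_const_div_atTop_nhds_zero_nat (b - a))
        refine tendsto_of_tendsto_of_tendsto_of_le_of_le' h0 tendsto_const_nhds ?_ ?_
        · filter_upwards [eventually_ne_atTop 0] with K hK using (hp K hK).2.1
        · filter_upwards [eventually_ne_atTop 0] with K hK using (hp K hK).1
      · filter_upwards [eventually_ne_atTop 0] with K hK using (hp K hK).1
    refine ((hf τ hτ).tendsto.comp hlim).congr' ?_
    filter_upwards [eventually_ne_atTop 0] with K hK using (hp K hK).2.2.symm
  · rw [indicator_of_notMem hτ]
    simp only [stepFun_of_notMem f hab _ hτ]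
    exact tendsto_const_nhds

lemma stronglyMeasurable_indicator_of_leftCont {f : ℝ → F} {a b : ℝ} (hab : a ≤ b)
    (hf : ∀ τ ∈ Ioc a b, ContinuousWithinAt f (Iic τ) τ) :
    StronglyMeasurable ((Ioc a b).indicator f) :=
  stronglyMeasurable_of_tendsto atTop (fun K => stronglyMeasurable_stepFun f a b K)
    (tendsto_pi_nhds.2 fun τ => tendsto_stepFun hab hf τ)

lemma integral_stepFun [NormedSpace ℝ F] [CompleteSpace F] (f : ℝ → F) {a b : ℝ} (hab : a ≤ b)
    (K : ℕ) :
    ∫ τ, stepFun f a b K τ = ∑ k ∈ Finset.range K, ((b - a) / K) • f (realGrid a b K k) := by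
  unfold stepFun
  rw [integral_finsetSum]
  · refine Finset.sum_congr rfl fun k _ => ?_
    rw [integral_indicator_const _ measurableSet_Ioc, measureReal_def, Real.volume_Ioc,
      realGrid_succ_sub, ENNReal.toReal_ofReal]
    exact div_nonneg (sub_nonneg.2 hab) (Nat.cast_nonneg K)
  · intro k _
    exact (integrable_indicator_iff measurableSet_Ioc).2 (integrableOn_const (by simp) (by simp))

lemma intervalIntegrable_of_leftCont {f : ℝ → F} {a b C : ℝ} (hab : a ≤ b)
    (hf : ∀ τ ∈ Ioc a b, ContinuousWithinAt f (Iic τ) τ) (hC : ∀ τ ∈ Icc a b, ‖f τ‖ ≤ C) :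
    IntervalIntegrable f volume a b := by
  rw [intervalIntegrable_iff_integrableOn_Ioc_of_le hab]
  have hm : AEStronglyMeasurable f (volume.restrict (Ioc a b)) :=
    (aestronglyMeasurable_indicator_iff measurableSet_Ioc).1
      (stronglyMeasurable_indicator_of_leftCont hab hf).aestronglyMeasurable
  refine Integrable.of_bound (C := C) hm ?_
  filter_upwards [ae_restrict_mem measurableSet_Ioc] with τ hτ using hC τ ⟨hτ.1.le, hτ.2⟩

/-- The left Riemann sums of a bounded left-continuous function converge to its integral. -/
lemma tendsto_riemann [NormedSpace ℝ F] [CompleteSpace F] {f : ℝ → F} {a b C : ℝ} (hab : a ≤ b)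
    (hf : ∀ τ ∈ Ioc a b, ContinuousWithinAt f (Iic τ) τ) (hC : ∀ τ ∈ Icc a b, ‖f τ‖ ≤ C) :
    Tendsto (fun K : ℕ => ∑ k ∈ Finset.range K, ((b - a) / K) • f (realGrid a b K k)) atTop
      (𝓝 (∫ τ in a..b, f τ)) := by
  have h0 : ∫ τ in a..b, f τ = ∫ τ, (Ioc a b).indicator f τ := by
    rw [intervalIntegral.integral_of_le hab, integral_indicator measurableSet_Ioc]
  rw [h0]
  simp_rw [← integral_stepFun f hab]
  have hC0 : 0 ≤ C := (norm_nonneg _).trans (hC a (left_mem_Icc.2 hab))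
  refine tendsto_integral_of_dominated_convergence ((Ioc a b).indicator fun _ => C)
    (fun K => (stronglyMeasurable_stepFun f a b K).aestronglyMeasurable) ?_ ?_ ?_
  · exact (integrable_indicator_iff measurableSet_Ioc).2 (integrableOn_const (by simp) (by simp))
  · intro K
    refine ae_of_all _ fun τ => ?_
    by_cases hτ : τ ∈ Ioc a b
    · simpa [hτ] using norm_stepFun_le f hab hC K τ
    · simp [stepFun_of_notMem f hab K hτ, hτ]
  · exact ae_of_all _ fun τ => tendsto_stepFun hab hf τ

end StepFunctions

/-! ### Functions as elements of `L²` -/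

section ToL2

variable {α : Type*} {mα : MeasurableSpace α} {F : Type*} [NormedAddCommGroup F]

open Classical in
/-- The class of `f` in `L²(μ)`, with the junk value `0` when `f` is not square integrable. -/
noncomputable def toL2 (μ : Measure α) (f : α → F) : Lp F 2 μ :=
  if h : MemLp f 2 μ then h.toLp f else 0

variable {μ : Measure α}

lemma toL2_eq {f : α → F} (h : MemLp f 2 μ) : toL2 μ f = h.toLp f := dif_pos h

lemma coeFn_toL2 {f : α → F} (h : MemLp f 2 μ) : toL2 μ f =ᵐ[μ] f := by
  rw [toL2_eq h]; exact h.coeFn_toLp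

lemma toL2_congr {f g : α → F} (h : f =ᵐ[μ] g) : toL2 μ f = toL2 μ g := by
  by_cases hf : MemLp f 2 μ
  · have hg : MemLp g 2 μ := hf.ae_eq h
    rw [toL2_eq hf, toL2_eq hg]
    exact (MemLp.toLp_eq_toLp_iff hf hg).2 h
  · have hg : ¬ MemLp g 2 μ := fun h' => hf (h'.ae_eq h.symm)
    simp [toL2, hf, hg]

lemma toL2_coeFn (f : Lp F 2 μ) : toL2 μ f = f := by
  rw [toL2_eq (Lp.memLp f), Lp.toLp_coeFn]

lemma eq_toL2_of_ae_eq {z : Lp F 2 μ} {f : α → F} (h : z =ᵐ[μ] f) : z = toL2 μ f := by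
  rw [← toL2_congr h, toL2_coeFn]

lemma toL2_add {f g : α → F} (hf : MemLp f 2 μ) (hg : MemLp g 2 μ) :
    toL2 μ (f + g) = toL2 μ f + toL2 μ g := by
  rw [toL2_eq hf, toL2_eq hg, toL2_eq (hf.add hg)]; rfl

lemma toL2_sub {f g : α → F} (hf : MemLp f 2 μ) (hg : MemLp g 2 μ) :
    toL2 μ (f - g) = toL2 μ f - toL2 μ g := by
  rw [toL2_eq hf, toL2_eq hg, toL2_eq (hf.sub hg)]; rfl

lemma toL2_sum {ι : Type*} (s : Finset ι) {f : ι → α → F} (hf : ∀ i ∈ s, MemLp (f i) 2 μ) :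
    toL2 μ (fun x => ∑ i ∈ s, f i x) = ∑ i ∈ s, toL2 μ (f i) := by
  classical
  induction s using Finset.induction_on with
  | empty =>
    have : MemLp (fun _ : α => (0 : F)) 2 μ := MemLp.zero
    simp only [Finset.sum_empty]
    rw [toL2_eq this]
    exact MemLp.toLp_zero this
  | insert i s hi ih =>
    have h1 : MemLp (fun x => ∑ j ∈ s, f j x) 2 μ :=
      memLp_finsetSum s fun j hj => hf j (Finset.mem_insert_of_mem hj)
    simp only [Finset.sum_insert hi]
    rw [← ih fun j hj => hf j (Finset.mem_insert_of_mem hj)]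
    exact toL2_add (hf i (Finset.mem_insert_self i s)) h1

lemma toL2_const_smul {𝕜 : Type*} [NormedField 𝕜] [NormedSpace 𝕜 F] {f : α → F} (c : 𝕜)
    (hf : MemLp f 2 μ) : toL2 μ (fun x => c • f x) = c • toL2 μ f := by
  have h : MemLp (fun x => c • f x) 2 μ := hf.const_smul c
  rw [toL2_eq hf, toL2_eq h]; rfl

lemma tendsto_eLpNorm_two_of_dominated [IsFiniteMeasure μ] {f : ℕ → α → F} {g : α → F} {C : ℝ}
    (hf : ∀ n, AEStronglyMeasurable (f n) μ) (hb : ∀ n, ∀ᵐ x ∂μ, ‖f n x‖ ≤ C)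
    (hlim : ∀ᵐ x ∂μ, Tendsto (fun n => f n x) atTop (𝓝 (g x))) :
    MemLp g 2 μ ∧ Tendsto (fun n => toL2 μ (f n)) atTop (𝓝 (toL2 μ g)) := by
  have hgm : AEStronglyMeasurable g μ := aestronglyMeasurable_of_tendsto_ae atTop hf hlim
  have hgb : ∀ᵐ x ∂μ, ‖g x‖ ≤ C := by
    filter_upwards [hlim, ae_all_iff.2 hb] with x hx hbx
    exact le_of_tendsto hx.norm (Eventually.of_forall hbx)
  have hg : MemLp g 2 μ := MemLp.of_bound hgm C hgb
  have hfn : ∀ n, MemLp (f n) 2 μ := fun n => MemLp.of_bound (hf n) C (hb n)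
  refine ⟨hg, ?_⟩
  rw [toL2_eq hg]
  simp_rw [fun n => toL2_eq (hfn n)]
  rw [Lp.tendsto_Lp_iff_tendsto_eLpNorm'']
  have h2 : Tendsto (fun n => ∫⁻ x, ‖f n x - g x‖ₑ ^ (2 : ℝ) ∂μ) atTop (𝓝 0) := by
    have := tendsto_lintegral_of_dominated_convergence' (μ := μ)
      (F := fun n x => ‖f n x - g x‖ₑ ^ (2 : ℝ)) (f := fun _ => 0)
      (fun _ => (ENNReal.ofReal (2 * C)) ^ (2 : ℝ))
      (fun n => ((hf n).sub hgm).enorm.pow_const _) ?_ ?_ ?_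
    · simpa using this
    · intro n
      filter_upwards [hb n, hgb] with x h1 h2
      gcongr
      rw [← ofReal_norm]
      exact ENNReal.ofReal_le_ofReal ((norm_sub_le _ _).trans (by linarith))
    · rw [lintegral_const]
      exact ENNReal.mul_ne_top (ENNReal.rpow_ne_top_of_nonneg (by norm_num) ENNReal.ofReal_ne_top)
        (measure_ne_top μ univ)
    · filter_upwards [hlim] with x hx
      have h3 : Tendsto (fun n => f n x - g x) atTop (𝓝 0) := by
        simpa using hx.sub (tendsto_const_nhds (x := g x))
      have h4 : Tendsto (fun n => ‖f n x - g x‖ₑ) atTop (𝓝 0) := by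
        simpa using h3.enorm
      simpa [Function.comp_def] using (ENNReal.continuous_rpow_const (y := 2)).tendsto 0 |>.comp h4
  have h5 : Tendsto (fun n => (∫⁻ x, ‖f n x - g x‖ₑ ^ (2 : ℝ) ∂μ) ^ (1 / 2 : ℝ)) atTop (𝓝 0) := by
    simpa [Function.comp_def] using
      (ENNReal.continuous_rpow_const (y := 1 / 2)).tendsto 0 |>.comp h2
  refine h5.congr fun n => ?_
  rw [eLpNorm_eq_lintegral_rpow_enorm_toReal (by simp) (by simp)]
  simp

end ToL2

/-! ### Isometries from equal Gram matrices -/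

section Gram

variable {H E : Type*} [NormedAddCommGroup H] [InnerProductSpace ℝ H] [CompleteSpace H]
  [NormedAddCommGroup E] [InnerProductSpace ℝ E] [CompleteSpace E]

/-- The closed linear span of a set. -/
abbrev closedSpan (s : Set H) : Submodule ℝ H := (Submodule.span ℝ s).topologicalClosure

lemma norm_linearCombination_eq {ι : Type*} {e : ι → H} {f : ι → E}
    (h : ∀ i j, inner ℝ (e i) (e j) = inner ℝ (f i) (f j)) (c : ι →₀ ℝ) :
    ‖Finsupp.linearCombination ℝ e c‖ = ‖Finsupp.linearCombination ℝ f c‖ := by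
  have key : ‖Finsupp.linearCombination ℝ e c‖ ^ 2 = ‖Finsupp.linearCombination ℝ f c‖ ^ 2 := by
    rw [← real_inner_self_eq_norm_sq, ← real_inner_self_eq_norm_sq]
    simp only [Finsupp.linearCombination_apply, Finsupp.sum, sum_inner, inner_sum,
      real_inner_smul_left, real_inner_smul_right, h]
  exact (sq_eq_sq₀ (norm_nonneg _) (norm_nonneg _)).1 key

/-- If two families in Hilbert spaces have the same Gram matrix, then mapping one to the other
extends to a bounded operator which is isometric on the closed span of the first family. -/
lemma exists_clm_of_gram_eq {ι : Type*} (e : ι → H) (f : ι → E)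
    (h : ∀ i j, inner ℝ (e i) (e j) = inner ℝ (f i) (f j)) :
    ∃ I : H →L[ℝ] E, (∀ i, I (e i) = f i) ∧
      ∀ φ ∈ closedSpan (range e), ∀ φ' ∈ closedSpan (range e),
        inner ℝ (I φ) (I φ') = inner ℝ φ φ' := by
  set Te := Finsupp.linearCombination ℝ e with hTe
  set Tf := Finsupp.linearCombination ℝ f with hTf
  set S := LinearMap.range Te with hS
  obtain ⟨s, hs⟩ := LinearMap.exists_rightInverse_of_surjective Te.rangeRestrict
    (LinearMap.range_rangeRestrict Te)
  have hs' : ∀ v : S, Te (s v) = v := fun v => by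
    have := LinearMap.congr_fun hs v
    simpa using congrArg Subtype.val this
  have hnorm : ∀ v, ‖(Tf ∘ₗ s) v‖ = ‖v‖ := fun v => by
    rw [LinearMap.comp_apply, ← norm_linearCombination_eq h, ← hTe, hs' v]; rfl
  have hTfs : ∀ c, Tf (s (Te.rangeRestrict c)) = Tf c := fun c => by
    rw [← sub_eq_zero, ← map_sub, ← norm_eq_zero, ← norm_linearCombination_eq h, ← hTe, map_sub,
      hs']
    simp
  have hrange : LinearMap.range Te = Submodule.span ℝ (range e) := Finsupp.range_linearCombination ℝ
  let g : S →L[ℝ] E := (Tf ∘ₗ s).mkContinuous 1 fun v => by rw [hnorm, one_mul]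
  have hgn : ∀ v, ‖g v‖ = ‖v‖ := hnorm
  -- extend from the span to its closure `V`, and by zero on the orthogonal complement of `V`
  let V := S.topologicalClosure
  let ι' : S →L[ℝ] V :=
    { toLinearMap := Submodule.inclusion S.le_topologicalClosure
      cont := by
        refine Continuous.subtype_mk continuous_subtype_val _ }
  have hι' : IsUniformInducing ι' :=
    (AddMonoidHomClass.isometry_of_norm ι' fun v => rfl).isUniformInducing
  have hdense : DenseRange ι' := by
    rw [DenseRange, dense_iff_closure_eq]
    apply eq_univ_of_forall
    intro v
    rw [Topology.IsInducing.subtypeVal.closure_eq_preimage_closure_image]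
    have : (Subtype.val '' (range ι') : Set H) = S := by
      ext x
      constructor
      · rintro ⟨_, ⟨y, rfl⟩, rfl⟩
        exact y.2
      · intro hx
        exact ⟨ι' ⟨x, hx⟩, ⟨_, rfl⟩, rfl⟩
    change (v : H) ∈ closure (Subtype.val '' (range ι') : Set H)
    rw [this]
    exact v.2
  let G : V →L[ℝ] E := g.extend ι'
  have hG : ∀ v, G (ι' v) = g v := fun v => ContinuousLinearMap.extend_eq g hdense hι' v
  have hGn : ∀ v, ‖G v‖ = ‖v‖ := by
    intro v
    refine hdense.induction_on v (isClosed_eq G.continuous.norm continuous_norm) fun w => ?_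
    rw [hG, hgn]; rfl
  have : CompleteSpace V := (Submodule.isClosed_topologicalClosure S).completeSpace_coe
  let I : H →L[ℝ] E := G.comp V.orthogonalProjectionOnto
  have hI : ∀ φ (hφ : φ ∈ V), I φ = G ⟨φ, hφ⟩ := fun φ hφ => by
    change G (V.orthogonalProjectionOnto φ) = _
    congr 1
    exact Submodule.orthogonalProjectionOnto_mem_subspace_eq_self (⟨φ, hφ⟩ : V)
  have hVeq : closedSpan (range e) = V := by rw [closedSpan, ← hrange]
  refine ⟨I, fun i => ?_, fun φ hφ φ' hφ' => ?_⟩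
  · have hei : e i = Te (Finsupp.single i 1) := by simp [hTe]
    have hmem : e i ∈ S := hei ▸ LinearMap.mem_range_self Te _
    rw [hI _ (S.le_topologicalClosure hmem)]
    have h1 : (⟨e i, S.le_topologicalClosure hmem⟩ : V)
        = ι' (Te.rangeRestrict (Finsupp.single i 1)) := by
      apply Subtype.ext
      exact hei
    rw [h1, hG]
    exact (hTfs (Finsupp.single i 1)).trans (by simp [hTf])
  · rw [hVeq] at hφ hφ'
    rw [hI φ hφ, hI φ' hφ']
    let Gi : V →ₗᵢ[ℝ] E := ⟨G.toLinearMap, hGn⟩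
    exact Gi.inner_map_map ⟨φ, hφ⟩ ⟨φ', hφ'⟩

end Gram

/-! ### Second moments of Brownian increments -/

section Moments

variable {Ω : Type*} {mΩ : MeasurableSpace Ω} {P : Measure Ω} [IsProbabilityMeasure P]
  {𝓕 : Filtration ℝ≥0 mΩ} {W : ℝ≥0 → Ω → ℝ}

lemma IsBrownianMotion.measurable (hW : IsBrownianMotion W 𝓕 P) (t : ℝ≥0) : Measurable (W t) :=
  (hW.adapted t).mono (𝓕.le t) le_rfl

lemma IsBrownianMotion.memLp_increment (hW : IsBrownianMotion W 𝓕 P) (s t : ℝ≥0) :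
    MemLp (fun ω => W t ω - W s ω) 2 P :=
  (hW.isBrownianReal.isGaussianProcess.hasGaussianLaw_eval t).memLp_two.sub
    (hW.isBrownianReal.isGaussianProcess.hasGaussianLaw_eval s).memLp_two

lemma IsBrownianMotion.indepFun (hW : IsBrownianMotion W 𝓕 P) {s t : ℝ≥0} (hst : s ≤ t)
    {g : Ω → ℝ} (hg : Measurable[𝓕 s] g) : IndepFun (fun ω => W t ω - W s ω) g P := by
  rw [IndepFun_iff_Indep]
  have h := hW.indep s t hst
  have hle : MeasurableSpace.comap g inferInstance ≤ 𝓕 s := hg.comap_le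
  have hb : (borel ℝ) = (inferInstance : MeasurableSpace ℝ) := (BorelSpace.measurable_eq).symm
  rw [hb] at h
  exact indep_of_indep_of_le_right h hle

lemma IsBrownianMotion.integral_increment (hW : IsBrownianMotion W 𝓕 P) (s t : ℝ≥0) :
    ∫ ω, (W t ω - W s ω) ∂P = 0 := by
  rw [integral_sub (hW.isBrownianReal.integrable_eval t) (hW.isBrownianReal.integrable_eval s),
    hW.isBrownianReal.integral_eval, hW.isBrownianReal.integral_eval, sub_zero]

lemma IsBrownianMotion.integral_increment_sq (hW : IsBrownianMotion W 𝓕 P) {s t : ℝ≥0}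
    (hst : s ≤ t) : ∫ ω, (W t ω - W s ω) ^ 2 ∂P = (t : ℝ) - s := by
  have h2 : ∀ u, MemLp (W u) 2 P := fun u =>
    (hW.isBrownianReal.isGaussianProcess.hasGaussianLaw_eval u).memLp_two
  have h1 : Var[W t - W s; P] = (t : ℝ) - s := by
    rw [variance_sub (h2 t) (h2 s), ← covariance_self (hW.measurable t).aemeasurable,
      ← covariance_self (hW.measurable s).aemeasurable, hW.isBrownianReal.covariance_eval,
      hW.isBrownianReal.covariance_eval, hW.isBrownianReal.covariance_eval]
    rw [min_eq_right hst]
    simp only [min_self]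
    ring
  rw [variance_of_integral_eq_zero] at h1
  · simpa using h1
  · exact ((hW.measurable t).sub (hW.measurable s)).aemeasurable
  · simpa using hW.integral_increment s t

/-- Increments after `s` are orthogonal to everything known at time `s`. -/
lemma IsBrownianMotion.integral_mul_increment (hW : IsBrownianMotion W 𝓕 P) {s t : ℝ≥0}
    (hst : s ≤ t) {g : Ω → ℝ} (hg : Measurable[𝓕 s] g) :
    ∫ ω, g ω * (W t ω - W s ω) ∂P = 0 := by
  have h := (hW.indepFun hst hg).symm.integral_mul_eq_mul_integral
    (hg.mono (𝓕.le s) le_rfl).aestronglyMeasurable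
    ((hW.measurable t).sub (hW.measurable s)).aestronglyMeasurable
  have h' : ∫ ω, g ω * (W t ω - W s ω) ∂P = (∫ ω, g ω ∂P) * ∫ ω, (W t ω - W s ω) ∂P := h
  rw [h', hW.integral_increment, mul_zero]

lemma IsBrownianMotion.integral_mul_increment_sq (hW : IsBrownianMotion W 𝓕 P) {s t : ℝ≥0}
    (hst : s ≤ t) {g : Ω → ℝ} (hg : Measurable[𝓕 s] g) :
    ∫ ω, g ω * (W t ω - W s ω) ^ 2 ∂P = (∫ ω, g ω ∂P) * (t - s) := by
  have hi : IndepFun g (fun ω => (W t ω - W s ω) ^ 2) P :=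
    (hW.indepFun hst hg).symm.comp measurable_id (measurable_id.pow_const 2)
  have h := hi.integral_mul_eq_mul_integral
    (hg.mono (𝓕.le s) le_rfl).aestronglyMeasurable
    (((hW.measurable t).sub (hW.measurable s)).pow_const 2).aestronglyMeasurable
  have h' : ∫ ω, g ω * (W t ω - W s ω) ^ 2 ∂P
      = (∫ ω, g ω ∂P) * ∫ ω, (W t ω - W s ω) ^ 2 ∂P := h
  rw [h', hW.integral_increment_sq hst]

/-- The Itô isometry for a pair of elementary integrands which start at the same time. -/
lemma IsBrownianMotion.integral_mul_increment_mul_increment (hW : IsBrownianMotion W 𝓕 P)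
    {c b d : ℝ≥0} (hcb : c ≤ b) (hbd : b ≤ d) {g : Ω → ℝ} (hg : Measurable[𝓕 c] g) {C : ℝ}
    (hC : ∀ᵐ ω ∂P, |g ω| ≤ C) :
    ∫ ω, g ω * (W b ω - W c ω) * (W d ω - W c ω) ∂P = (∫ ω, g ω ∂P) * (b - c) := by
  have hgm : AEStronglyMeasurable g P := (hg.mono (𝓕.le c) le_rfl).aestronglyMeasurable
  have hbc := hW.memLp_increment c b
  have hdb := hW.memLp_increment b d
  have hint1 : Integrable (fun ω => g ω * (W b ω - W c ω) ^ 2) P :=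
    hbc.integrable_sq.bdd_mul hgm hC
  have hint2 : Integrable (fun ω => g ω * (W b ω - W c ω) * (W d ω - W b ω)) P := by
    have : Integrable (fun ω => (W b ω - W c ω) * (W d ω - W b ω)) P := hbc.integrable_mul hdb
    simpa [mul_assoc] using this.bdd_mul hgm hC
  have h1 : ∀ ω, g ω * (W b ω - W c ω) * (W d ω - W c ω)
      = g ω * (W b ω - W c ω) ^ 2 + g ω * (W b ω - W c ω) * (W d ω - W b ω) := fun ω => by ring
  simp_rw [h1]
  rw [integral_add hint1 hint2, hW.integral_mul_increment_sq hcb hg, hW.integral_mul_increment hbd,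
    add_zero]
  exact (hg.mono (𝓕.mono hcb) le_rfl).mul
    (((hW.adapted b)).sub ((hW.adapted c).mono (𝓕.mono hcb) le_rfl))

/-- The **Itô isometry** for elementary integrands. -/
lemma IsBrownianMotion.integral_elementary_mul (hW : IsBrownianMotion W 𝓕 P)
    {a b c d : ℝ≥0} (hab : a ≤ b) (hcd : c ≤ d) {ξ η : Ω → ℝ} (hξ : Measurable[𝓕 a] ξ)
    (hη : Measurable[𝓕 c] η) {C C' : ℝ} (hC : ∀ᵐ ω ∂P, |ξ ω| ≤ C) (hC' : ∀ᵐ ω ∂P, |η ω| ≤ C') :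
    ∫ ω, (ξ ω * (W b ω - W a ω)) * (η ω * (W d ω - W c ω)) ∂P
      = volume.real (Ioc (a : ℝ) b ∩ Ioc (c : ℝ) d) * ∫ ω, ξ ω * η ω ∂P := by
  wlog hac : a ≤ c generalizing a b c d ξ η C C'
  · have := this hcd hab hη hξ hC' hC (le_of_not_ge hac)
    rw [inter_comm]
    simp_rw [mul_comm (ξ _) (η _)]
    rw [← this]
    congr 1 with ω
    ring
  have hξη : Measurable[𝓕 c] (fun ω => ξ ω * η ω) := (hξ.mono (𝓕.mono hac) le_rfl).mul hη
  have hξηb : ∀ᵐ ω ∂P, |ξ ω * η ω| ≤ C * C' := by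
    filter_upwards [hC, hC'] with ω h1 h2
    rw [abs_mul]
    exact mul_le_mul h1 h2 (abs_nonneg _) ((abs_nonneg _).trans h1)
  have hξηm : AEStronglyMeasurable (fun ω => ξ ω * η ω) P :=
    (hξη.mono (𝓕.le c) le_rfl).aestronglyMeasurable
  rw [Ioc_inter_Ioc, measureReal_def, Real.volume_Ioc]
  have hmax : (a : ℝ) ⊔ c = c := max_eq_right (by exact_mod_cast hac)
  rw [hmax]
  rcases le_total b c with hbc | hcb
  · have h0 : ∀ ω, (ξ ω * (W b ω - W a ω)) * (η ω * (W d ω - W c ω))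
        = (ξ ω * η ω * (W b ω - W a ω)) * (W d ω - W c ω) := fun ω => by ring
    simp_rw [h0]
    rw [hW.integral_mul_increment hcd]
    · have : (b : ℝ) ⊓ d - c ≤ 0 := by
        have : (b : ℝ) ≤ c := by exact_mod_cast hbc
        linarith [min_le_left (b : ℝ) d]
      rw [ENNReal.ofReal_of_nonpos this]; simp
    · exact hξη.mul (((hW.adapted b).mono (𝓕.mono hbc) le_rfl).sub
        ((hW.adapted a).mono (𝓕.mono hac) le_rfl))
  · have h0 : ∀ ω, (ξ ω * (W b ω - W a ω)) * (η ω * (W d ω - W c ω))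
        = (ξ ω * η ω * (W c ω - W a ω)) * (W d ω - W c ω)
          + ξ ω * η ω * (W b ω - W c ω) * (W d ω - W c ω) := fun ω => by ring
    simp_rw [h0]
    have hint : ∀ s t, Integrable (fun ω => ξ ω * η ω * (W t ω - W s ω) * (W d ω - W c ω)) P := by
      intro s t
      have : Integrable (fun ω => (W t ω - W s ω) * (W d ω - W c ω)) P :=
        (hW.memLp_increment s t).integrable_mul (hW.memLp_increment c d)
      simpa [mul_assoc] using this.bdd_mul hξηm hξηb
    rw [integral_add (hint _ _) (hint _ _), hW.integral_mul_increment hcd, zero_add]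
    · have hcb' : (c : ℝ) ≤ b := by exact_mod_cast hcb
      have hcd' : (c : ℝ) ≤ d := by exact_mod_cast hcd
      rw [ENNReal.toReal_ofReal (sub_nonneg.2 (le_min hcb' hcd'))]
      rcases le_total b d with hbd | hdb
      · rw [hW.integral_mul_increment_mul_increment hcb hbd hξη hξηb,
          min_eq_left (by exact_mod_cast hbd)]
        ring
      · have h3 : ∀ ω, ξ ω * η ω * (W b ω - W c ω) * (W d ω - W c ω)
          = ξ ω * η ω * (W d ω - W c ω) * (W b ω - W c ω) := fun ω => by ring
        simp_rw [h3]
        rw [hW.integral_mul_increment_mul_increment hcd hdb hξη hξηb,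
          min_eq_right (by exact_mod_cast hdb)]
        ring
    · exact hξη.mul ((hW.adapted c).sub ((hW.adapted a).mono (𝓕.mono hac) le_rfl))

end Moments

/-! ### Indicators and conditional expectations as operators on `L²` -/

section Operators

variable {Ω : Type*} {m mΩ : MeasurableSpace Ω} {P : Measure Ω} [IsProbabilityMeasure P]

lemma memLp_two_of_bdd {ξ : Ω → ℝ} (hm : AEStronglyMeasurable ξ P) {C : ℝ}
    (hC : ∀ᵐ ω ∂P, |ξ ω| ≤ C) : MemLp ξ 2 P := MemLp.of_bound hm C hC

lemma memLp_indicator {A : Set Ω} (hA : MeasurableSet A) (z : Lp ℝ 2 P) :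
    MemLp (A.indicator (z : Ω → ℝ)) 2 P := MemLp.indicator hA (Lp.memLp z)

lemma toL2_indicator_add {A : Set Ω} (hA : MeasurableSet A) (z z' : Lp ℝ 2 P) :
    toL2 P (A.indicator ((z + z' : Lp ℝ 2 P) : Ω → ℝ))
      = toL2 P (A.indicator (z : Ω → ℝ)) + toL2 P (A.indicator (z' : Ω → ℝ)) := by
  rw [← toL2_add (memLp_indicator hA z) (memLp_indicator hA z')]
  apply toL2_congr
  filter_upwards [Lp.coeFn_add z z'] with ω hω
  by_cases h : ω ∈ A
  · simpa only [indicator_of_mem h, Pi.add_apply] using hω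
  · simp [h]

lemma toL2_indicator_smul {A : Set Ω} (hA : MeasurableSet A) (c : ℝ) (z : Lp ℝ 2 P) :
    toL2 P (A.indicator ((c • z : Lp ℝ 2 P) : Ω → ℝ)) = c • toL2 P (A.indicator (z : Ω → ℝ)) := by
  rw [← toL2_const_smul c (memLp_indicator hA z)]
  apply toL2_congr
  filter_upwards [Lp.coeFn_smul c z] with ω hω
  by_cases h : ω ∈ A
  · simpa only [indicator_of_mem h, Pi.smul_apply] using hω
  · simp [h]

lemma norm_toL2_indicator_le {A : Set Ω} (hA : MeasurableSet A) (z : Lp ℝ 2 P) :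
    ‖toL2 P (A.indicator (z : Ω → ℝ))‖ ≤ 1 * ‖z‖ := by
  rw [one_mul]
  refine Lp.norm_le_norm_of_ae_le ?_
  filter_upwards [coeFn_toL2 (memLp_indicator hA z)] with ω hω
  rw [hω]
  by_cases h : ω ∈ A <;> simp [h]

/-- Multiplication by the indicator of `A`, as a bounded operator on `L²(P)`. -/
noncomputable def indOp (P : Measure Ω) [IsProbabilityMeasure P] {A : Set Ω}
    (hA : MeasurableSet A) : Lp ℝ 2 P →L[ℝ] Lp ℝ 2 P :=
  LinearMap.mkContinuous
    { toFun := fun z => toL2 P (A.indicator (z : Ω → ℝ))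
      map_add' := toL2_indicator_add hA
      map_smul' := toL2_indicator_smul hA }
    1 (norm_toL2_indicator_le hA)

variable {A : Set Ω} (hA : MeasurableSet A)

lemma indOp_apply (z : Lp ℝ 2 P) : indOp P hA z = toL2 P (A.indicator (z : Ω → ℝ)) := rfl

lemma coeFn_indOp (z : Lp ℝ 2 P) : indOp P hA z =ᵐ[P] A.indicator (z : Ω → ℝ) :=
  coeFn_toL2 (memLp_indicator hA z)

lemma indOp_toL2 {ξ : Ω → ℝ} (hξ : MemLp ξ 2 P) :
    indOp P hA (toL2 P ξ) = toL2 P (A.indicator ξ) := by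
  rw [indOp_apply]
  apply toL2_congr
  filter_upwards [coeFn_toL2 hξ] with ω hω
  by_cases h : ω ∈ A <;> simp [h, hω]

lemma norm_indOp_le (z : Lp ℝ 2 P) : ‖indOp P hA z‖ ≤ ‖z‖ :=
  (norm_toL2_indicator_le hA z).trans_eq (one_mul _)

lemma inner_eq_integral (z z' : Lp ℝ 2 P) : inner ℝ z z' = ∫ ω, z ω * z' ω ∂P := by
  rw [L2.inner_def]
  congr 1 with ω
  simp [mul_comm]

lemma inner_indOp_left (z z' : Lp ℝ 2 P) :
    inner ℝ (indOp P hA z) z' = ∫ ω in A, z ω * z' ω ∂P := by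
  rw [inner_eq_integral, ← integral_indicator hA]
  apply integral_congr_ae
  filter_upwards [coeFn_indOp hA z] with ω hω
  by_cases h : ω ∈ A <;> simp [h, hω]

lemma inner_indOp_right (z z' : Lp ℝ 2 P) :
    inner ℝ z (indOp P hA z') = inner ℝ (indOp P hA z) z' := by
  rw [real_inner_comm, inner_indOp_left, inner_indOp_left]
  simp_rw [mul_comm]

lemma indOp_indOp (z : Lp ℝ 2 P) : indOp P hA (indOp P hA z) = indOp P hA z := by
  rw [indOp_apply, indOp_apply]
  apply toL2_congr
  filter_upwards [coeFn_toL2 (memLp_indicator hA z)] with ω hω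
  by_cases h : ω ∈ A <;> simp [h, hω]

lemma inner_indOp_indOp (z z' : Lp ℝ 2 P) :
    inner ℝ (indOp P hA z) (indOp P hA z') = inner ℝ (indOp P hA z) z' := by
  rw [inner_indOp_right, indOp_indOp]

/-- The constant random variable `c` as an element of `L²(P)`. -/
noncomputable def constL2 (P : Measure Ω) (c : ℝ) : Lp ℝ 2 P := toL2 P (fun _ => c)

lemma memLp_const_real (c : ℝ) : MemLp (fun _ : Ω => c) 2 P := memLp_const c

lemma coeFn_constL2 (c : ℝ) : constL2 P c =ᵐ[P] fun _ => c := coeFn_toL2 (memLp_const c)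

lemma smul_constL2 (a c : ℝ) : a • constL2 P c = constL2 P (a * c) := by
  rw [constL2, ← toL2_const_smul a (memLp_const_real c)]; rfl

lemma inner_indOp_one (z : Lp ℝ 2 P) : inner ℝ (indOp P hA (constL2 P 1)) z = ∫ ω in A, z ω ∂P := by
  rw [inner_indOp_left]
  apply setIntegral_congr_ae hA
  filter_upwards [coeFn_constL2 (P := P) 1] with ω hω _
  simp [hω]

lemma norm_indOp_toL2_le {ξ : Ω → ℝ} (hξ : AEStronglyMeasurable ξ P) {C : ℝ}
    (hC : ∀ᵐ ω ∂P, |ξ ω| ≤ C) : ‖indOp P hA (toL2 P ξ)‖ ≤ C * √(P.real A) := by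
  have hC0 : 0 ≤ C := by
    obtain ⟨ω, hω⟩ := hC.exists
    exact (abs_nonneg _).trans hω
  have h2 := memLp_two_of_bdd hξ hC
  have h1 : ‖indOp P hA (toL2 P ξ)‖ ^ 2 ≤ C ^ 2 * P.real A := by
    rw [← real_inner_self_eq_norm_sq, inner_indOp_indOp, inner_indOp_left]
    have h3 : ∫ ω in A, (toL2 P ξ) ω * (toL2 P ξ) ω ∂P ≤ ∫ ω in A, C ^ 2 ∂P := by
      refine setIntegral_mono_ae (Lp.memLp _ |>.integrable_mul (Lp.memLp _)).integrableOn
        (integrable_const _).integrableOn ?_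
      filter_upwards [coeFn_toL2 h2, hC] with ω hω hb
      rw [hω, ← sq, ← sq_abs]
      gcongr
    simpa [mul_comm] using h3
  have h4 : ‖indOp P hA (toL2 P ξ)‖ ≤ √(C ^ 2 * P.real A) := Real.le_sqrt_of_sq_le h1
  rwa [Real.sqrt_mul (sq_nonneg C), Real.sqrt_sq hC0] at h4

lemma norm_toL2_le_of_bdd {ξ : Ω → ℝ} (hξ : AEStronglyMeasurable ξ P) {C : ℝ}
    (hC : ∀ᵐ ω ∂P, |ξ ω| ≤ C) : ‖toL2 P ξ‖ ≤ C := by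
  have h := norm_indOp_toL2_le MeasurableSet.univ hξ hC
  rwa [indOp_toL2 _ (memLp_two_of_bdd hξ hC), indicator_univ, probReal_univ, Real.sqrt_one,
    mul_one] at h

variable (hm : m ≤ mΩ)

/-- The conditional expectation given `m`, as an orthogonal projection in `L²(P)`. -/
noncomputable def condProj (P : Measure Ω) (hm : m ≤ mΩ) : Lp ℝ 2 P →L[ℝ] Lp ℝ 2 P :=
  (lpMeas ℝ ℝ m 2 P).subtypeL.comp (condExpL2 ℝ ℝ hm)

lemma aestronglyMeasurable_condProj (z : Lp ℝ 2 P) :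
    AEStronglyMeasurable[m] (condProj P hm z) P := aestronglyMeasurable_condExpL2 hm z

lemma coeFn_condProj (z : Lp ℝ 2 P) : condProj P hm z =ᵐ[P] P[z | m] := by
  have h := (Lp.memLp z).condExpL2_ae_eq_condExp (𝕜 := ℝ) hm
  rwa [Lp.toLp_coeFn] at h

lemma inner_condProj_left (z z' : Lp ℝ 2 P) :
    inner ℝ (condProj P hm z) z' = inner ℝ z (condProj P hm z') :=
  inner_condExpL2_left_eq_right hm

lemma inner_condProj_of_meas (z : Lp ℝ 2 P) {g : Lp ℝ 2 P} (hg : AEStronglyMeasurable[m] g P) :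
    inner ℝ (condProj P hm z) g = inner ℝ z g := inner_condExpL2_eq_inner_fun hm z g hg

lemma condProj_of_meas {g : Lp ℝ 2 P} (hg : AEStronglyMeasurable[m] g P) :
    condProj P hm g = g := by
  refine ext_inner_left ℝ fun z => ?_
  rw [← inner_condProj_left, inner_condProj_of_meas hm z hg]

lemma condProj_condProj (z : Lp ℝ 2 P) : condProj P hm (condProj P hm z) = condProj P hm z :=
  condProj_of_meas hm (aestronglyMeasurable_condProj hm z)

lemma norm_sub_condProj_le (z : Lp ℝ 2 P) : ‖z - condProj P hm z‖ ≤ ‖z‖ := by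
  have h : inner ℝ z (condProj P hm z) = ‖condProj P hm z‖ ^ 2 := by
    rw [← real_inner_self_eq_norm_sq, inner_condProj_left, condProj_condProj]
  have h2 : ‖z - condProj P hm z‖ ^ 2 ≤ ‖z‖ ^ 2 := by
    rw [norm_sub_sq_real, h]
    nlinarith [sq_nonneg ‖condProj P hm z‖]
  exact (sq_le_sq₀ (norm_nonneg _) (norm_nonneg _)).1 h2

lemma aestronglyMeasurable_indOp (hA' : MeasurableSet[m] A) {z : Lp ℝ 2 P}
    (hz : AEStronglyMeasurable[m] z P) : AEStronglyMeasurable[m] (indOp P hA z) P := by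
  refine AEStronglyMeasurable.congr ?_ (coeFn_indOp hA z).symm
  obtain ⟨g, hg, hzg⟩ := hz
  refine ⟨A.indicator g, hg.indicator hA', ?_⟩
  filter_upwards [hzg] with ω hω
  by_cases h : ω ∈ A <;> simp [h, hω]

/-- Taking out what is known: indicators of `m`-measurable sets commute with the conditional
expectation given `m`. -/
lemma condProj_indOp (hA' : MeasurableSet[m] A) (z : Lp ℝ 2 P) :
    condProj P hm (indOp P hA z) = indOp P hA (condProj P hm z) := by
  refine ext_inner_right ℝ fun z' => ?_
  have h1 : AEStronglyMeasurable[m] (indOp P hA (condProj P hm z')) P :=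
    aestronglyMeasurable_indOp hA hA' (aestronglyMeasurable_condProj hm z')
  have h2 : AEStronglyMeasurable[m] (indOp P hA (condProj P hm z)) P :=
    aestronglyMeasurable_indOp hA hA' (aestronglyMeasurable_condProj hm z)
  rw [inner_condProj_left, ← inner_indOp_right, ← inner_condProj_of_meas hm z h1,
    inner_indOp_right, ← inner_condProj_left, condProj_of_meas hm h2]

lemma aestronglyMeasurable_toL2 {ξ : Ω → ℝ} (h2 : MemLp ξ 2 P)
    (hξ : AEStronglyMeasurable[m] ξ P) : AEStronglyMeasurable[m] (toL2 P ξ) P :=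
  hξ.congr (coeFn_toL2 h2).symm

lemma aestronglyMeasurable_L2_add {z z' : Lp ℝ 2 P} (hz : AEStronglyMeasurable[m] z P)
    (hz' : AEStronglyMeasurable[m] z' P) :
    AEStronglyMeasurable[m] ((z + z' : Lp ℝ 2 P) : Ω → ℝ) P :=
  (lpMeas ℝ ℝ m 2 P).add_mem hz hz'

lemma aestronglyMeasurable_L2_smul (c : ℝ) {z : Lp ℝ 2 P} (hz : AEStronglyMeasurable[m] z P) :
    AEStronglyMeasurable[m] ((c • z : Lp ℝ 2 P) : Ω → ℝ) P :=
  (lpMeas ℝ ℝ m 2 P).smul_mem c hz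

lemma aestronglyMeasurable_constL2 (c : ℝ) : AEStronglyMeasurable[m] (constL2 P c) P :=
  aestronglyMeasurable_toL2 (memLp_const_real c) aestronglyMeasurable_const

/-- A random variable whose integrals over all events of `m` vanish has conditional expectation
zero. -/
lemma condProj_eq_zero {z : Lp ℝ 2 P} (h : ∀ A, MeasurableSet[m] A → ∫ ω in A, z ω ∂P = 0) :
    condProj P hm z = 0 := by
  have hz : Integrable z P := (Lp.memLp z).integrable one_le_two
  have h1 : (0 : Ω → ℝ) =ᵐ[P] P[z | m] := by
    refine ae_eq_condExp_of_forall_setIntegral_eq hm hz (fun _ _ _ => integrableOn_zero) ?_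
      aestronglyMeasurable_zero
    intro A hA _
    simp [h A hA]
  apply Lp.ext
  filter_upwards [coeFn_condProj hm z, h1, Lp.coeFn_zero ℝ 2 P] with ω h2 h3 h4
  rw [h2, ← h3, h4]

end Operators

/-! ### The Hilbert space of square integrable paths -/

section Paths

variable {Ω : Type*} {mΩ : MeasurableSpace Ω} {P : Measure Ω} [IsProbabilityMeasure P]
  {𝓕 : Filtration ℝ≥0 mΩ} {T : ℝ≥0}

/-- Lebesgue measure on the time interval `(0, T]`. -/
noncomputable abbrev timeMeasure (T : ℝ≥0) : Measure ℝ := volume.restrict (Ioc 0 (T : ℝ))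

/-- The square integrable paths in `L²(P)` over the time interval `(0, T]`. This space plays the
role of `L²(dt ⊗ P)`, and avoids any question about joint measurability. -/
abbrev PathSpace (P : Measure Ω) (T : ℝ≥0) : Type _ := Lp (Lp ℝ 2 P) 2 (timeMeasure T)

/-- The path `1_{(a, b]} U`, as an element of the path space. -/
noncomputable def seg (P : Measure Ω) (T : ℝ≥0) (a b : ℝ) (U : ℝ → Lp ℝ 2 P) : PathSpace P T :=
  toL2 (timeMeasure T) ((Ioc a b).indicator U)

/-- `U` is the `L²(P)`-valued path of an adapted process which is bounded by `C` and
left-continuous in mean square. -/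
structure IsAdaptedPath (P : Measure Ω) (𝓕 : Filtration ℝ≥0 mΩ) (T : ℝ≥0) (C : ℝ)
    (U : ℝ → Lp ℝ 2 P) : Prop where
  leftCont : ∀ τ ∈ Ioc 0 (T : ℝ), ContinuousWithinAt U (Iic τ) τ
  adapted : ∀ s : ℝ≥0, s ≤ T → ∃ ξ : Ω → ℝ, Measurable[𝓕 s] ξ ∧ (∀ᵐ ω ∂P, |ξ ω| ≤ C) ∧
    U s = toL2 P ξ

variable {C C' : ℝ} {U U' : ℝ → Lp ℝ 2 P}

lemma aesm_of_measurable {s : ℝ≥0} {ξ : Ω → ℝ} (hξ : Measurable[𝓕 s] ξ) :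
    AEStronglyMeasurable ξ P := (hξ.mono (𝓕.le s) le_rfl).aestronglyMeasurable

lemma IsAdaptedPath.nonneg (hU : IsAdaptedPath P 𝓕 T C U) : 0 ≤ C := by
  obtain ⟨ξ, _, hC, _⟩ := hU.adapted 0 zero_le
  obtain ⟨ω, hω⟩ := hC.exists
  exact (abs_nonneg _).trans hω

lemma IsAdaptedPath.adapted_real (hU : IsAdaptedPath P 𝓕 T C U) {τ : ℝ} (hτ : τ ∈ Icc 0 (T : ℝ)) :
    ∃ ξ : Ω → ℝ, Measurable[𝓕 τ.toNNReal] ξ ∧ (∀ᵐ ω ∂P, |ξ ω| ≤ C) ∧ U τ = toL2 P ξ := by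
  obtain ⟨ξ, h⟩ := hU.adapted τ.toNNReal (Real.toNNReal_le_iff_le_coe.2 hτ.2)
  rw [Real.coe_toNNReal _ hτ.1] at h
  exact ⟨ξ, h⟩

lemma IsAdaptedPath.norm_indOp_le (hU : IsAdaptedPath P 𝓕 T C U) {τ : ℝ} (hτ : τ ∈ Icc 0 (T : ℝ))
    {A : Set Ω} (hA : MeasurableSet A) : ‖indOp P hA (U τ)‖ ≤ C * √(P.real A) := by
  obtain ⟨ξ, h1, h2, h3⟩ := hU.adapted_real hτ
  rw [h3]
  exact norm_indOp_toL2_le hA (aesm_of_measurable h1) h2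

lemma IsAdaptedPath.norm_le (hU : IsAdaptedPath P 𝓕 T C U) {τ : ℝ} (hτ : τ ∈ Icc 0 (T : ℝ)) :
    ‖U τ‖ ≤ C := by
  obtain ⟨ξ, h1, h2, h3⟩ := hU.adapted_real hτ
  rw [h3]
  exact norm_toL2_le_of_bdd (aesm_of_measurable h1) h2

lemma IsAdaptedPath.aestronglyMeasurable (hU : IsAdaptedPath P 𝓕 T C U) {s t : ℝ≥0} (hsT : s ≤ T)
    (hst : s ≤ t) : AEStronglyMeasurable[𝓕 t] (U s) P := by
  obtain ⟨ξ, h1, h2, h3⟩ := hU.adapted s hsT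
  rw [h3]
  refine aestronglyMeasurable_toL2 (memLp_two_of_bdd (aesm_of_measurable h1) h2) ?_
  exact (h1.mono (𝓕.mono hst) le_rfl).aestronglyMeasurable

lemma IsAdaptedPath.leftCont' (hU : IsAdaptedPath P 𝓕 T C U) {a b : ℝ} (ha : 0 ≤ a) (hb : b ≤ T) :
    ∀ τ ∈ Ioc a b, ContinuousWithinAt U (Iic τ) τ :=
  fun τ hτ => hU.leftCont τ ⟨ha.trans_lt hτ.1, hτ.2.trans hb⟩

lemma IsAdaptedPath.norm_le' (hU : IsAdaptedPath P 𝓕 T C U) {a b : ℝ} (ha : 0 ≤ a) (hb : b ≤ T) :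
    ∀ τ ∈ Icc a b, ‖U τ‖ ≤ C := fun _ hτ => hU.norm_le ⟨ha.trans hτ.1, hτ.2.trans hb⟩

lemma IsAdaptedPath.intervalIntegrable (hU : IsAdaptedPath P 𝓕 T C U) {a b : ℝ} (ha : 0 ≤ a)
    (hab : a ≤ b) (hb : b ≤ T) : IntervalIntegrable U volume a b :=
  intervalIntegrable_of_leftCont hab (hU.leftCont' ha hb) (hU.norm_le' ha hb)

/-- The path `1_{(a, b]} U` is square integrable. -/
def SegMemLp (T : ℝ≥0) (a b : ℝ) (U : ℝ → Lp ℝ 2 P) : Prop :=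
  MemLp ((Ioc a b).indicator U) 2 (timeMeasure T)

lemma segMemLp_of_leftCont {a b : ℝ} (hab : a ≤ b)
    (hU : ∀ τ ∈ Ioc a b, ContinuousWithinAt U (Iic τ) τ) (hC : ∀ τ ∈ Icc a b, ‖U τ‖ ≤ C) :
    SegMemLp T a b U := by
  refine MemLp.of_bound (stronglyMeasurable_indicator_of_leftCont hab hU).aestronglyMeasurable C ?_
  refine ae_of_all _ fun τ => ?_
  have hC0 : 0 ≤ C := (norm_nonneg _).trans (hC a (left_mem_Icc.2 hab))
  by_cases h : τ ∈ Ioc a b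
  · simpa [h] using hC τ ⟨h.1.le, h.2⟩
  · simpa [h] using hC0

lemma IsAdaptedPath.segMemLp (hU : IsAdaptedPath P 𝓕 T C U) {a b : ℝ} (ha : 0 ≤ a) (hab : a ≤ b)
    (hb : b ≤ T) : SegMemLp T a b U :=
  segMemLp_of_leftCont hab (hU.leftCont' ha hb) (hU.norm_le' ha hb)

lemma segMemLp_const (a b : ℝ) (Z : Lp ℝ 2 P) : SegMemLp T a b (fun _ => Z) :=
  memLp_indicator_const 2 measurableSet_Ioc Z (Or.inr (measure_ne_top _ _))

lemma coeFn_seg {a b : ℝ} (hU : SegMemLp T a b U) :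
    seg P T a b U =ᵐ[timeMeasure T] (Ioc a b).indicator U := coeFn_toL2 hU

lemma seg_congr {a b : ℝ} (h : ∀ τ ∈ Ioc a b, U τ = U' τ) : seg P T a b U = seg P T a b U' := by
  rw [seg, seg]
  congr 1
  exact indicator_congr h

lemma seg_sub {a b : ℝ} (hU : SegMemLp T a b U) (hU' : SegMemLp T a b U') :
    seg P T a b (fun τ => U τ - U' τ) = seg P T a b U - seg P T a b U' := by
  rw [seg, seg, seg, ← toL2_sub hU hU']
  exact congrArg _ (indicator_sub (Ioc a b) U U')

lemma seg_smul {a b : ℝ} (c : ℝ) (hU : SegMemLp T a b U) :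
    seg P T a b (fun τ => c • U τ) = c • seg P T a b U := by
  rw [seg, seg, ← toL2_const_smul c hU]
  congr 1
  exact indicator_const_smul (Ioc a b) c U

lemma seg_concat {a b c : ℝ} (hab : a ≤ b) (hbc : b ≤ c) (h1 : SegMemLp T a b U)
    (h2 : SegMemLp T b c U) : seg P T a c U = seg P T a b U + seg P T b c U := by
  rw [seg, seg, seg, ← toL2_add h1 h2, ← Ioc_union_Ioc_eq_Ioc hab hbc, indicator_union_of_disjoint]
  · rfl
  · exact Ioc_disjoint_Ioc_of_le le_rfl

lemma seg_self (a : ℝ) : seg P T a a U = 0 := by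
  have h : MemLp (0 : ℝ → Lp ℝ 2 P) 2 (timeMeasure T) := MemLp.zero
  rw [seg, Ioc_self, indicator_empty]
  exact (toL2_eq h).trans (MemLp.toLp_zero h)

lemma inner_seg_left {a b : ℝ} (ha : 0 ≤ a) (hab : a ≤ b) (hb : b ≤ T) (hU : SegMemLp T a b U)
    (φ : PathSpace P T) : inner ℝ (seg P T a b U) φ = ∫ τ in a..b, inner ℝ (U τ) (φ τ) := by
  rw [L2.inner_def, intervalIntegral.integral_of_le hab]
  have hsub : Ioc a b ⊆ Ioc 0 (T : ℝ) := Ioc_subset_Ioc ha hb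
  calc ∫ τ, inner ℝ (seg P T a b U τ) (φ τ) ∂(timeMeasure T)
      = ∫ τ, (Ioc a b).indicator (fun τ => inner ℝ (U τ) (φ τ)) τ ∂(timeMeasure T) := by
        apply integral_congr_ae
        filter_upwards [coeFn_seg hU] with τ hτ
        rw [hτ]
        by_cases h : τ ∈ Ioc a b <;> simp [h]
    _ = _ := by
        rw [integral_indicator measurableSet_Ioc, Measure.restrict_restrict measurableSet_Ioc,
          inter_eq_left.2 hsub]

lemma coeFn_seg_of_mem {a b : ℝ} (ha : 0 ≤ a) (hb : b ≤ T) (hU : SegMemLp T a b U) :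
    ∀ᵐ τ ∂(volume.restrict (Ioc a b)), seg P T a b U τ = U τ := by
  have h := ae_restrict_of_ae_restrict_of_subset (Ioc_subset_Ioc ha hb) (coeFn_seg hU)
  filter_upwards [h, ae_restrict_mem measurableSet_Ioc] with τ hτ hm
  rw [hτ, indicator_of_mem hm]

lemma inner_seg_seg {a b : ℝ} (ha : 0 ≤ a) (hab : a ≤ b) (hb : b ≤ T) (hU : SegMemLp T a b U)
    (hU' : SegMemLp T a b U') :
    inner ℝ (seg P T a b U) (seg P T a b U') = ∫ τ in a..b, inner ℝ (U τ) (U' τ) := by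
  rw [inner_seg_left ha hab hb hU, intervalIntegral.integral_of_le hab,
    intervalIntegral.integral_of_le hab]
  apply integral_congr_ae
  filter_upwards [coeFn_seg_of_mem ha hb hU'] with τ hτ
  rw [hτ]

lemma inner_seg_const {a b c d : ℝ≥0} (hb : b ≤ T) (Z Z' : Lp ℝ 2 P) :
    inner ℝ (seg P T a b (fun _ => Z)) (seg P T c d (fun _ => Z'))
      = volume.real (Ioc (a : ℝ) b ∩ Ioc (c : ℝ) d) * inner ℝ Z Z' := by
  have h : ∀ (a b : ℝ≥0) (Z : Lp ℝ 2 P), seg P T a b (fun _ => Z)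
      = indicatorConstLp 2 (measurableSet_Ioc : MeasurableSet (Ioc (a : ℝ) b))
        (measure_ne_top (timeMeasure T) _) Z := fun a b Z => toL2_eq (segMemLp_const _ _ Z)
  rw [h, h, L2.inner_indicatorConstLp_indicatorConstLp, smul_eq_mul, measureReal_restrict_apply]
  · congr 2
    apply inter_eq_left.2
    exact inter_subset_left.trans (Ioc_subset_Ioc a.2 (by exact_mod_cast hb))
  · exact measurableSet_Ioc.inter measurableSet_Ioc

lemma norm_seg_le {a b : ℝ} (ha : 0 ≤ a) (hab : a ≤ b) (hb : b ≤ T) (hU : SegMemLp T a b U)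
    (hC0 : 0 ≤ C) (hC : ∀ τ ∈ Ioc a b, ‖U τ‖ ≤ C) : ‖seg P T a b U‖ ≤ C * √(b - a) := by
  have h1 : ‖seg P T a b U‖ ^ 2 ≤ C ^ 2 * (b - a) := by
    rw [← real_inner_self_eq_norm_sq, inner_seg_seg ha hab hb hU hU]
    have h2 : ‖∫ τ in a..b, inner ℝ (U τ) (U τ)‖ ≤ C ^ 2 * |b - a| := by
      refine intervalIntegral.norm_integral_le_of_norm_le_const fun τ hτ => ?_
      rw [uIoc_of_le hab] at hτ
      rw [real_inner_self_eq_norm_sq, norm_pow, norm_norm]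
      gcongr
      exact hC τ hτ
    rw [abs_of_nonneg (sub_nonneg.2 hab)] at h2
    exact (le_abs_self _).trans h2
  have h4 := Real.le_sqrt_of_sq_le h1
  rwa [Real.sqrt_mul (sq_nonneg C), Real.sqrt_sq hC0] at h4

/-! #### Operations on paths -/

lemma isAdaptedPath_const (c : ℝ) : IsAdaptedPath P 𝓕 T |c| (fun _ => constL2 P c) where
  leftCont _ _ := continuousWithinAt_const
  adapted _ _ := ⟨fun _ => c, measurable_const, ae_of_all _ fun _ => le_rfl, rfl⟩

lemma IsAdaptedPath.sub (hU : IsAdaptedPath P 𝓕 T C U) (hU' : IsAdaptedPath P 𝓕 T C' U') :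
    IsAdaptedPath P 𝓕 T (C + C') (fun τ => U τ - U' τ) where
  leftCont τ hτ := (hU.leftCont τ hτ).sub (hU'.leftCont τ hτ)
  adapted s hs := by
    obtain ⟨ξ, h1, h2, h3⟩ := hU.adapted s hs
    obtain ⟨ξ', h1', h2', h3'⟩ := hU'.adapted s hs
    refine ⟨ξ - ξ', h1.sub h1', ?_, ?_⟩
    · filter_upwards [h2, h2'] with ω hω hω'
      exact (abs_sub _ _).trans (add_le_add hω hω')
    · rw [h3, h3', toL2_sub (memLp_two_of_bdd (aesm_of_measurable h1) h2)
        (memLp_two_of_bdd (aesm_of_measurable h1') h2')]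

lemma IsAdaptedPath.smul (hU : IsAdaptedPath P 𝓕 T C U) {g : ℝ → ℝ} (hg : Continuous g) {G : ℝ}
    (hG : ∀ τ ∈ Icc 0 (T : ℝ), |g τ| ≤ G) : IsAdaptedPath P 𝓕 T (G * C) (fun τ => g τ • U τ) where
  leftCont τ hτ := hg.continuousWithinAt.smul (hU.leftCont τ hτ)
  adapted s hs := by
    obtain ⟨ξ, h1, h2, h3⟩ := hU.adapted s hs
    refine ⟨fun ω => g s • ξ ω, h1.const_smul (g s), ?_, ?_⟩
    · filter_upwards [h2] with ω hω
      rw [smul_eq_mul, abs_mul]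
      have h4 := hG s ⟨s.2, by exact_mod_cast hs⟩
      exact mul_le_mul h4 hω (abs_nonneg _) ((abs_nonneg _).trans h4)
    · rw [h3, toL2_const_smul _ (memLp_two_of_bdd (aesm_of_measurable h1) h2)]

/-- The `L²(P)`-valued path of a process. -/
noncomputable def pathL2 (P : Measure Ω) (u : ℝ≥0 → Ω → ℝ) (τ : ℝ) : Lp ℝ 2 P :=
  toL2 P (u τ.toNNReal)

lemma IsControl.ae_abs_le {M : ℝ} {u : ℝ≥0 → Ω → ℝ} (hu : IsControl 𝓕 P T M u) {s : ℝ≥0}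
    (hs : s ≤ T) : ∀ᵐ ω ∂P, |u s ω| ≤ M := by
  filter_upwards [hu.bounded] with ω hω using hω s hs

lemma IsControl.memLp {M : ℝ} {u : ℝ≥0 → Ω → ℝ} (hu : IsControl 𝓕 P T M u) {s : ℝ≥0}
    (hs : s ≤ T) : MemLp (u s) 2 P :=
  memLp_two_of_bdd (aesm_of_measurable (hu.adapted s hs)) (hu.ae_abs_le hs)

lemma IsControl.ae_leftCont_real {M : ℝ} {u : ℝ≥0 → Ω → ℝ} (hu : IsControl 𝓕 P T M u) :
    ∀ᵐ ω ∂P, ∀ τ ∈ Ioc 0 (T : ℝ), ContinuousWithinAt (fun s : ℝ => u s.toNNReal ω) (Iic τ) τ := by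
  filter_upwards [hu.left_continuous] with ω hω τ hτ
  have h := hω τ.toNNReal (Real.toNNReal_pos.2 hτ.1) (Real.toNNReal_le_iff_le_coe.2 hτ.2)
  exact ContinuousWithinAt.comp (f := Real.toNNReal) (g := fun s => u s ω) h
    continuous_real_toNNReal.continuousWithinAt (fun s hs => Real.toNNReal_le_toNNReal hs)

lemma IsControl.isAdaptedPath {M : ℝ} {u : ℝ≥0 → Ω → ℝ} (hu : IsControl 𝓕 P T M u) :
    IsAdaptedPath P 𝓕 T M (pathL2 P u) where
  leftCont τ hτ := by
    refine tendsto_of_seq_tendsto fun x hx => ?_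
    obtain ⟨hx1, hx2⟩ := tendsto_nhdsWithin_iff.1 hx
    have hle : ∀ n, (min (x n) τ).toNNReal ≤ T := fun n =>
      Real.toNNReal_le_iff_le_coe.2 ((min_le_right _ _).trans hτ.2)
    have hlim : Tendsto (fun n => min (x n) τ) atTop (𝓝[≤] τ) := by
      refine tendsto_nhdsWithin_iff.2 ⟨?_,
        Eventually.of_forall fun n => mem_Iic.2 (min_le_right _ _)⟩
      simpa using hx1.min (tendsto_const_nhds (x := τ))
    have h := (tendsto_eLpNorm_two_of_dominated (μ := P) (C := M)
      (f := fun n => u (min (x n) τ).toNNReal) (g := u τ.toNNReal)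
      (fun n => aesm_of_measurable (hu.adapted _ (hle n))) (fun n => hu.ae_abs_le (hle n)) ?_).2
    · refine h.congr' ?_
      filter_upwards [hx2] with n hn
      rw [min_eq_left (show x n ≤ τ from hn)]; rfl
    · filter_upwards [hu.ae_leftCont_real] with ω hω
      exact (hω τ hτ).tendsto.comp hlim
  adapted s hs := ⟨u s, hu.adapted s hs, hu.ae_abs_le hs, by simp [pathL2]⟩

end Paths

/-! ### The Itô integral and the time integral as operators on the path space -/

section Ito

variable {Ω : Type*} {mΩ : MeasurableSpace Ω} {P : Measure Ω} [IsProbabilityMeasure P]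
  {𝓕 : Filtration ℝ≥0 mΩ} {T : ℝ≥0} {W : ℝ≥0 → Ω → ℝ}

/-- The elementary integrands `1_{(a, b]} ξ` with `t ≤ a ≤ b ≤ T` and a bounded random variable
`ξ` which is known at time `a`. -/
def elementary (P : Measure Ω) (𝓕 : Filtration ℝ≥0 mΩ) (T t : ℝ≥0) : Set (PathSpace P T) :=
  {φ | ∃ (a b : ℝ≥0) (ξ : Ω → ℝ), t ≤ a ∧ a ≤ b ∧ b ≤ T ∧ Measurable[𝓕 a] ξ ∧
    (∃ C : ℝ, ∀ᵐ ω ∂P, |ξ ω| ≤ C) ∧ φ = seg P T a b (fun _ => toL2 P ξ)}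

/-- The closed span of the elementary integrands that vanish up to time `t`. -/
noncomputable def integrands (P : Measure Ω) [IsProbabilityMeasure P] (𝓕 : Filtration ℝ≥0 mΩ)
    (T t : ℝ≥0) : Submodule ℝ (PathSpace P T) :=
  closedSpan (elementary P 𝓕 T t)

lemma integrands_anti {s t : ℝ≥0} (hst : s ≤ t) : integrands P 𝓕 T t ≤ integrands P 𝓕 T s := by
  apply Submodule.topologicalClosure_mono
  apply Submodule.span_mono
  rintro φ ⟨a, b, ξ, h1, h2⟩
  exact ⟨a, b, ξ, hst.trans h1, h2⟩

lemma integrands_le {t : ℝ≥0} {K : Submodule ℝ (PathSpace P T)}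
    (hK : IsClosed (K : Set (PathSpace P T))) (h : elementary P 𝓕 T t ⊆ K) :
    integrands P 𝓕 T t ≤ K :=
  Submodule.topologicalClosure_minimal _ (Submodule.span_le.2 h) hK

lemma isClosed_integrands (t : ℝ≥0) :
    IsClosed (integrands P 𝓕 T t : Set (PathSpace P T)) :=
  Submodule.isClosed_topologicalClosure _

/-- `I` is the Itô integral with respect to `W` over `(0, T]`: it takes `1_{(a, b]} ξ` to
`ξ (W_b - W_a)`, and it is isometric on the space of adapted integrands. -/
structure IsItoIntegral (P : Measure Ω) [IsProbabilityMeasure P] (𝓕 : Filtration ℝ≥0 mΩ)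
    (T : ℝ≥0) (W : ℝ≥0 → Ω → ℝ) (I : PathSpace P T →L[ℝ] Lp ℝ 2 P) : Prop where
  apply_elementary : ∀ (a b : ℝ≥0) (ξ : Ω → ℝ), a ≤ b → b ≤ T → Measurable[𝓕 a] ξ →
    (∃ C : ℝ, ∀ᵐ ω ∂P, |ξ ω| ≤ C) →
    I (seg P T a b (fun _ => toL2 P ξ)) = toL2 P (fun ω => ξ ω * (W b ω - W a ω))
  isometry : ∀ φ ∈ integrands P 𝓕 T 0, ∀ φ' ∈ integrands P 𝓕 T 0,
    inner ℝ (I φ) (I φ') = inner ℝ φ φ'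

lemma IsBrownianMotion.memLp_mul_increment (hW : IsBrownianMotion W 𝓕 P) {a b : ℝ≥0} {ξ : Ω → ℝ}
    (hξ : AEStronglyMeasurable ξ P) {C : ℝ} (hC : ∀ᵐ ω ∂P, |ξ ω| ≤ C) :
    MemLp (fun ω => ξ ω * (W b ω - W a ω)) 2 P :=
  (hW.memLp_increment a b).of_le_mul (c := C)
    (hξ.mul ((hW.measurable b).sub (hW.measurable a)).aestronglyMeasurable) (by
      filter_upwards [hC] with ω hω
      rw [norm_mul]
      exact mul_le_mul_of_nonneg_right hω (norm_nonneg _))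

/-- Existence of the Itô integral. -/
lemma IsBrownianMotion.exists_isItoIntegral (hW : IsBrownianMotion W 𝓕 P) (T : ℝ≥0) :
    ∃ I, IsItoIntegral P 𝓕 T W I := by
  let ι := {p : ℝ≥0 × ℝ≥0 × (Ω → ℝ) // p.1 ≤ p.2.1 ∧ p.2.1 ≤ T ∧ Measurable[𝓕 p.1] p.2.2 ∧
    ∃ C : ℝ, ∀ᵐ ω ∂P, |p.2.2 ω| ≤ C}
  let e : ι → PathSpace P T := fun p => seg P T p.1.1 p.1.2.1 (fun _ => toL2 P p.1.2.2)
  let f : ι → Lp ℝ 2 P := fun p =>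
    toL2 P (fun ω => p.1.2.2 ω * (W p.1.2.1 ω - W p.1.1 ω))
  have hgram : ∀ i j, inner ℝ (e i) (e j) = inner ℝ (f i) (f j) := by
    rintro ⟨⟨a, b, ξ⟩, hab, hbT, hξ, C, hC⟩ ⟨⟨c, d, η⟩, hcd, hdT, hη, C', hC'⟩
    dsimp only at hab hbT hξ hC hcd hdT hη hC'
    simp only [e, f]
    have h1 := memLp_two_of_bdd (aesm_of_measurable hξ) hC
    have h2 := memLp_two_of_bdd (aesm_of_measurable hη) hC'
    rw [inner_seg_const hbT, inner_eq_integral, inner_eq_integral]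
    have h3 : ∫ ω, toL2 P ξ ω * toL2 P η ω ∂P = ∫ ω, ξ ω * η ω ∂P := by
      apply integral_congr_ae
      filter_upwards [coeFn_toL2 h1, coeFn_toL2 h2] with ω h h'
      rw [h, h']
    rw [h3, ← hW.integral_elementary_mul hab hcd hξ hη hC hC']
    apply integral_congr_ae
    filter_upwards [coeFn_toL2 (hW.memLp_mul_increment (a := a) (b := b)
      (aesm_of_measurable hξ) hC),
      coeFn_toL2 (hW.memLp_mul_increment (a := c) (b := d) (aesm_of_measurable hη) hC')] with ω h h'
    rw [h, h']
  obtain ⟨I, hI1, hI2⟩ := exists_clm_of_gram_eq e f hgram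
  have hrange : range e = elementary P 𝓕 T 0 := by
    ext φ
    constructor
    · rintro ⟨⟨⟨a, b, ξ⟩, hab, hbT, hξ, hC⟩, rfl⟩
      exact ⟨a, b, ξ, zero_le, hab, hbT, hξ, hC, rfl⟩
    · rintro ⟨a, b, ξ, _, hab, hbT, hξ, hC, rfl⟩
      exact ⟨⟨⟨a, b, ξ⟩, hab, hbT, hξ, hC⟩, rfl⟩
  refine ⟨I, ⟨fun a b ξ hab hbT hξ hC => hI1 ⟨⟨a, b, ξ⟩, hab, hbT, hξ, hC⟩, ?_⟩⟩
  rw [hrange] at hI2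
  exact hI2

lemma coe_gridPoint {a b : ℝ≥0} (hab : a ≤ b) (K k : ℕ) :
    (gridPoint a b K k : ℝ) = realGrid a b K k := by
  simp [gridPoint, realGrid, NNReal.coe_sub hab]

lemma gridPoint_mono {a b : ℝ≥0} (hab : a ≤ b) (K : ℕ) : Monotone (gridPoint a b K) := by
  intro i j hij
  rw [← NNReal.coe_le_coe, coe_gridPoint hab, coe_gridPoint hab]
  exact realGrid_mono (by exact_mod_cast hab) K hij

lemma gridPoint_mem {a b : ℝ≥0} (hab : a ≤ b) {K k : ℕ} (hK : K ≠ 0) (hk : k ≤ K) :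
    gridPoint a b K k ∈ Icc a b := by
  have h := realGrid_mem (a := (a : ℝ)) (b := b) (by exact_mod_cast hab) hK hk
  rw [← coe_gridPoint hab] at h
  exact ⟨by exact_mod_cast h.1, by exact_mod_cast h.2⟩

/-- The step function along the equidistant partition of `[a, b]`, in the path space. -/
noncomputable def stepPath (P : Measure Ω) (T : ℝ≥0) (a b : ℝ≥0) (U : ℝ → Lp ℝ 2 P) (K : ℕ) :
    PathSpace P T := toL2 (timeMeasure T) (stepFun U a b K)

lemma stepPath_eq_sum {a b : ℝ≥0} (hab : a ≤ b) (U : ℝ → Lp ℝ 2 P) (K : ℕ) :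
    stepPath P T a b U K = ∑ k ∈ Finset.range K,
      seg P T (gridPoint a b K k) (gridPoint a b K (k + 1)) (fun _ => U (gridPoint a b K k)) := by
  simp only [coe_gridPoint hab]
  exact toL2_sum _ fun k _ => segMemLp_const _ _ _

variable {C : ℝ} {U : ℝ → Lp ℝ 2 P}

lemma IsAdaptedPath.tendsto_stepPath (hU : IsAdaptedPath P 𝓕 T C U) {a b : ℝ≥0} (hab : a ≤ b)
    (hb : b ≤ T) : Tendsto (stepPath P T a b U) atTop (𝓝 (seg P T a b U)) := by
  have hab' : (a : ℝ) ≤ b := by exact_mod_cast hab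
  have hb' : (b : ℝ) ≤ T := by exact_mod_cast hb
  refine (tendsto_eLpNorm_two_of_dominated (C := C)
    (fun K => (stronglyMeasurable_stepFun U a b K).aestronglyMeasurable) (fun K => ?_) ?_).2
  · exact ae_of_all _ fun τ => norm_stepFun_le U hab' (hU.norm_le' a.2 hb') K τ
  · exact ae_of_all _ fun τ => tendsto_stepFun hab' (hU.leftCont' a.2 hb') τ

lemma IsAdaptedPath.seg_const_mem (hU : IsAdaptedPath P 𝓕 T C U) {t a b : ℝ≥0} (hta : t ≤ a)
    (hab : a ≤ b) (hb : b ≤ T) : seg P T a b (fun _ => U a) ∈ integrands P 𝓕 T t := by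
  obtain ⟨ξ, h1, h2, h3⟩ := hU.adapted a (hab.trans hb)
  rw [h3]
  exact Submodule.le_topologicalClosure _ (Submodule.subset_span
    ⟨a, b, ξ, hta, hab, hb, h1, ⟨C, h2⟩, rfl⟩)

lemma IsAdaptedPath.stepPath_mem (hU : IsAdaptedPath P 𝓕 T C U) {t a b : ℝ≥0} (hta : t ≤ a)
    (hab : a ≤ b) (hb : b ≤ T) (K : ℕ) : stepPath P T a b U K ∈ integrands P 𝓕 T t := by
  rw [stepPath_eq_sum hab]
  refine Submodule.sum_mem _ fun k hk => ?_
  have hk := Finset.mem_range.1 hk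
  have hK : K ≠ 0 := by omega
  exact hU.seg_const_mem (hta.trans (gridPoint_mem hab hK hk.le).1)
    (gridPoint_mono hab K (Nat.le_succ k)) ((gridPoint_mem hab hK hk).2.trans hb)

lemma IsAdaptedPath.seg_mem (hU : IsAdaptedPath P 𝓕 T C U) {t a b : ℝ≥0} (hta : t ≤ a)
    (hab : a ≤ b) (hb : b ≤ T) : seg P T a b U ∈ integrands P 𝓕 T t :=
  (isClosed_integrands t).mem_of_tendsto (hU.tendsto_stepPath hab hb)
    (Eventually.of_forall fun K => hU.stepPath_mem hta hab hb K)

variable {I : PathSpace P T →L[ℝ] Lp ℝ 2 P}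

lemma IsItoIntegral.norm_apply (hI : IsItoIntegral P 𝓕 T W I) {φ : PathSpace P T} {t : ℝ≥0}
    (hφ : φ ∈ integrands P 𝓕 T t) : ‖I φ‖ = ‖φ‖ := by
  have h := integrands_anti zero_le hφ
  have h1 : ‖I φ‖ ^ 2 = ‖φ‖ ^ 2 := by
    rw [← real_inner_self_eq_norm_sq, ← real_inner_self_eq_norm_sq, hI.isometry φ h φ h]
  exact (sq_eq_sq₀ (norm_nonneg _) (norm_nonneg _)).1 h1

/-- The Itô integral of a step function is a non-anticipating Riemann sum. -/
lemma IsItoIntegral.apply_stepPath (hW : IsBrownianMotion W 𝓕 P) (hI : IsItoIntegral P 𝓕 T W I)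
    {ξ : ℝ≥0 → Ω → ℝ} (hξ : ∀ s ≤ T, Measurable[𝓕 s] (ξ s))
    (hC : ∀ s ≤ T, ∀ᵐ ω ∂P, |ξ s ω| ≤ C) (hUξ : ∀ s : ℝ≥0, s ≤ T → U s = toL2 P (ξ s))
    {a b : ℝ≥0} (hab : a ≤ b) (hb : b ≤ T) (K : ℕ) :
    I (stepPath P T a b U K) = toL2 P (riemannSum W ξ a b K) := by
  rw [stepPath_eq_sum hab, map_sum]
  have hle : ∀ k ∈ Finset.range K, gridPoint a b K k ≤ T ∧ gridPoint a b K (k + 1) ≤ T := by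
    intro k hk
    have hk := Finset.mem_range.1 hk
    have hK : K ≠ 0 := by omega
    exact ⟨(gridPoint_mem hab hK hk.le).2.trans hb, (gridPoint_mem hab hK hk).2.trans hb⟩
  have h2 : ∀ k ∈ Finset.range K, MemLp (fun ω => ξ (gridPoint a b K k) ω *
      (W (gridPoint a b K (k + 1)) ω - W (gridPoint a b K k) ω)) 2 P := fun k hk =>
    hW.memLp_mul_increment (aesm_of_measurable (hξ _ (hle k hk).1)) (hC _ (hle k hk).1)
  rw [show riemannSum W ξ a b K = fun ω => ∑ k ∈ Finset.range K, ξ (gridPoint a b K k) ω *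
    (W (gridPoint a b K (k + 1)) ω - W (gridPoint a b K k) ω) from rfl, toL2_sum _ h2]
  refine Finset.sum_congr rfl fun k hk => ?_
  rw [hUξ _ (hle k hk).1]
  exact hI.apply_elementary _ _ _ (gridPoint_mono hab K (Nat.le_succ k)) (hle k hk).2
    (hξ _ (hle k hk).1) ⟨C, hC _ (hle k hk).1⟩

lemma memLp_riemannSum (hW : IsBrownianMotion W 𝓕 P)
    {ξ : ℝ≥0 → Ω → ℝ} (hξ : ∀ s ≤ T, Measurable[𝓕 s] (ξ s))
    (hC : ∀ s ≤ T, ∀ᵐ ω ∂P, |ξ s ω| ≤ C) {a b : ℝ≥0} (hab : a ≤ b) (hb : b ≤ T) (K : ℕ) :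
    MemLp (riemannSum W ξ a b K) 2 P := by
  refine memLp_finsetSum (f := fun k ω => ξ (gridPoint a b K k) ω *
    (W (gridPoint a b K (k + 1)) ω - W (gridPoint a b K k) ω)) _ fun k hk => ?_
  have hk := Finset.mem_range.1 hk
  have hK : K ≠ 0 := by omega
  have hle := (gridPoint_mem hab hK hk.le).2.trans hb
  exact hW.memLp_mul_increment (aesm_of_measurable (hξ _ hle)) (hC _ hle)

/-- The Itô integral of a control is its stochastic integral in the sense of limits of Riemann
sums. -/
lemma IsItoIntegral.isStochasticIntegral (hW : IsBrownianMotion W 𝓕 P)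
    (hI : IsItoIntegral P 𝓕 T W I) {M : ℝ} {u : ℝ≥0 → Ω → ℝ} (hu : IsControl 𝓕 P T M u)
    {a b : ℝ≥0} (hab : a ≤ b) (hb : b ≤ T) :
    IsStochasticIntegral P W u a b (I (seg P T a b (pathL2 P u))) := by
  refine ⟨Lp.aestronglyMeasurable _, ?_⟩
  have h1 := (I.continuous.tendsto _).comp (hu.isAdaptedPath.tendsto_stepPath hab hb)
  have hR : ∀ K, MemLp (riemannSum W u a b K) 2 P := fun K =>
    memLp_riemannSum hW hu.adapted (fun s hs => hu.ae_abs_le hs) hab hb K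
  have h2 : ∀ K, I (stepPath P T a b (pathL2 P u) K) = toL2 P (riemannSum W u a b K) := fun K =>
    hI.apply_stepPath hW hu.adapted (fun s hs => hu.ae_abs_le hs) (fun s _ => by simp [pathL2])
      hab hb K
  simp only [Function.comp_def, h2] at h1
  have h3 := tendstoInMeasure_of_tendsto_Lp h1
  exact h3.congr_left fun K => coeFn_toL2 (hR K)

/-- Itô integrals over times after `t` have mean zero given the information at time `t`. -/
lemma IsItoIntegral.condProj_eq_zero (hW : IsBrownianMotion W 𝓕 P) (hI : IsItoIntegral P 𝓕 T W I)
    {t : ℝ≥0} {φ : PathSpace P T} (hφ : φ ∈ integrands P 𝓕 T t) :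
    condProj P (𝓕.le t) (I φ) = 0 := by
  let K : Submodule ℝ (PathSpace P T) := ((condProj P (𝓕.le t)).comp I).ker
  have hK : IsClosed (K : Set (PathSpace P T)) := ContinuousLinearMap.isClosed_ker _
  refine integrands_le (K := K) hK ?_ hφ
  rintro _ ⟨a, b, ξ, hta, hab, hbT, hξ, ⟨C, hC⟩, rfl⟩
  change condProj P (𝓕.le t) (I _) = 0
  rw [hI.apply_elementary a b ξ hab hbT hξ ⟨C, hC⟩]
  refine MeanRisk.condProj_eq_zero _ fun A hA => ?_
  have hA' := 𝓕.le t A hA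
  have h1 : ∫ ω in A, (toL2 P fun ω => ξ ω * (W b ω - W a ω)) ω ∂P
      = ∫ ω, A.indicator ξ ω * (W b ω - W a ω) ∂P := by
    rw [← integral_indicator hA']
    apply integral_congr_ae
    filter_upwards [coeFn_toL2 (hW.memLp_mul_increment (a := a) (b := b)
      (aesm_of_measurable hξ) hC)] with ω hω
    by_cases h : ω ∈ A <;> simp [h, hω]
  rw [h1]
  exact hW.integral_mul_increment hab (hξ.indicator (𝓕.mono hta A hA))

/-- Multiplication by the indicator of an event, on the path space. -/
noncomputable def indPath (P : Measure Ω) [IsProbabilityMeasure P] (T : ℝ≥0) {A : Set Ω}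
    (hA : MeasurableSet A) : PathSpace P T →L[ℝ] PathSpace P T :=
  (indOp P hA).compLpL 2 (timeMeasure T)

lemma indPath_seg {A : Set Ω} (hA : MeasurableSet A) {a b : ℝ} (hU : SegMemLp T a b U) :
    indPath P T hA (seg P T a b U) = seg P T a b (fun τ => indOp P hA (U τ)) := by
  refine eq_toL2_of_ae_eq ?_
  filter_upwards [(indOp P hA).coeFn_compLpL (seg P T a b U), coeFn_seg hU] with τ h1 h2
  refine h1.trans ?_
  rw [h2]
  by_cases h : τ ∈ Ioc a b <;> simp [h]

lemma segMemLp_indOp {A : Set Ω} (hA : MeasurableSet A) {a b : ℝ} (hU : SegMemLp T a b U) :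
    SegMemLp T a b (fun τ => indOp P hA (U τ)) := by
  have h := (indOp P hA).comp_memLp' hU
  have h' : (indOp P hA) ∘ (Ioc a b).indicator U = (Ioc a b).indicator fun τ => indOp P hA (U τ) :=
    (indicator_comp_of_zero (map_zero _)).symm
  rwa [h'] at h

lemma indPath_elementary {A : Set Ω} {a b : ℝ≥0} (hA : MeasurableSet A) {ξ : Ω → ℝ}
    (hξ : MemLp ξ 2 P) : indPath P T hA (seg P T a b (fun _ => toL2 P ξ))
      = seg P T a b (fun _ => toL2 P (A.indicator ξ)) := by
  rw [indPath_seg hA (segMemLp_const _ _ _), indOp_toL2 hA hξ]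

lemma ae_abs_indicator_le {A : Set Ω} {ξ : Ω → ℝ} {C : ℝ} (hC : ∀ᵐ ω ∂P, |ξ ω| ≤ C) :
    ∀ᵐ ω ∂P, |A.indicator ξ ω| ≤ C := by
  filter_upwards [hC] with ω hω
  by_cases h : ω ∈ A
  · simpa [h] using hω
  · simpa [h] using (abs_nonneg _).trans hω

lemma indPath_mem {t : ℝ≥0} {A : Set Ω} (hA : MeasurableSet[𝓕 t] A) {φ : PathSpace P T}
    (hφ : φ ∈ integrands P 𝓕 T t) :
    indPath P T (𝓕.le t A hA) φ ∈ integrands P 𝓕 T t := by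
  let K : Submodule ℝ (PathSpace P T) :=
    (integrands P 𝓕 T t).comap (indPath P T (𝓕.le t A hA)).toLinearMap
  have hK : IsClosed (K : Set (PathSpace P T)) :=
    (isClosed_integrands t).preimage (indPath P T (𝓕.le t A hA)).continuous
  refine integrands_le (K := K) hK ?_ hφ
  rintro _ ⟨a, b, ξ, hta, hab, hbT, hξ, ⟨C, hC⟩, rfl⟩
  change indPath P T (𝓕.le t A hA) _ ∈ integrands P 𝓕 T t
  rw [indPath_elementary _ (memLp_two_of_bdd (aesm_of_measurable hξ) hC)]
  exact Submodule.le_topologicalClosure _ (Submodule.subset_span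
    ⟨a, b, _, hta, hab, hbT, hξ.indicator (𝓕.mono hta A hA), ⟨C, ae_abs_indicator_le hC⟩, rfl⟩)

/-- Events known at time `t` can be taken out of Itô integrals over times after `t`. -/
lemma IsItoIntegral.apply_indPath (hW : IsBrownianMotion W 𝓕 P) (hI : IsItoIntegral P 𝓕 T W I)
    {t : ℝ≥0} {A : Set Ω} (hA : MeasurableSet[𝓕 t] A) {φ : PathSpace P T}
    (hφ : φ ∈ integrands P 𝓕 T t) :
    I (indPath P T (𝓕.le t A hA) φ) = indOp P (𝓕.le t A hA) (I φ) := by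
  let D : PathSpace P T →L[ℝ] Lp ℝ 2 P :=
    I.comp (indPath P T (𝓕.le t A hA)) - (indOp P (𝓕.le t A hA)).comp I
  have hK : IsClosed (D.ker : Set (PathSpace P T)) := ContinuousLinearMap.isClosed_ker _
  have h0 : φ ∈ D.ker := by
    refine integrands_le hK ?_ hφ
    rintro _ ⟨a, b, ξ, hta, hab, hbT, hξ, ⟨C, hC⟩, rfl⟩
    change I (indPath P T (𝓕.le t A hA) _) - indOp P (𝓕.le t A hA) (I _) = 0
    rw [sub_eq_zero, indPath_elementary _ (memLp_two_of_bdd (aesm_of_measurable hξ) hC),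
      hI.apply_elementary a b ξ hab hbT hξ ⟨C, hC⟩,
      hI.apply_elementary a b _ hab hbT (hξ.indicator (𝓕.mono hta A hA))
        ⟨C, ae_abs_indicator_le hC⟩,
      indOp_toL2 _ (hW.memLp_mul_increment (aesm_of_measurable hξ) hC)]
    apply toL2_congr
    refine ae_of_all _ fun ω => ?_
    by_cases h : ω ∈ A <;> simp [h]
  exact sub_eq_zero.1 h0

lemma IsItoIntegral.aestronglyMeasurable_seg (hW : IsBrownianMotion W 𝓕 P)
    (hI : IsItoIntegral P 𝓕 T W I) (hU : IsAdaptedPath P 𝓕 T C U) {a b t : ℝ≥0} (hab : a ≤ b)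
    (hb : b ≤ T) (hbt : b ≤ t) : AEStronglyMeasurable[𝓕 t] (I (seg P T a b U)) P := by
  refine (isClosed_aestronglyMeasurable (𝓕.le t)).mem_of_tendsto
    ((I.continuous.tendsto _).comp (hU.tendsto_stepPath hab hb)) (Eventually.of_forall fun K => ?_)
  change I (stepPath P T a b U K) ∈ lpMeas ℝ ℝ (𝓕 t) 2 P
  rw [stepPath_eq_sum hab, map_sum]
  refine Submodule.sum_mem _ fun k hk => ?_
  have hk := Finset.mem_range.1 hk
  have hK : K ≠ 0 := by omega
  have hle := (gridPoint_mem hab hK hk.le).2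
  have hle' := (gridPoint_mem hab hK hk).2
  obtain ⟨ξ, h1, h2, h3⟩ := hU.adapted _ (hle.trans hb)
  rw [h3, hI.apply_elementary _ _ _ (gridPoint_mono hab K (Nat.le_succ k)) (hle'.trans hb) h1
    ⟨C, h2⟩]
  refine aestronglyMeasurable_toL2 (hW.memLp_mul_increment (aesm_of_measurable h1) h2) ?_
  refine Measurable.aestronglyMeasurable (Measurable.mul ?_ (Measurable.sub ?_ ?_))
  · exact h1.mono (𝓕.mono (hle.trans hbt)) le_rfl
  · exact (hW.adapted _).mono (𝓕.mono (hle'.trans hbt)) le_rfl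
  · exact (hW.adapted _).mono (𝓕.mono (hle.trans hbt)) le_rfl

/-- The time integral `φ ↦ ∫_0^T φ_s ds` on the path space, defined as the adjoint of the
embedding of the constant paths. -/
noncomputable def timeIntegral (P : Measure Ω) (T : ℝ≥0) : PathSpace P T →L[ℝ] Lp ℝ 2 P :=
  ContinuousLinearMap.adjoint (Lp.constL 2 (timeMeasure T) ℝ)

lemma timeIntegral_seg {a b : ℝ} (ha : 0 ≤ a) (hab : a ≤ b) (hb : b ≤ T) (hU : SegMemLp T a b U)
    (hint : IntervalIntegrable U volume a b) :
    timeIntegral P T (seg P T a b U) = ∫ τ in a..b, U τ := by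
  refine ext_inner_left ℝ fun η => ?_
  rw [timeIntegral, ContinuousLinearMap.adjoint_inner_right, real_inner_comm,
    inner_seg_left ha hab hb hU]
  have h1 : ∫ τ in a..b, inner ℝ (U τ) (Lp.constL 2 (timeMeasure T) ℝ η τ)
      = ∫ τ in a..b, inner ℝ η (U τ) := by
    rw [intervalIntegral.integral_of_le hab, intervalIntegral.integral_of_le hab]
    apply integral_congr_ae
    have h2 := ae_restrict_of_ae_restrict_of_subset (Ioc_subset_Ioc ha hb)
      (Lp.coeFn_const (p := 2) (μ := timeMeasure T) η)
    filter_upwards [h2] with τ hτ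
    have h3 : Lp.constL 2 (timeMeasure T) ℝ η τ = η := hτ
    rw [h3, real_inner_comm]
  rw [h1]
  exact (innerSL ℝ η).intervalIntegral_comp_comm hint

lemma IsAdaptedPath.timeIntegral_seg (hU : IsAdaptedPath P 𝓕 T C U) {a b : ℝ} (ha : 0 ≤ a)
    (hab : a ≤ b) (hb : b ≤ T) : timeIntegral P T (seg P T a b U) = ∫ τ in a..b, U τ :=
  MeanRisk.timeIntegral_seg ha hab hb (hU.segMemLp ha hab hb) (hU.intervalIntegrable ha hab hb)

lemma IsAdaptedPath.aestronglyMeasurable_timeIntegral (hU : IsAdaptedPath P 𝓕 T C U) {a b t : ℝ≥0}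
    (hab : a ≤ b) (hb : b ≤ T) (hbt : b ≤ t) :
    AEStronglyMeasurable[𝓕 t] (timeIntegral P T (seg P T a b U)) P := by
  have hab' : (a : ℝ) ≤ b := by exact_mod_cast hab
  have hb' : (b : ℝ) ≤ T := by exact_mod_cast hb
  rw [hU.timeIntegral_seg a.coe_nonneg hab' hb']
  refine (isClosed_aestronglyMeasurable (𝓕.le t)).mem_of_tendsto
    (tendsto_riemann hab' (hU.leftCont' a.2 hb') (hU.norm_le' a.2 hb'))
    (Eventually.of_forall fun K => ?_)
  change _ ∈ lpMeas ℝ ℝ (𝓕 t) 2 P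
  refine Submodule.sum_mem _ fun k hk => Submodule.smul_mem _ _ ?_
  have hk := Finset.mem_range.1 hk
  have hK : K ≠ 0 := by omega
  have hle := (gridPoint_mem hab hK hk.le).2
  rw [← coe_gridPoint hab]
  exact hU.aestronglyMeasurable (hle.trans hb) (hle.trans hbt)

end Ito

/-! ### Continuous versions of Itô integrals -/

section Doob

variable {Ω : Type*} {mΩ : MeasurableSpace Ω} {P : Measure Ω} [IsProbabilityMeasure P]
  {𝓕 : Filtration ℝ≥0 mΩ} {T : ℝ≥0}

lemma integral_sq_eq_norm_indOp_sq {A : Set Ω} (hA : MeasurableSet A) {z : Lp ℝ 2 P} {Z : Ω → ℝ}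
    (hZ : Z =ᵐ[P] z) : ∫ ω in A, Z ω ^ 2 ∂P = ‖indOp P hA z‖ ^ 2 := by
  rw [← real_inner_self_eq_norm_sq, inner_indOp_indOp, inner_indOp_left]
  apply setIntegral_congr_ae hA
  filter_upwards [hZ] with ω hω _
  rw [hω, sq]

/-- Kolmogorov's maximal inequality for square integrable martingales in discrete time. -/
lemma measure_exists_le_discrete {𝒢 : Filtration ℕ mΩ} {Z : ℕ → Ω → ℝ} {z : ℕ → Lp ℝ 2 P}
    (hZm : ∀ k, StronglyMeasurable[𝒢 k] (Z k)) (hZ : ∀ k, Z k =ᵐ[P] z k)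
    (hmart : ∀ k, condProj P (𝒢.le k) (z (k + 1) - z k) = 0) {ε : ℝ} (hε : 0 < ε) (n : ℕ) :
    P {ω | ∃ k ≤ n, ε ≤ |Z k ω|} ≤ ENNReal.ofReal (‖z n‖ ^ 2 / ε ^ 2) := by
  have hZ2 : ∀ k, MemLp (Z k) 2 P := fun k => (Lp.memLp (z k)).ae_eq (hZ k).symm
  have hsub : Submartingale (fun k ω => Z k ω ^ 2) 𝒢 P := by
    refine submartingale_of_setIntegral_le_succ (fun k => (hZm k).pow 2)
      (fun k => (hZ2 k).integrable_sq) fun k A hA => ?_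
    have hA' := 𝒢.le k A hA
    rw [integral_sq_eq_norm_indOp_sq hA' (hZ k), integral_sq_eq_norm_indOp_sq hA' (hZ (k + 1))]
    have hzm : AEStronglyMeasurable[𝒢 k] (z k) P :=
      ⟨Z k, hZm k, (hZ k).symm⟩
    have horth : inner ℝ (indOp P hA' (z k)) (indOp P hA' (z (k + 1) - z k)) = 0 := by
      rw [inner_indOp_indOp, real_inner_comm,
        ← inner_condProj_of_meas (𝒢.le k) _ (aestronglyMeasurable_indOp hA' hA hzm), hmart,
        inner_zero_left]
    have h1 : indOp P hA' (z (k + 1)) = indOp P hA' (z k) + indOp P hA' (z (k + 1) - z k) := by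
      rw [← map_add]; congr 1; abel
    rw [h1, norm_add_sq_real, horth]
    nlinarith [sq_nonneg ‖indOp P hA' (z (k + 1) - z k)‖]
  have hmax := maximal_ineq hsub (fun k ω => sq_nonneg (Z k ω)) (ε := (ε ^ 2).toNNReal) n
  have hεc : ((ε ^ 2).toNNReal : ℝ) = ε ^ 2 := Real.coe_toNNReal _ (sq_nonneg ε)
  set S := {ω | (((ε ^ 2).toNNReal : ℝ≥0) : ℝ) ≤
    (Finset.range (n + 1)).sup' Finset.nonempty_range_add_one fun k => Z k ω ^ 2} with hS
  have hsubset : {ω | ∃ k ≤ n, ε ≤ |Z k ω|} ⊆ S := by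
    rintro ω ⟨k, hk, h⟩
    rw [hS, mem_ofPred_eq, hεc, Finset.le_sup'_iff]
    refine ⟨k, Finset.mem_range.2 (by omega), ?_⟩
    rw [← sq_abs (Z k ω)]
    gcongr
  refine (measure_mono hsubset).trans ?_
  have hint : ∫ ω in S, Z n ω ^ 2 ∂P ≤ ‖z n‖ ^ 2 := by
    have h1 : ∫ ω in S, Z n ω ^ 2 ∂P ≤ ∫ ω, Z n ω ^ 2 ∂P :=
      setIntegral_le_integral (hZ2 n).integrable_sq (ae_of_all _ fun ω => sq_nonneg _)
    have h2 := integral_sq_eq_norm_indOp_sq MeasurableSet.univ (hZ n)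
    rw [setIntegral_univ] at h2
    rw [h2] at h1
    exact h1.trans (pow_le_pow_left₀ (norm_nonneg _) (norm_indOp_le _ _) 2)
  have h3 : ENNReal.ofReal (ε ^ 2) * P S ≤ ENNReal.ofReal (‖z n‖ ^ 2) :=
    hmax.trans (ENNReal.ofReal_le_ofReal hint)
  rw [ENNReal.ofReal_div_of_pos (by positivity)]
  rw [ENNReal.le_div_iff_mul_le (Or.inl (by simp; positivity)) (Or.inl ENNReal.ofReal_ne_top),
    mul_comm]
  exact h3

lemma gridPoint_two_mul (a b : ℝ≥0) (n k : ℕ) :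
    gridPoint a b (2 ^ (n + 1)) (2 * k) = gridPoint a b (2 ^ n) k := by
  rw [gridPoint, gridPoint]
  congr 2
  push_cast
  rw [pow_succ, mul_comm (2 : ℝ≥0) k]
  exact mul_div_mul_right _ _ two_ne_zero

lemma exists_gridPoint_near {a b : ℝ≥0} {s : ℝ≥0} (hs : s ∈ Icc a b) {δ : ℝ}
    (hδ : 0 < δ) : ∃ n k : ℕ, k ≤ 2 ^ n ∧ |(gridPoint a b (2 ^ n) k : ℝ) - s| < δ := by
  have hab : a ≤ b := hs.1.trans hs.2
  rcases eq_or_lt_of_le hs.1 with h | h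
  · exact ⟨0, 0, by simp, by simp [gridPoint, h, hδ]⟩
  obtain ⟨n, hn⟩ := pow_unbounded_of_one_lt (((b : ℝ) - a) / δ) (one_lt_two (α := ℝ))
  have hs' : (s : ℝ) ∈ Ioc (a : ℝ) b := ⟨by exact_mod_cast h, by exact_mod_cast hs.2⟩
  obtain ⟨k, hk, hk2⟩ := exists_mem_Ioc_realGrid (K := 2 ^ n) (by positivity) hs'
  refine ⟨n, k, hk.le, ?_⟩
  rw [coe_gridPoint hab]
  have h1 := realGrid_succ_sub (a : ℝ) b (2 ^ n) k
  have h2 : ((b : ℝ) - a) / ((2 ^ n : ℕ) : ℝ) < δ := by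
    rw [div_lt_iff₀ hδ] at hn
    rw [div_lt_iff₀ (by positivity)]
    push_cast
    linarith
  rw [abs_lt]
  constructor <;> linarith [hk2.1, hk2.2]

/-- The maximal inequality for martingales with continuous paths. -/
lemma measure_exists_lt_continuous {t : ℝ≥0} (htT : t ≤ T) {Z : ℝ≥0 → Ω → ℝ}
    {z : ℝ≥0 → Lp ℝ 2 P}
    (hZm : ∀ s ∈ Icc t T, StronglyMeasurable[𝓕 s] (Z s)) (hZ : ∀ s ∈ Icc t T, Z s =ᵐ[P] z s)
    (hcont : ∀ᵐ ω ∂P, ContinuousOn (fun s => Z s ω) (Icc t T))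
    (hmart : ∀ s s', t ≤ s → s ≤ s' → s' ≤ T → condProj P (𝓕.le s) (z s' - z s) = 0)
    {ε : ℝ} (hε : 0 < ε) :
    P {ω | ∃ s ∈ Icc t T, ε < |Z s ω|} ≤ ENNReal.ofReal (‖z T‖ ^ 2 / ε ^ 2) := by
  let B : ℕ → Set Ω := fun n => {ω | ∃ k ≤ 2 ^ n, ε ≤ |Z (gridPoint t T (2 ^ n) k) ω|}
  have hB : ∀ n, P (B n) ≤ ENNReal.ofReal (‖z T‖ ^ 2 / ε ^ 2) := by
    intro n
    -- the grid is frozen after the terminal time so as to be indexed by all natural numbers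
    let g : ℕ → ℝ≥0 := fun k => gridPoint t T (2 ^ n) (min k (2 ^ n))
    have hg : Monotone g := fun i j hij =>
      gridPoint_mono htT _ (min_le_min hij le_rfl)
    have hgm : ∀ k, g k ∈ Icc t T := fun k =>
      gridPoint_mem htT (by positivity) (min_le_right _ _)
    let 𝒢 : Filtration ℕ mΩ := ⟨fun k => 𝓕 (g k), fun i j hij => 𝓕.mono (hg hij), fun k => 𝓕.le _⟩
    have h := measure_exists_le_discrete (P := P) (𝒢 := 𝒢) (Z := fun k => Z (g k))
      (z := fun k => z (g k)) (fun k => hZm _ (hgm k)) (fun k => hZ _ (hgm k))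
      (fun k => hmart _ _ (hgm k).1 (hg (Nat.le_succ k)) (hgm (k + 1)).2) hε (2 ^ n)
    have hgT : g (2 ^ n) = T := by
      simp only [g, min_self, gridPoint]
      rw [div_self (by positivity), one_mul, add_tsub_cancel_of_le htT]
    rw [hgT] at h
    refine (measure_mono ?_).trans h
    rintro ω ⟨k, hk, hk2⟩
    refine ⟨k, hk, ?_⟩
    simpa only [g, min_eq_left hk] using hk2
  have hmono : Monotone B := by
    refine monotone_nat_of_le_succ fun n => ?_
    rintro ω ⟨k, hk, hk2⟩
    refine ⟨2 * k, by rw [pow_succ]; omega, ?_⟩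
    rwa [gridPoint_two_mul]
  have hsup : P (⋃ n, B n) ≤ ENNReal.ofReal (‖z T‖ ^ 2 / ε ^ 2) := by
    rw [hmono.measure_iUnion]
    exact iSup_le hB
  refine (measure_mono_ae ?_).trans hsup
  filter_upwards [hcont] with ω hω
  rintro ⟨s, hs, hsε⟩
  have h1 : ∀ᶠ s' in 𝓝[Icc t T] s, ε < |Z s' ω| :=
    ((hω s hs).abs.eventually (lt_mem_nhds hsε))
  obtain ⟨δ, hδ, hδ2⟩ := Metric.mem_nhdsWithin_iff.1 h1
  obtain ⟨n, k, hk, hk2⟩ := exists_gridPoint_near hs hδ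
  refine mem_iUnion.2 ⟨n, k, hk, ?_⟩
  refine le_of_lt (hδ2 ⟨?_, gridPoint_mem htT (by positivity) hk⟩)
  rwa [Metric.mem_ball, NNReal.dist_eq]

end Doob

section ContinuousVersion

variable {Ω : Type*} {mΩ : MeasurableSpace Ω} {P : Measure Ω} [IsProbabilityMeasure P]
  {𝓕 : Filtration ℝ≥0 mΩ} {T : ℝ≥0} {W : ℝ≥0 → Ω → ℝ} {C : ℝ} {U : ℝ → Lp ℝ 2 P}
  {I : PathSpace P T →L[ℝ] Lp ℝ 2 P}

lemma leftCont_indicator_Ioc {F : Type*} [NormedAddCommGroup F] (a b : ℝ) (c : F) (τ : ℝ) :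
    ContinuousWithinAt ((Ioc a b).indicator fun _ => c) (Iic τ) τ := by
  by_cases h : τ ∈ Ioc a b
  · have : ∀ᶠ s in 𝓝[Iic τ] τ, (Ioc a b).indicator (fun _ => c) s = c := by
      have h1 : ∀ᶠ s in 𝓝[Iic τ] τ, a < s := nhdsWithin_le_nhds (lt_mem_nhds h.1)
      filter_upwards [h1, self_mem_nhdsWithin] with s hs hs2
      exact indicator_of_mem (show s ∈ Ioc a b from ⟨hs, (mem_Iic.1 hs2).trans h.2⟩) _
    rw [ContinuousWithinAt, indicator_of_mem h]
    exact tendsto_const_nhds.congr' (this.mono fun s hs => hs.symm)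
  · have : ∀ᶠ s in 𝓝[Iic τ] τ, (Ioc a b).indicator (fun _ => c) s = 0 := by
      rcases le_or_gt τ a with h1 | h1
      · filter_upwards [self_mem_nhdsWithin] with s hs
        exact indicator_of_notMem (fun h2 => absurd h2.1 (not_lt.2 ((mem_Iic.1 hs).trans h1))) _
      · have h2 : b < τ := by
          by_contra h3
          exact h ⟨h1, not_lt.1 h3⟩
        have h3 : ∀ᶠ s in 𝓝[Iic τ] τ, b < s := nhdsWithin_le_nhds (lt_mem_nhds h2)
        filter_upwards [h3] with s hs
        exact indicator_of_notMem (fun h4 => absurd h4.2 (not_le.2 hs)) _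
    rw [ContinuousWithinAt, indicator_of_notMem h]
    exact tendsto_const_nhds.congr' (this.mono fun s hs => hs.symm)

lemma leftCont_stepFun {F : Type*} [NormedAddCommGroup F] (f : ℝ → F) (a b : ℝ) (K : ℕ) (τ : ℝ) :
    ContinuousWithinAt (stepFun f a b K) (Iic τ) τ := by
  unfold stepFun
  exact tendsto_finsetSum _ fun k _ => leftCont_indicator_Ioc _ _ _ τ

lemma IsAdaptedPath.stepFun (hU : IsAdaptedPath P 𝓕 T C U) {a b : ℝ≥0} (hab : a ≤ b) (hb : b ≤ T)
    (K : ℕ) : IsAdaptedPath P 𝓕 T C (stepFun U a b K) where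
  leftCont τ _ := leftCont_stepFun U a b K τ
  adapted s hs := by
    have hab' : (a : ℝ) ≤ b := by exact_mod_cast hab
    have h0 : ∃ ξ : Ω → ℝ, Measurable[𝓕 s] ξ ∧ (∀ᵐ ω ∂P, |ξ ω| ≤ C) ∧
        (0 : Lp ℝ 2 P) = toL2 P ξ := by
      refine ⟨fun _ => 0, measurable_const, ae_of_all _ fun _ => by simpa using hU.nonneg, ?_⟩
      have h : MemLp (fun _ : Ω => (0 : ℝ)) 2 P := memLp_const 0
      rw [toL2_eq h]
      exact (MemLp.toLp_zero h).symm
    rcases eq_or_ne K 0 with rfl | hK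
    · simpa [MeanRisk.stepFun] using h0
    by_cases h : (s : ℝ) ∈ Ioc (a : ℝ) b
    · obtain ⟨k, hk, hk2⟩ := exists_mem_Ioc_realGrid hK h
      rw [stepFun_of_mem_Ioc U hab' hk hk2, ← coe_gridPoint hab]
      obtain ⟨ξ, h1, h2, h3⟩ := hU.adapted _ ((gridPoint_mem hab hK hk.le).2.trans hb)
      refine ⟨ξ, h1.mono (𝓕.mono ?_) le_rfl, h2, h3⟩
      rw [← NNReal.coe_le_coe, coe_gridPoint hab]
      exact hk2.1.le
    · rw [stepFun_of_notMem U hab' K h]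
      exact h0

lemma seg_stepFun {a b : ℝ≥0} (hab : a ≤ b) (K : ℕ) :
    seg P T a b (stepFun U a b K) = stepPath P T a b U K := by
  rw [seg, stepPath]
  congr 1
  ext1 τ
  by_cases h : τ ∈ Ioc (a : ℝ) b
  · rw [indicator_of_mem h]
  · rw [indicator_of_notMem h, stepFun_of_notMem U (by exact_mod_cast hab) K h]

/-- The integral process of a step function, written with stopped increments. -/
noncomputable def stepIntegral (W ξ : ℝ≥0 → Ω → ℝ) (a b : ℝ≥0) (K : ℕ) (s : ℝ≥0) (ω : Ω) : ℝ :=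
  ∑ k ∈ Finset.range K, ξ (gridPoint a b K k) ω *
    (W (min (gridPoint a b K (k + 1)) s) ω - W (min (gridPoint a b K k) s) ω)

lemma continuous_stepIntegral {W ξ : ℝ≥0 → Ω → ℝ} {ω : Ω} (hW : Continuous fun s => W s ω)
    (a b : ℝ≥0) (K : ℕ) : Continuous fun s => stepIntegral W ξ a b K s ω := by
  unfold stepIntegral
  refine continuous_finsetSum _ fun k _ => continuous_const.mul (Continuous.sub ?_ ?_)
  · exact hW.comp (continuous_const.min continuous_id)
  · exact hW.comp (continuous_const.min continuous_id)

lemma measurable_stepIntegral (hW : IsBrownianMotion W 𝓕 P) {ξ : ℝ≥0 → Ω → ℝ} {a b : ℝ≥0}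
    (hab : a ≤ b) (hξ : ∀ s ≤ b, Measurable[𝓕 s] (ξ s)) (K : ℕ) (s : ℝ≥0) :
    Measurable[𝓕 s] (stepIntegral W ξ a b K s) := by
  unfold stepIntegral
  refine Finset.measurable_fun_sum _ fun k hk => ?_
  have hk := Finset.mem_range.1 hk
  have hK : K ≠ 0 := by omega
  have hWm : ∀ r, Measurable[𝓕 s] (W (min r s)) := fun r =>
    (hW.adapted _).mono (𝓕.mono (min_le_right _ _)) le_rfl
  rcases le_total (gridPoint a b K k) s with h | h
  · exact ((hξ _ (gridPoint_mem hab hK hk.le).2).mono (𝓕.mono h) le_rfl).mul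
      ((hWm _).sub (hWm _))
  · have h2 := h.trans (gridPoint_mono hab K (Nat.le_succ k))
    simp only [min_eq_right h, min_eq_right h2, sub_self, mul_zero]
    exact measurable_const

lemma IsItoIntegral.stepIntegral_ae_eq (hW : IsBrownianMotion W 𝓕 P) (hI : IsItoIntegral P 𝓕 T W I)
    {ξ : ℝ≥0 → Ω → ℝ} (hξ : ∀ s ≤ T, Measurable[𝓕 s] (ξ s))
    (hC : ∀ s ≤ T, ∀ᵐ ω ∂P, |ξ s ω| ≤ C) (hUξ : ∀ s : ℝ≥0, s ≤ T → U s = toL2 P (ξ s))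
    {a b s : ℝ≥0} (hab : a ≤ b) (hb : b ≤ T) (hs : s ∈ Icc a b) (K : ℕ) :
    stepIntegral W ξ a b K s =ᵐ[P] I (seg P T a s (stepFun U a b K)) := by
  have hab' : (a : ℝ) ≤ b := by exact_mod_cast hab
  have hle : ∀ k ∈ Finset.range K, gridPoint a b K k ∈ Icc a b := by
    intro k hk
    have hk := Finset.mem_range.1 hk
    exact gridPoint_mem hab (by omega) hk.le
  have h1 : seg P T a s (stepFun U a b K) = ∑ k ∈ Finset.range K,
      seg P T ((min (gridPoint a b K k) s : ℝ≥0) : ℝ) ((min (gridPoint a b K (k + 1)) s : ℝ≥0) : ℝ)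
        (fun _ => U (gridPoint a b K k)) := by
    have h2 := toL2_sum (μ := timeMeasure T) (Finset.range K)
      (f := fun k => (Ioc ((min (gridPoint a b K k) s : ℝ≥0) : ℝ)
        ((min (gridPoint a b K (k + 1)) s : ℝ≥0) : ℝ)).indicator
          (fun _ => U (gridPoint a b K k))) (fun k _ => segMemLp_const _ _ _)
    refine Eq.trans ?_ h2
    rw [seg]
    congr 1
    ext1 τ
    by_cases hτ : τ ∈ Ioc (a : ℝ) s
    · rw [indicator_of_mem hτ, MeanRisk.stepFun]
      refine Finset.sum_congr rfl fun k hk => ?_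
      simp only [indicator, NNReal.coe_min, coe_gridPoint hab, mem_Ioc, le_min_iff, min_lt_iff]
      have h3 : ¬ (s : ℝ) < τ := not_lt.2 hτ.2
      simp [h3, hτ.2]
    · rw [indicator_of_notMem hτ, eq_comm]
      refine Finset.sum_eq_zero fun k hk => indicator_of_notMem (fun h => hτ ?_) _
      refine ⟨lt_of_le_of_lt ?_ h.1, h.2.trans (by simp)⟩
      exact_mod_cast le_min (hle k hk).1 hs.1
  have hmem : ∀ k ∈ Finset.range K, MemLp (fun ω => ξ (gridPoint a b K k) ω *
      (W (min (gridPoint a b K (k + 1)) s) ω - W (min (gridPoint a b K k) s) ω)) 2 P := fun k hk =>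
    hW.memLp_mul_increment (aesm_of_measurable (hξ _ ((hle k hk).2.trans hb)))
      (hC _ ((hle k hk).2.trans hb))
  have h4 : I (seg P T a s (stepFun U a b K)) = toL2 P (stepIntegral W ξ a b K s) := by
    rw [h1, map_sum]
    refine Eq.trans ?_ (toL2_sum _ hmem).symm
    refine Finset.sum_congr rfl fun k hk => ?_
    rcases le_total (gridPoint a b K k) s with h | h
    · rw [min_eq_left h, hUξ _ ((hle k hk).2.trans hb)]
      exact hI.apply_elementary _ _ _ (le_min (gridPoint_mono hab K (Nat.le_succ k)) h)
        ((min_le_right _ _).trans (hs.2.trans hb)) (hξ _ ((hle k hk).2.trans hb))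
        ⟨C, hC _ ((hle k hk).2.trans hb)⟩
    · have h2 := h.trans (gridPoint_mono hab K (Nat.le_succ k))
      rw [min_eq_right h, min_eq_right h2, seg_self, map_zero]
      simp only [sub_self, mul_zero]
      have h5 : MemLp (fun _ : Ω => (0 : ℝ)) 2 P := memLp_const 0
      rw [toL2_eq h5]
      exact (MemLp.toLp_zero h5).symm
  rw [h4]
  refine (coeFn_toL2 ?_).symm
  exact memLp_finsetSum (f := fun k ω => ξ (gridPoint a b K k) ω *
    (W (min (gridPoint a b K (k + 1)) s) ω - W (min (gridPoint a b K k) s) ω)) _ hmem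

lemma IsAdaptedPath.tendsto_seg_stepFun (hU : IsAdaptedPath P 𝓕 T C U) {a b s : ℝ≥0} (hab : a ≤ b)
    (hb : b ≤ T) (hs : s ∈ Icc a b) :
    Tendsto (fun K => seg P T a s (MeanRisk.stepFun U a b K)) atTop (𝓝 (seg P T a s U)) := by
  have hab' : (a : ℝ) ≤ b := by exact_mod_cast hab
  have hb' : (b : ℝ) ≤ T := by exact_mod_cast hb
  have hsb : (s : ℝ) ≤ b := by exact_mod_cast hs.2
  refine (tendsto_eLpNorm_two_of_dominated (C := C) (fun K => ?_) (fun K => ?_) ?_).2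
  · exact ((stronglyMeasurable_stepFun U a b K).indicator measurableSet_Ioc).aestronglyMeasurable
  · refine ae_of_all _ fun τ => (norm_indicator_le_norm_self _ _).trans ?_
    exact norm_stepFun_le U hab' (hU.norm_le' a.coe_nonneg hb') K τ
  · refine ae_of_all _ fun τ => ?_
    by_cases hτ : τ ∈ Ioc (a : ℝ) s
    · have h := tendsto_stepFun hab' (hU.leftCont' a.coe_nonneg hb') τ
      have hτ' : τ ∈ Ioc (a : ℝ) b := ⟨hτ.1, hτ.2.trans hsb⟩
      rw [indicator_of_mem hτ'] at h
      simpa only [indicator_of_mem hτ] using h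
    · simpa only [indicator_of_notMem hτ] using tendsto_const_nhds

/-- If two adapted step integrals are close in mean square at the terminal time, then they are
uniformly close with high probability. -/
lemma IsItoIntegral.measure_stepIntegral_sub (hW : IsBrownianMotion W 𝓕 P)
    (hI : IsItoIntegral P 𝓕 T W I) (hU : IsAdaptedPath P 𝓕 T C U)
    {ξ : ℝ≥0 → Ω → ℝ} (hξ : ∀ s ≤ T, Measurable[𝓕 s] (ξ s))
    (hC : ∀ s ≤ T, ∀ᵐ ω ∂P, |ξ s ω| ≤ C) (hUξ : ∀ s : ℝ≥0, s ≤ T → U s = toL2 P (ξ s))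
    {t : ℝ≥0} (htT : t ≤ T) (K L : ℕ) {ε : ℝ} (hε : 0 < ε) :
    P {ω | ∃ s ∈ Icc t T, ε < |stepIntegral W ξ t T K s ω - stepIntegral W ξ t T L s ω|} ≤
      ENNReal.ofReal (‖stepPath P T t T U K - stepPath P T t T U L‖ ^ 2 / ε ^ 2) := by
  let V : ℝ → Lp ℝ 2 P := fun τ => stepFun U t T K τ - stepFun U t T L τ
  have hV : IsAdaptedPath P 𝓕 T (C + C) V := (hU.stepFun htT le_rfl K).sub (hU.stepFun htT le_rfl L)
  have hmem : ∀ s ∈ Icc t T, ∀ K, SegMemLp T t s (stepFun U t T K) := fun s hs K =>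
    (hU.stepFun htT le_rfl K).segMemLp t.coe_nonneg (by exact_mod_cast hs.1)
      (by exact_mod_cast hs.2)
  have hsub : ∀ s ∈ Icc t T, seg P T t s V
      = seg P T t s (stepFun U t T K) - seg P T t s (stepFun U t T L) := fun s hs =>
    seg_sub (hmem s hs K) (hmem s hs L)
  have h := measure_exists_lt_continuous (P := P) (𝓕 := 𝓕) htT
    (Z := fun s ω => stepIntegral W ξ t T K s ω - stepIntegral W ξ t T L s ω)
    (z := fun s => I (seg P T t s V)) ?_ ?_ ?_ ?_ hε
  · rw [hsub T ⟨htT, le_rfl⟩, seg_stepFun htT, seg_stepFun htT, hI.norm_apply (t := t)] at h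
    · exact h
    · exact Submodule.sub_mem _ (hU.stepPath_mem le_rfl htT le_rfl K)
        (hU.stepPath_mem le_rfl htT le_rfl L)
  · intro s _
    exact ((measurable_stepIntegral hW htT hξ K s).sub
      (measurable_stepIntegral hW htT hξ L s)).stronglyMeasurable
  · intro s hs
    rw [hsub s hs, map_sub]
    filter_upwards [hI.stepIntegral_ae_eq hW hξ hC hUξ htT le_rfl hs K,
      hI.stepIntegral_ae_eq hW hξ hC hUξ htT le_rfl hs L,
      Lp.coeFn_sub (I (seg P T t s (stepFun U t T K))) (I (seg P T t s (stepFun U t T L)))]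
      with ω h1 h2 h3
    rw [h3, h1, h2]; rfl
  · filter_upwards [hW.isBrownianReal.cont] with ω hω
    exact ((continuous_stepIntegral hω t T K).sub (continuous_stepIntegral hω t T L)).continuousOn
  · intro s s' hts hss' hs'T
    have hts' : (t : ℝ) ≤ s := by exact_mod_cast hts
    have hss'' : (s : ℝ) ≤ s' := by exact_mod_cast hss'
    have hs'T' : (s' : ℝ) ≤ T := by exact_mod_cast hs'T
    rw [← map_sub, seg_concat hts' hss''
      (hV.segMemLp t.coe_nonneg hts' (hss''.trans hs'T'))
      (hV.segMemLp s.coe_nonneg hss'' hs'T'), add_sub_cancel_left]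
    exact hI.condProj_eq_zero hW (hV.seg_mem le_rfl hss' hs'T)

/-- The Itô integral of a bounded adapted path has a version with continuous paths. -/
lemma IsItoIntegral.exists_continuous_version (hW : IsBrownianMotion W 𝓕 P)
    (hI : IsItoIntegral P 𝓕 T W I) (hU : IsAdaptedPath P 𝓕 T C U) {t : ℝ≥0} (htT : t ≤ T) :
    ∃ N : ℝ≥0 → Ω → ℝ, (∀ᵐ ω ∂P, ContinuousOn (fun s => N s ω) (Icc t T)) ∧
      ∀ s ∈ Icc t T, N s =ᵐ[P] I (seg P T t s U) := by
  have hex : ∀ s : ℝ≥0, ∃ ξ : Ω → ℝ, s ≤ T →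
      Measurable[𝓕 s] ξ ∧ (∀ᵐ ω ∂P, |ξ ω| ≤ C) ∧ U s = toL2 P ξ := fun s => by
    by_cases h : s ≤ T
    · obtain ⟨ξ, hξ⟩ := hU.adapted s h
      exact ⟨ξ, fun _ => hξ⟩
    · exact ⟨0, fun h' => absurd h' h⟩
  choose ξ hξ using hex
  have hξm : ∀ s ≤ T, Measurable[𝓕 s] (ξ s) := fun s hs => (hξ s hs).1
  have hξC : ∀ s ≤ T, ∀ᵐ ω ∂P, |ξ s ω| ≤ C := fun s hs => (hξ s hs).2.1
  have hUξ : ∀ s : ℝ≥0, s ≤ T → U s = toL2 P (ξ s) := fun s hs => (hξ s hs).2.2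
  -- a subsequence of step integrals which converges fast
  have hlim := hU.tendsto_stepPath htT le_rfl
  obtain ⟨κ, hκ, hκ2⟩ := extraction_forall_of_eventually' (P := fun j K =>
    ‖stepPath P T t T U K - seg P T t T U‖ ≤ (1 / 4 : ℝ) ^ j / 2) (fun j => by
      have h := (tendsto_iff_norm_sub_tendsto_zero.1 hlim).eventually
        (gt_mem_nhds (show (0 : ℝ) < (1 / 4 : ℝ) ^ j / 2 by positivity))
      obtain ⟨N, hN⟩ := eventually_atTop.1 h
      exact ⟨N, fun k hk => (hN k hk).le⟩)
  have hdist : ∀ j, ‖stepPath P T t T U (κ (j + 1)) - stepPath P T t T U (κ j)‖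
      ≤ (1 / 4 : ℝ) ^ j := fun j => by
    have h1 := hκ2 j
    have h2 := hκ2 (j + 1)
    have h3 := norm_sub_le_norm_sub_add_norm_sub (stepPath P T t T U (κ (j + 1)))
      (seg P T t T U) (stepPath P T t T U (κ j))
    rw [norm_sub_rev (seg P T t T U)] at h3
    have h4 : (1 / 4 : ℝ) ^ (j + 1) ≤ (1 / 4 : ℝ) ^ j :=
      pow_le_pow_of_le_one (by norm_num) (by norm_num) (Nat.le_succ j)
    linarith
  let X : ℕ → ℝ≥0 → Ω → ℝ := fun j => stepIntegral W ξ t T (κ j)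
  let B : ℕ → Set Ω := fun j => {ω | ∃ s ∈ Icc t T, (1 / 2 : ℝ) ^ j < |X (j + 1) s ω - X j s ω|}
  have hB : ∀ j, P (B j) ≤ ENNReal.ofReal ((1 / 4 : ℝ) ^ j) := fun j => by
    refine (hI.measure_stepIntegral_sub hW hU hξm hξC hUξ htT (κ (j + 1)) (κ j)
      (ε := (1 / 2 : ℝ) ^ j) (by positivity)).trans (ENNReal.ofReal_le_ofReal ?_)
    rw [div_le_iff₀ (by positivity)]
    have h1 := pow_le_pow_left₀ (norm_nonneg _) (hdist j) 2
    refine h1.trans (le_of_eq ?_)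
    rw [← pow_mul, ← pow_mul, mul_comm j 2, pow_mul, pow_mul, ← mul_pow]
    norm_num
  have hsum : ∑' j, P (B j) ≠ ∞ := by
    refine ne_top_of_le_ne_top ?_ (ENNReal.tsum_le_tsum hB)
    have h1 : Summable fun j : ℕ => (1 / 4 : ℝ) ^ j :=
      summable_geometric_of_lt_one (by norm_num) (by norm_num)
    rw [← ENNReal.ofReal_tsum_of_nonneg (fun j => by positivity) h1]
    exact ENNReal.ofReal_ne_top
  have hBC : ∀ᵐ ω ∂P, ∀ᶠ j in atTop, ω ∉ B j := ae_eventually_notMem hsum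
  -- uniform convergence outside a null set
  have hunif : ∀ᵐ ω ∂P, ∃ J : ℕ, ∀ s ∈ Icc t T, ∃ l : ℝ,
      Tendsto (fun j => X j s ω) atTop (𝓝 l) ∧
        ∀ n, |X (n + J) s ω - l| ≤ (1 / 2 : ℝ) ^ J * (1 / 2 : ℝ) ^ n / (1 - 1 / 2) := by
    filter_upwards [hBC] with ω hω
    obtain ⟨J, hJ⟩ := eventually_atTop.1 hω
    refine ⟨J, fun s hs => ?_⟩
    have hd : ∀ n, dist (X (n + J) s ω) (X (n + 1 + J) s ω)
        ≤ (1 / 2 : ℝ) ^ J * (1 / 2 : ℝ) ^ n := fun n => by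
      have h1 : ¬ (1 / 2 : ℝ) ^ (n + J) < |X (n + J + 1) s ω - X (n + J) s ω| := fun h =>
        hJ (n + J) (Nat.le_add_left _ _) ⟨s, hs, h⟩
      rw [dist_comm, Real.dist_eq, show n + 1 + J = n + J + 1 by ring]
      refine (not_lt.1 h1).trans (le_of_eq ?_)
      rw [pow_add, mul_comm]
    obtain ⟨l, hl⟩ := cauchySeq_tendsto_of_complete
      (cauchySeq_of_le_geometric (1 / 2) ((1 / 2 : ℝ) ^ J) (by norm_num) hd)
    refine ⟨l, (tendsto_add_atTop_iff_nat J).1 hl, fun n => ?_⟩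
    exact dist_le_of_le_geometric_of_tendsto (1 / 2) _ (by norm_num) hd hl n
  let N : ℝ≥0 → Ω → ℝ := fun s ω => limUnder atTop (fun j => X j s ω)
  refine ⟨N, ?_, ?_⟩
  · filter_upwards [hunif, hW.isBrownianReal.cont] with ω hω hcont
    obtain ⟨J, hJ⟩ := hω
    have hunifω : TendstoUniformlyOn (fun n s => X (n + J) s ω) (fun s => N s ω) atTop
        (Icc t T) := by
      rw [Metric.tendstoUniformlyOn_iff]
      intro ε hε
      have h0 : Tendsto (fun n : ℕ => (1 / 2 : ℝ) ^ J * (1 / 2 : ℝ) ^ n / (1 - 1 / 2)) atTop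
          (𝓝 0) := by
        have h1 := tendsto_pow_atTop_nhds_zero_of_lt_one (r := (1 / 2 : ℝ)) (by norm_num)
          (by norm_num)
        simpa using (h1.const_mul ((1 / 2 : ℝ) ^ J)).div_const (1 - 1 / 2)
      filter_upwards [h0.eventually (gt_mem_nhds hε)] with n hn s hs
      obtain ⟨l, hl, hl2⟩ := hJ s hs
      have h2 : N s ω = l := hl.limUnder_eq
      rw [h2, dist_comm, Real.dist_eq]
      exact (hl2 n).trans_lt hn
    refine hunifω.continuousOn (Eventually.of_forall fun n => ?_).frequently
    exact (continuous_stepIntegral hcont t T _).continuousOn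
  · intro s hs
    have h1 : TendstoInMeasure P (fun j => X j s) atTop (N s) := by
      refine tendstoInMeasure_of_tendsto_ae (fun j => ?_) ?_
      · exact aesm_of_measurable (measurable_stepIntegral hW htT hξm _ s)
      · filter_upwards [hunif] with ω hω
        obtain ⟨J, hJ⟩ := hω
        obtain ⟨l, hl, _⟩ := hJ s hs
        have h2 : N s ω = l := hl.limUnder_eq
        rw [h2]; exact hl
    have h2 : TendstoInMeasure P (fun j => X j s) atTop (I (seg P T t s U)) := by
      have h3 := (I.continuous.tendsto _).comp
        ((hU.tendsto_seg_stepFun htT le_rfl hs).comp hκ.tendsto_atTop)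
      refine (tendstoInMeasure_of_tendsto_Lp h3).congr_left fun j => ?_
      exact (hI.stepIntegral_ae_eq hW hξm hξC hUξ htT le_rfl hs _).symm
    exact tendstoInMeasure_ae_unique h1 h2

end ContinuousVersion

/-! ### Path-wise integrals and integration by parts -/

section Wealth

variable {Ω : Type*} {mΩ : MeasurableSpace Ω} {P : Measure Ω} [IsProbabilityMeasure P]
  {𝓕 : Filtration ℝ≥0 mΩ} {T : ℝ≥0} {W : ℝ≥0 → Ω → ℝ} {C : ℝ} {U : ℝ → Lp ℝ 2 P}

/-- The `L²(P)`-valued Bochner integral of a process agrees with the path-wise integral, since both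
are limits of the same Riemann sums. -/
lemma ae_integral_path {f : ℝ → Ω → ℝ} {F : ℝ → Lp ℝ 2 P} {a b : ℝ} (hab : a ≤ b)
    (hF : ∀ τ ∈ Ioc a b, ContinuousWithinAt F (Iic τ) τ) (hC : ∀ τ ∈ Icc a b, ‖F τ‖ ≤ C)
    (hFf : ∀ τ ∈ Icc a b, F τ =ᵐ[P] f τ)
    (hf : ∀ᵐ ω ∂P, (∀ τ ∈ Ioc a b, ContinuousWithinAt (fun s => f s ω) (Iic τ) τ) ∧
      ∃ D, ∀ τ ∈ Icc a b, ‖f τ ω‖ ≤ D) :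
    ((∫ τ in a..b, F τ : Lp ℝ 2 P) : Ω → ℝ) =ᵐ[P] fun ω => ∫ τ in a..b, f τ ω := by
  have hR := tendstoInMeasure_of_tendsto_Lp (tendsto_riemann hab hF hC)
  refine tendstoInMeasure_ae_unique hR
    (tendstoInMeasure_of_tendsto_ae (fun K => Lp.aestronglyMeasurable _) ?_)
  have hsum : ∀ K : ℕ, ((∑ k ∈ Finset.range K, ((b - a) / K) • F (realGrid a b K k) : Lp ℝ 2 P) :
      Ω → ℝ) =ᵐ[P] fun ω => ∑ k ∈ Finset.range K, ((b - a) / K) • f (realGrid a b K k) ω := by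
    intro K
    have h1 : ∀ᵐ ω ∂P, ∀ k ∈ Finset.range K, (((b - a) / K) • F (realGrid a b K k) : Lp ℝ 2 P) ω
        = ((b - a) / K) • f (realGrid a b K k) ω := by
      refine (Finset.range K).eventually_all.2 fun k hk => ?_
      have hk := Finset.mem_range.1 hk
      filter_upwards [Lp.coeFn_smul ((b - a) / K) (F (realGrid a b K k)),
        hFf _ (realGrid_mem hab (by omega) hk.le)] with ω h1 h2
      rw [h1, Pi.smul_apply, h2]
    filter_upwards [h1, Lp.coeFn_finsetSum (Finset.range K)
      (fun k => ((b - a) / K) • F (realGrid a b K k))] with ω h1 h2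
    rw [h2, Finset.sum_apply]
    exact Finset.sum_congr rfl h1
  filter_upwards [ae_all_iff.2 hsum, hf] with ω h1 h2
  obtain ⟨h2, D, hD⟩ := h2
  simp only [h1]
  exact tendsto_riemann hab h2 hD

lemma IsAdaptedPath.norm_seg_le (hU : IsAdaptedPath P 𝓕 T C U) {a b : ℝ} (ha : 0 ≤ a)
    (hab : a ≤ b) (hb : b ≤ T) : ‖seg P T a b U‖ ≤ C * √(b - a) :=
  MeanRisk.norm_seg_le ha hab hb (hU.segMemLp ha hab hb) hU.nonneg
    fun _ hτ => hU.norm_le ⟨ha.trans hτ.1.le, hτ.2.trans hb⟩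

lemma IsAdaptedPath.seg_concat (hU : IsAdaptedPath P 𝓕 T C U) {a b c : ℝ} (ha : 0 ≤ a)
    (hab : a ≤ b) (hbc : b ≤ c) (hc : c ≤ T) :
    seg P T a c U = seg P T a b U + seg P T b c U :=
  MeanRisk.seg_concat hab hbc (hU.segMemLp ha hab (hbc.trans hc))
    (hU.segMemLp (ha.trans hab) hbc hc)

lemma IsAdaptedPath.continuousOn_seg (hU : IsAdaptedPath P 𝓕 T C U) {t : ℝ} (ht : 0 ≤ t) :
    ContinuousOn (fun s => seg P T t s U) (Icc t T) := by
  have key : ∀ s ∈ Icc t (T : ℝ), ∀ s' ∈ Icc t (T : ℝ),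
      ‖seg P T t s' U - seg P T t s U‖ ≤ C * √|s' - s| := by
    intro s hs s' hs'
    rcases le_total s s' with h | h
    · rw [hU.seg_concat ht hs.1 h hs'.2, add_sub_cancel_left, abs_of_nonneg (sub_nonneg.2 h)]
      exact hU.norm_seg_le (ht.trans hs.1) h hs'.2
    · rw [norm_sub_rev, hU.seg_concat ht hs'.1 h hs.2, add_sub_cancel_left, abs_sub_comm,
        abs_of_nonneg (sub_nonneg.2 h)]
      exact hU.norm_seg_le (ht.trans hs'.1) h hs.2
  intro s hs
  refine tendsto_iff_norm_sub_tendsto_zero.2 ?_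
  have h0 : Tendsto (fun s' => C * √|s' - s|) (𝓝[Icc t T] s) (𝓝 0) := by
    have h : Continuous fun s' => C * √|s' - s| := by fun_prop
    simpa using (h.tendsto s).mono_left nhdsWithin_le_nhds
  refine tendsto_of_tendsto_of_tendsto_of_le_of_le' tendsto_const_nhds h0
    (Eventually.of_forall fun _ => norm_nonneg _) ?_
  filter_upwards [self_mem_nhdsWithin] with s' hs' using key s hs s' hs'

/-- Integration by parts against the primitive of an integrable function. -/
lemma integral_mul_primitive {e e' k : ℝ → ℝ} (he : ∀ τ, HasDerivAt e (e' τ) τ)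
    (he' : Continuous e') {a b : ℝ} (hk : IntervalIntegrable k volume a b) :
    ∫ τ in a..b, e τ * k τ = e b * (∫ τ in a..b, k τ) - ∫ τ in a..b, e' τ * ∫ ρ in a..τ, k ρ := by
  have hde : deriv e = e' := funext fun τ => (he τ).deriv
  have hce : ContDiff ℝ 1 e := contDiff_one_iff_deriv.2
    ⟨fun τ => (he τ).differentiableAt, hde ▸ he'⟩
  have h := AbsolutelyContinuousOnInterval.integral_mul_deriv_eq_deriv_mul
    (hce.contDiffOn (s := uIcc a b)).absolutelyContinuousOnInterval
    (hk.absolutelyContinuousOnInterval_intervalIntegral (left_mem_uIcc (a := a) (b := b)))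
  simp only [intervalIntegral.integral_same, mul_zero, sub_zero, hde] at h
  rw [← h]
  apply intervalIntegral.integral_congr_ae
  filter_upwards [hk.ae_hasDerivAt_integral] with τ hτ hm
  rw [(hτ (uIoc_subset_uIcc hm) a left_mem_uIcc).deriv]

lemma IsAdaptedPath.seg_smul_eq (hU : IsAdaptedPath P 𝓕 T C U) {e e' : ℝ → ℝ}
    (he : ∀ τ, HasDerivAt e (e' τ) τ) (he' : Continuous e') {t s : ℝ} (ht : 0 ≤ t) (hts : t ≤ s)
    (hs : s ≤ T) :
    seg P T t s (fun τ => e τ • U τ)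
      = e s • seg P T t s U - ∫ τ in t..s, e' τ • seg P T t τ U := by
  refine ext_inner_right ℝ fun φ => ?_
  have hce : Continuous e := continuous_iff_continuousAt.2 fun τ => (he τ).continuousAt
  have hsm : SegMemLp T t s (fun τ => e τ • U τ) := by
    obtain ⟨G, hG⟩ := (isCompact_Icc (a := (0 : ℝ)) (b := T)).exists_bound_of_continuousOn
      hce.continuousOn
    exact (hU.smul hce hG).segMemLp ht hts hs
  have hcont : ContinuousOn (fun τ => e' τ • seg P T t τ U) (uIcc t s) := by
    rw [uIcc_of_le hts]
    exact he'.continuousOn.smul ((hU.continuousOn_seg ht).mono (Icc_subset_Icc_right hs))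
  have h1 : inner ℝ (∫ τ in t..s, e' τ • seg P T t τ U) φ
      = ∫ τ in t..s, e' τ * ∫ ρ in t..τ, inner ℝ (U ρ) (φ ρ) := by
    rw [real_inner_comm]
    have h := (innerSL ℝ φ).intervalIntegral_comp_comm (hcont.intervalIntegrable (μ := volume))
    simp only [innerSL_apply_apply] at h
    rw [← h]
    apply intervalIntegral.integral_congr
    intro τ hτ
    rw [uIcc_of_le hts] at hτ
    have hτT := hτ.2.trans hs
    simp only [inner_smul_right]
    rw [real_inner_comm, inner_seg_left ht hτ.1 hτT (hU.segMemLp ht hτ.1 hτT)]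
  have hk : IntervalIntegrable (fun τ => inner ℝ (U τ) (φ τ)) volume t s := by
    rw [intervalIntegrable_iff_integrableOn_Ioc_of_le hts]
    have h := L2.integrable_inner (𝕜 := ℝ) (seg P T t s U) φ
    have h' : Integrable (fun τ => inner ℝ (seg P T t s U τ) (φ τ))
        (volume.restrict (Ioc t s)) := IntegrableOn.mono_set h (Ioc_subset_Ioc ht hs)
    refine h'.congr ?_
    filter_upwards [coeFn_seg_of_mem ht hs (hU.segMemLp ht hts hs)] with τ hτ
    rw [hτ]
  rw [inner_seg_left ht hts hs hsm, inner_sub_left, h1, inner_smul_left,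
    inner_seg_left ht hts hs (hU.segMemLp ht hts hs)]
  simp only [inner_smul_left, conj_trivial]
  exact integral_mul_primitive he he' hk

end Wealth

/-! ### The wealth process -/

section Wealth

variable {Ω : Type*} {mΩ : MeasurableSpace Ω} {P : Measure Ω} [IsProbabilityMeasure P]
  {𝓕 : Filtration ℝ≥0 mΩ} {T : ℝ≥0} {W : ℝ≥0 → Ω → ℝ} {M r μ σ : ℝ} {u : ℝ≥0 → Ω → ℝ}
  {I : PathSpace P T →L[ℝ] Lp ℝ 2 P}

/-- The path of investments `u`, compounded to the terminal time `T`. -/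
noncomputable def compoundedPath (P : Measure Ω) (T : ℝ≥0) (r : ℝ) (u : ℝ≥0 → Ω → ℝ) (τ : ℝ) :
    Lp ℝ 2 P := Real.exp (r * (T - τ)) • pathL2 P u τ

/-- The gain functional `φ ↦ ∫ (μ - r) φ dτ + ∫ σ φ dW` on compounded paths of investments. -/
noncomputable def gainOp (μ r σ : ℝ) (I : PathSpace P T →L[ℝ] Lp ℝ 2 P) :
    PathSpace P T →L[ℝ] Lp ℝ 2 P := (μ - r) • timeIntegral P T + σ • I

lemma gainOp_apply (φ : PathSpace P T) :
    gainOp μ r σ I φ = (μ - r) • timeIntegral P T φ + σ • I φ := rfl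

/-- A bound for the compounding factors. -/
lemma abs_exp_mul_sub_le {τ : ℝ} (hτ : τ ∈ Icc 0 (T : ℝ)) :
    |Real.exp (r * (T - τ))| ≤ Real.exp (|r| * T) := by
  rw [abs_of_pos (Real.exp_pos _)]
  apply Real.exp_le_exp.2
  have h1 : r * (T - τ) ≤ |r| * (T - τ) :=
    mul_le_mul_of_nonneg_right (le_abs_self r) (sub_nonneg.2 hτ.2)
  have h2 : |r| * (T - τ) ≤ |r| * T := mul_le_mul_of_nonneg_left (by linarith [hτ.1]) (abs_nonneg r)
  exact h1.trans h2

lemma IsControl.isAdaptedPath_compoundedPath (hu : IsControl 𝓕 P T M u) :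
    IsAdaptedPath P 𝓕 T (Real.exp (|r| * T) * M) (compoundedPath P T r u) :=
  hu.isAdaptedPath.smul (g := fun τ => Real.exp (r * (T - τ))) (by fun_prop)
    fun _ hτ => abs_exp_mul_sub_le hτ

lemma hasDerivAt_discount (r : ℝ) (T : ℝ) (τ : ℝ) :
    HasDerivAt (fun τ => Real.exp (-r * (T - τ))) (r * Real.exp (-r * (T - τ))) τ := by
  have h := (((hasDerivAt_id τ).const_sub T).const_mul (-r)).exp
  simpa [mul_comm] using h

/-- The wealth at time `s` as an element of `L²(P)`: the initial wealth with interest, plus the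
discounted gain of the compounded investments. -/
noncomputable def wealthL2 (T : ℝ≥0) (r μ σ : ℝ) (I : PathSpace P T →L[ℝ] Lp ℝ 2 P) (t : ℝ) (x : ℝ)
    (u : ℝ≥0 → Ω → ℝ) (s : ℝ) : Lp ℝ 2 P :=
  Real.exp (r * (s - t)) • constL2 P x +
    Real.exp (-r * (T - s)) • gainOp μ r σ I (seg P T t s (compoundedPath P T r u))

lemma IsControl.continuousOn_wealthL2 (hu : IsControl 𝓕 P T M u) (t : ℝ≥0) (x : ℝ) :
    ContinuousOn (wealthL2 T r μ σ I t x u) (Icc (t : ℝ) T) := by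
  have h := (hu.isAdaptedPath_compoundedPath (r := r)).continuousOn_seg t.coe_nonneg
  have h1 : Continuous fun s : ℝ => Real.exp (r * (s - t)) • constL2 P x := by fun_prop
  have h2 : Continuous fun s : ℝ => Real.exp (-r * (T - s)) := by fun_prop
  refine h1.continuousOn.add (h2.continuousOn.smul ?_)
  exact (gainOp μ r σ I).continuous.comp_continuousOn h

lemma pathL2_eq_smul_compoundedPath (τ : ℝ) :
    pathL2 P u τ = Real.exp (-r * (T - τ)) • compoundedPath P T r u τ := by
  rw [compoundedPath, smul_smul, ← Real.exp_add]
  simp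

/-- The wealth equation, integrated in `L²(P)`. -/
lemma IsControl.wealthL2_eq (hu : IsControl 𝓕 P T M u) {t s : ℝ≥0} (hts : t ≤ s) (hs : s ≤ T)
    (x : ℝ) :
    wealthL2 T r μ σ I t x u s = constL2 P x +
      (∫ τ in (t : ℝ)..s, (r • wealthL2 T r μ σ I t x u τ + (μ - r) • pathL2 P u τ)) +
      σ • I (seg P T t s (pathL2 P u)) := by
  have hts' : (t : ℝ) ≤ s := by exact_mod_cast hts
  have hs' : (s : ℝ) ≤ T := by exact_mod_cast hs
  set L := gainOp μ r σ I with hL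
  set w := compoundedPath P T r u with hw
  have hwp : IsAdaptedPath P 𝓕 T _ w := hu.isAdaptedPath_compoundedPath
  have hcont : ContinuousOn (wealthL2 T r μ σ I t x u) (Icc (t : ℝ) s) :=
    (hu.continuousOn_wealthL2 t x).mono (Icc_subset_Icc_right hs')
  have hi1 : IntervalIntegrable (fun τ => r • wealthL2 T r μ σ I t x u τ) volume t s :=
    ContinuousOn.intervalIntegrable (by rw [uIcc_of_le hts']; exact hcont.const_smul r)
  have hi2 := hu.isAdaptedPath.intervalIntegrable t.coe_nonneg hts' hs'
  have hcs : ContinuousOn (fun τ => (r * Real.exp (-r * (T - τ))) • seg P T t τ w)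
      (uIcc (t : ℝ) s) := by
    rw [uIcc_of_le hts']
    have hd : Continuous fun τ : ℝ => r * Real.exp (-r * (T - τ)) := by fun_prop
    exact hd.continuousOn.smul
      ((hwp.continuousOn_seg t.coe_nonneg).mono (Icc_subset_Icc_right hs'))
  -- the discount factor is integrated by parts against the compounded path
  have h1 : seg P T t s (pathL2 P u) = Real.exp (-r * (T - s)) • seg P T t s w
      - ∫ τ in (t : ℝ)..s, (r * Real.exp (-r * (T - τ))) • seg P T t τ w := by
    rw [← hwp.seg_smul_eq (hasDerivAt_discount r T) (by fun_prop) t.coe_nonneg hts' hs']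
    exact seg_congr fun τ _ => pathL2_eq_smul_compoundedPath τ
  have h2 : ∫ τ in (t : ℝ)..s, r • wealthL2 T r μ σ I t x u τ
      = (Real.exp (r * (s - t)) - 1) • constL2 P x
        + L (∫ τ in (t : ℝ)..s, (r * Real.exp (-r * (T - τ))) • seg P T t τ w) := by
    rw [← ContinuousLinearMap.intervalIntegral_comp_comm L (hcs.intervalIntegrable (μ := volume))]
    have h3 : ∫ τ in (t : ℝ)..s, r * Real.exp (r * (τ - t)) = Real.exp (r * (s - t)) - 1 := by
      have hd : ∀ τ ∈ uIcc (t : ℝ) s,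
          HasDerivAt (fun τ => Real.exp (r * (τ - t))) (r * Real.exp (r * (τ - t))) τ := by
        intro τ _
        have h := (((hasDerivAt_id τ).sub_const (t : ℝ)).const_mul r).exp
        simpa [mul_comm] using h
      rw [intervalIntegral.integral_eq_sub_of_hasDerivAt hd
        (Continuous.intervalIntegrable (by fun_prop) _ _)]
      simp
    rw [← h3, ← intervalIntegral.integral_smul_const, ← intervalIntegral.integral_add]
    · apply intervalIntegral.integral_congr
      intro τ _
      simp only [wealthL2, smul_add, smul_smul, map_smul, hL, hw]
    · exact Continuous.intervalIntegrable (by fun_prop) _ _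
    · exact (L.continuous.comp_continuousOn hcs).intervalIntegrable
  have h4 : L (seg P T t s (pathL2 P u))
      = (μ - r) • (∫ τ in (t : ℝ)..s, pathL2 P u τ) + σ • I (seg P T t s (pathL2 P u)) := by
    rw [hL, gainOp_apply, hu.isAdaptedPath.timeIntegral_seg t.coe_nonneg hts' hs']
  have hi3 : IntervalIntegrable (fun τ => (μ - r) • pathL2 P u τ) volume t s :=
    hi2.smul (μ - r)
  rw [intervalIntegral.integral_add hi1 hi3, intervalIntegral.integral_smul (μ - r),
    add_assoc, add_assoc, ← h4, h1, h2, wealthL2, map_sub, map_smul, sub_smul, one_smul]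
  abel

lemma IsItoIntegral.aestronglyMeasurable_wealthL2 (hW : IsBrownianMotion W 𝓕 P)
    (hI : IsItoIntegral P 𝓕 T W I) (hu : IsControl 𝓕 P T M u) {t s : ℝ≥0} (hts : t ≤ s)
    (hs : s ≤ T) (x : ℝ) : AEStronglyMeasurable[𝓕 s] (wealthL2 T r μ σ I t x u s) P := by
  have hw := hu.isAdaptedPath_compoundedPath (r := r)
  refine aestronglyMeasurable_L2_add
    (aestronglyMeasurable_L2_smul _ (aestronglyMeasurable_constL2 x))
    (aestronglyMeasurable_L2_smul _ (aestronglyMeasurable_L2_add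
      (aestronglyMeasurable_L2_smul _ (hw.aestronglyMeasurable_timeIntegral hts hs le_rfl))
      (aestronglyMeasurable_L2_smul _ (hI.aestronglyMeasurable_seg hW hw hts hs le_rfl))))

end Wealth

section Wealth

variable {Ω : Type*} {mΩ : MeasurableSpace Ω} {P : Measure Ω} [IsProbabilityMeasure P]
  {𝓕 : Filtration ℝ≥0 mΩ} {T : ℝ≥0} {W : ℝ≥0 → Ω → ℝ} {M r μ σ : ℝ} {u : ℝ≥0 → Ω → ℝ}
  {I : PathSpace P T →L[ℝ] Lp ℝ 2 P}

lemma coeFn_pathL2 (hu : IsControl 𝓕 P T M u) {τ : ℝ} (hτ : τ ≤ T) :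
    pathL2 P u τ =ᵐ[P] u τ.toNNReal :=
  coeFn_toL2 (hu.memLp (Real.toNNReal_le_iff_le_coe.2 hτ))

/-- The paths of a control are left-continuous and bounded. -/
lemma IsControl.ae_path (hu : IsControl 𝓕 P T M u) :
    ∀ᵐ ω ∂P, (∀ τ ∈ Ioc 0 (T : ℝ),
        ContinuousWithinAt (fun s : ℝ => u s.toNNReal ω) (Iic τ) τ) ∧
      ∀ τ ≤ (T : ℝ), |u τ.toNNReal ω| ≤ M := by
  filter_upwards [hu.ae_leftCont_real, hu.bounded] with ω h1 h2
  exact ⟨h1, fun τ hτ => h2 _ (Real.toNNReal_le_iff_le_coe.2 hτ)⟩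

lemma continuousOn_comp_toNNReal {f : ℝ≥0 → ℝ} {t : ℝ≥0} (hf : ContinuousOn f (Icc t T)) :
    ContinuousOn (fun τ : ℝ => f τ.toNNReal) (Icc (t : ℝ) T) :=
  hf.comp continuous_real_toNNReal.continuousOn fun _ hτ =>
    ⟨NNReal.le_toNNReal_of_coe_le hτ.1, Real.toNNReal_le_iff_le_coe.2 hτ.2⟩

/-- The wealth equation has a solution, which is a version of the `L²(P)`-valued wealth. -/
theorem IsItoIntegral.exists_isWealthProcess (hW : IsBrownianMotion W 𝓕 P)
    (hI : IsItoIntegral P 𝓕 T W I) (hu : IsControl 𝓕 P T M u) {t : ℝ≥0} (ht : t ≤ T) (x : ℝ) :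
    ∃ X, IsWealthProcess P 𝓕 W T r μ σ t x u X ∧
      ∀ s ∈ Icc t T, X s =ᵐ[P] wealthL2 T r μ σ I t x u s := by
  have ht' : (t : ℝ) ≤ T := by exact_mod_cast ht
  have hw := hu.isAdaptedPath_compoundedPath (r := r)
  obtain ⟨N, hN1, hN2⟩ := hI.exists_continuous_version hW hw ht
  set G := Real.exp (|r| * T)
  set f : ℝ → Ω → ℝ := fun τ ω => Real.exp (r * (T - τ)) * u τ.toNNReal ω with hf
  have hfpath : ∀ᵐ ω ∂P, (∀ τ ∈ Ioc (t : ℝ) T, ContinuousWithinAt (fun s => f s ω) (Iic τ) τ) ∧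
      ∀ τ ∈ Icc (t : ℝ) T, ‖f τ ω‖ ≤ G * M := by
    filter_upwards [hu.ae_path] with ω hω
    refine ⟨fun τ hτ => ?_, fun τ hτ => ?_⟩
    · have h : Continuous fun τ : ℝ => Real.exp (r * (T - τ)) := by fun_prop
      exact h.continuousWithinAt.mul (hω.1 τ ⟨t.coe_nonneg.trans_lt hτ.1, hτ.2⟩)
    · rw [hf, norm_mul, Real.norm_eq_abs, Real.norm_eq_abs]
      exact mul_le_mul (abs_exp_mul_sub_le ⟨t.coe_nonneg.trans hτ.1, hτ.2⟩) (hω.2 τ hτ.2)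
        (abs_nonneg _) (Real.exp_pos _).le
  set X : ℝ≥0 → Ω → ℝ := fun s ω => Real.exp (r * (s - t)) * x + Real.exp (-r * (T - s)) *
    ((μ - r) * (∫ τ in (t : ℝ)..s, f τ ω) + σ * N s ω) with hX
  have hXae : ∀ s ∈ Icc t T, X s =ᵐ[P] wealthL2 T r μ σ I t x u s := by
    intro s hs
    have hts : (t : ℝ) ≤ s := by exact_mod_cast hs.1
    have hsT : (s : ℝ) ≤ T := by exact_mod_cast hs.2
    have h1 : ((∫ τ in (t : ℝ)..s, compoundedPath P T r u τ : Lp ℝ 2 P) : Ω → ℝ)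
        =ᵐ[P] fun ω => ∫ τ in (t : ℝ)..s, f τ ω := by
      refine ae_integral_path hts (hw.leftCont' t.coe_nonneg hsT) (hw.norm_le' t.coe_nonneg hsT)
        (fun τ hτ => ?_) ?_
      · filter_upwards [coeFn_pathL2 hu (hτ.2.trans hsT),
          Lp.coeFn_smul (Real.exp (r * (T - τ))) (pathL2 P u τ)] with ω h1 h2
        rw [compoundedPath, h2, Pi.smul_apply, h1, smul_eq_mul]
      · filter_upwards [hfpath] with ω hω
        exact ⟨fun τ hτ => hω.1 τ ⟨hτ.1, hτ.2.trans hsT⟩,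
          G * M, fun τ hτ => hω.2 τ ⟨hτ.1, hτ.2.trans hsT⟩⟩
    rw [← hw.timeIntegral_seg t.coe_nonneg hts hsT] at h1
    set φ := seg P T t s (compoundedPath P T r u) with hφ
    have hadd := Lp.coeFn_add (Real.exp (r * (s - t)) • constL2 P x)
      (Real.exp (-r * (T - s)) • gainOp μ r σ I φ)
    have hadd' := Lp.coeFn_add ((μ - r) • timeIntegral P T φ) (σ • I φ)
    filter_upwards [h1, hN2 s hs, hadd, hadd', coeFn_constL2 (P := P) x,
      Lp.coeFn_smul (Real.exp (r * (s - t))) (constL2 P x),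
      Lp.coeFn_smul (Real.exp (-r * (T - s))) (gainOp μ r σ I φ),
      Lp.coeFn_smul (μ - r) (timeIntegral P T φ), Lp.coeFn_smul σ (I φ)]
      with ω a1 a2 a3 a4 a5 a6 a7 a8 a9
    rw [wealthL2, a3, Pi.add_apply, a6, Pi.smul_apply, a5, a7, Pi.smul_apply, gainOp_apply, a4,
      Pi.add_apply, a8, Pi.smul_apply, a9, Pi.smul_apply, a1]
    simp only [hX, smul_eq_mul]
    rw [a2]
  have hXcont : ∀ᵐ ω ∂P, ContinuousOn (fun s => X s ω) (Icc t T) := by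
    filter_upwards [hN1, hfpath] with ω h1 h2
    have hint : IntervalIntegrable (fun τ => f τ ω) volume t T :=
      intervalIntegrable_of_leftCont ht' h2.1 h2.2
    have h3 := intervalIntegral.continuousOn_primitive_interval' hint left_mem_uIcc
    rw [uIcc_of_le ht'] at h3
    have h4 : ContinuousOn (fun s : ℝ≥0 => ∫ τ in (t : ℝ)..s, f τ ω) (Icc t T) :=
      h3.comp NNReal.continuous_coe.continuousOn fun s hs =>
        ⟨by exact_mod_cast hs.1, by exact_mod_cast hs.2⟩
    have h5 : Continuous fun s : ℝ≥0 => Real.exp (r * (s - t)) * x := by fun_prop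
    have h6 : Continuous fun s : ℝ≥0 => Real.exp (-r * (T - s)) := by fun_prop
    exact h5.continuousOn.add
      (h6.continuousOn.mul ((h4.const_smul (μ - r)).add (h1.const_smul σ)))
  refine ⟨X, ⟨fun s hs => ?_, hXcont, fun s hs => ?_⟩, hXae⟩
  · exact (hI.aestronglyMeasurable_wealthL2 hW hu hs.1 hs.2 x).congr (hXae s hs).symm
  refine ⟨I (seg P T t s (pathL2 P u)), hI.isStochasticIntegral hW hu hs.1 hs.2, ?_⟩
  have hts : (t : ℝ) ≤ s := by exact_mod_cast hs.1
  have hsT : (s : ℝ) ≤ T := by exact_mod_cast hs.2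
  set F : ℝ → Lp ℝ 2 P := fun τ => r • wealthL2 T r μ σ I t x u τ + (μ - r) • pathL2 P u τ with hF
  have hcont : ContinuousOn (wealthL2 T r μ σ I t x u) (Icc (t : ℝ) s) :=
    (hu.continuousOn_wealthL2 t x).mono (Icc_subset_Icc_right hsT)
  obtain ⟨B, hB⟩ := isCompact_Icc.exists_bound_of_continuousOn hcont
  have hint : ((∫ τ in (t : ℝ)..s, F τ : Lp ℝ 2 P) : Ω → ℝ)
      =ᵐ[P] fun ω => ∫ τ in (t : ℝ)..s, (r * X τ.toNNReal ω + u τ.toNNReal ω * (μ - r)) := by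
    refine ae_integral_path (C := |r| * B + |μ - r| * M) hts (fun τ hτ => ?_) (fun τ hτ => ?_)
      (fun τ hτ => ?_) ?_
    · refine ContinuousWithinAt.add (ContinuousWithinAt.const_smul ?_ r)
        (ContinuousWithinAt.const_smul (hu.isAdaptedPath.leftCont' t.coe_nonneg hsT τ hτ) (μ - r))
      exact (hcont τ ⟨hτ.1.le, hτ.2⟩).mono_of_mem_nhdsWithin (Icc_mem_nhdsLE_of_mem hτ)
    · refine (norm_add_le _ _).trans ?_
      rw [norm_smul, norm_smul, Real.norm_eq_abs, Real.norm_eq_abs]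
      gcongr
      · exact hB τ hτ
      · exact hu.isAdaptedPath.norm_le' t.coe_nonneg hsT τ hτ
    · have hτ0 : 0 ≤ τ := t.coe_nonneg.trans hτ.1
      have hX1 := hXae τ.toNNReal ⟨NNReal.le_toNNReal_of_coe_le hτ.1,
        Real.toNNReal_le_iff_le_coe.2 (hτ.2.trans hsT)⟩
      rw [Real.coe_toNNReal _ hτ0] at hX1
      filter_upwards [hX1, coeFn_pathL2 hu (hτ.2.trans hsT),
        Lp.coeFn_add (r • wealthL2 T r μ σ I t x u τ) ((μ - r) • pathL2 P u τ),
        Lp.coeFn_smul r (wealthL2 T r μ σ I t x u τ),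
        Lp.coeFn_smul (μ - r) (pathL2 P u τ)] with ω a1 a2 a3 a4 a5
      rw [hF, a3, Pi.add_apply, a4, a5, Pi.smul_apply, Pi.smul_apply, a1, a2, smul_eq_mul,
        smul_eq_mul, mul_comm (μ - r)]
    · filter_upwards [hXcont, hu.ae_path] with ω h1 h2
      have h3 := (continuousOn_comp_toNNReal h1).mono (Icc_subset_Icc_right hsT)
      obtain ⟨D, hD⟩ := isCompact_Icc.exists_bound_of_continuousOn h3
      refine ⟨fun τ hτ => ?_, |r| * D + M * |μ - r|, fun τ hτ => ?_⟩
      · refine ContinuousWithinAt.add (ContinuousWithinAt.const_smul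
          ((h3 τ ⟨hτ.1.le, hτ.2⟩).mono_of_mem_nhdsWithin (Icc_mem_nhdsLE_of_mem hτ)) r) ?_
        exact (h2.1 τ ⟨t.coe_nonneg.trans_lt hτ.1, hτ.2.trans hsT⟩).mul_const _
      · refine (norm_add_le _ _).trans ?_
        rw [norm_mul, norm_mul, Real.norm_eq_abs r, Real.norm_eq_abs (μ - r)]
        gcongr
        · exact hD τ hτ
        · exact h2.2 τ (hτ.2.trans hsT)
  have heq := hu.wealthL2_eq (I := I) (μ := μ) (σ := σ) (r := r) hs.1 hs.2 x
  filter_upwards [hXae s hs, hint, coeFn_constL2 (P := P) x,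
    Lp.coeFn_add (constL2 P x + ∫ τ in (t : ℝ)..s, F τ) (σ • I (seg P T t s (pathL2 P u))),
    Lp.coeFn_add (constL2 P x) (∫ τ in (t : ℝ)..s, F τ),
    Lp.coeFn_smul σ (I (seg P T t s (pathL2 P u)))] with ω a1 a2 a3 a4 a5 a6
  rw [a1, heq, a4, Pi.add_apply, a5, Pi.add_apply, a6, Pi.smul_apply, a3, a2, smul_eq_mul]

/-- Two solutions of the wealth equation with the same control have the same terminal value. -/
theorem IsWealthProcess.ae_eq (hu : IsControl 𝓕 P T M u) {t : ℝ≥0} (ht : t ≤ T) {x : ℝ}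
    {X X' : ℝ≥0 → Ω → ℝ} (hX : IsWealthProcess P 𝓕 W T r μ σ t x u X)
    (hX' : IsWealthProcess P 𝓕 W T r μ σ t x u X') : X T =ᵐ[P] X' T := by
  have ht' : (t : ℝ) ≤ T := by exact_mod_cast ht
  have hsde : ∀ s ∈ Icc t T, ∀ᵐ ω ∂P, X s ω - X' s ω
      = (∫ τ in (t : ℝ)..s, (r * X τ.toNNReal ω + u τ.toNNReal ω * (μ - r)))
        - ∫ τ in (t : ℝ)..s, (r * X' τ.toNNReal ω + u τ.toNNReal ω * (μ - r)) := by
    intro s hs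
    obtain ⟨I, hI, h⟩ := hX.sde s hs
    obtain ⟨I', hI', h'⟩ := hX'.sde s hs
    filter_upwards [h, h', tendstoInMeasure_ae_unique hI.2 hI'.2] with ω h1 h2 h3
    rw [h1, h2, h3]
    ring
  -- the null set of the wealth equation depends on the time, so pass to a countable dense set
  obtain ⟨S, hSc, hSd⟩ := TopologicalSpace.exists_countable_dense (Icc t T)
  have hall : ∀ᵐ ω ∂P, ∀ s ∈ S, X s ω - X' s ω
      = (∫ τ in (t : ℝ)..(s : ℝ≥0), (r * X τ.toNNReal ω + u τ.toNNReal ω * (μ - r)))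
        - ∫ τ in (t : ℝ)..(s : ℝ≥0), (r * X' τ.toNNReal ω + u τ.toNNReal ω * (μ - r)) :=
    (ae_ball_iff hSc).2 fun s _ => hsde s s.2
  filter_upwards [hall, hX.continuous, hX'.continuous, hu.ae_path] with ω h hc hc' hup
  set Δ : ℝ → ℝ := fun τ => X τ.toNNReal ω - X' τ.toNNReal ω
  have hcX := continuousOn_comp_toNNReal hc
  have hcX' := continuousOn_comp_toNNReal hc'
  have hΔ : ContinuousOn Δ (Icc (t : ℝ) T) := hcX.sub hcX'
  have hui : IntervalIntegrable (fun τ => u τ.toNNReal ω * (μ - r)) volume t T :=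
    (intervalIntegrable_of_leftCont ht'
      (fun τ hτ => hup.1 τ ⟨t.coe_nonneg.trans_lt hτ.1, hτ.2⟩) fun τ hτ => hup.2 τ hτ.2).mul_const _
  have hXi : ∀ {Y : ℝ → ℝ}, ContinuousOn Y (Icc (t : ℝ) T) →
      IntervalIntegrable (fun τ => r * Y τ) volume t T := fun hY =>
    ContinuousOn.intervalIntegrable (by rw [uIcc_of_le ht']; exact hY.const_smul r)
  set D : ℝ → ℝ := fun s => ∫ τ in (t : ℝ)..s, Δ τ with hD
  have hΔi : IntervalIntegrable Δ volume t T :=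
    ContinuousOn.intervalIntegrable (by rwa [uIcc_of_le ht'])
  have hDc : ContinuousOn D (Icc (t : ℝ) T) := by
    have := intervalIntegral.continuousOn_primitive_interval' hΔi left_mem_uIcc
    rwa [uIcc_of_le ht'] at this
  have hrhs : ∀ s ∈ Icc (t : ℝ) T,
      (∫ τ in (t : ℝ)..s, (r * X τ.toNNReal ω + u τ.toNNReal ω * (μ - r)))
        - ∫ τ in (t : ℝ)..s, (r * X' τ.toNNReal ω + u τ.toNNReal ω * (μ - r)) = r * D s := by
    intro s hs
    have hsub : uIcc (t : ℝ) s ⊆ uIcc (t : ℝ) T := by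
      rw [uIcc_of_le hs.1, uIcc_of_le ht']; exact Icc_subset_Icc_right hs.2
    rw [← intervalIntegral.integral_sub (((hXi hcX).add hui).mono_set hsub)
      (((hXi hcX').add hui).mono_set hsub), hD, ← intervalIntegral.integral_const_mul]
    refine intervalIntegral.integral_congr fun τ _ => ?_
    simp only [Δ]
    ring
  have hΔD : ∀ s ∈ Icc (t : ℝ) T, Δ s = r * D s := by
    have hcoe : ∀ s : Icc t T, ((s : ℝ≥0) : ℝ) ∈ Icc (t : ℝ) T := fun s =>
      ⟨by exact_mod_cast s.2.1, by exact_mod_cast s.2.2⟩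
    have hι : Continuous fun s : Icc t T => ((s : ℝ≥0) : ℝ) := by fun_prop
    have h1 : (fun s : Icc t T => Δ (s : ℝ≥0)) = fun s : Icc t T => r * D (s : ℝ≥0) := by
      refine Continuous.ext_on hSd (hΔ.comp_continuous hι hcoe)
        ((hDc.comp_continuous hι hcoe).const_smul r) fun s hs => ?_
      have h2 := h s hs
      rw [hrhs _ (hcoe s)] at h2
      simpa [Δ] using h2
    intro s hs
    have hs0 : 0 ≤ s := t.coe_nonneg.trans hs.1
    have h2 := congrFun h1 ⟨⟨s, hs0⟩, by exact_mod_cast hs.1, by exact_mod_cast hs.2⟩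
    exact h2
  -- Gronwall's lemma
  have hDzero : D T = 0 := by
    refine eq_zero_of_abs_deriv_le_mul_abs_self_of_eq_zero_right (f' := Δ) (K := |r|) hDc
      (fun s hs => ?_) (by simp [hD]) (fun s hs => ?_) T ⟨ht', le_rfl⟩
    · have hnhds : Icc (t : ℝ) T ∈ 𝓝[≥] s := Icc_mem_nhdsGE_of_mem hs
      have hcs : ContinuousWithinAt Δ (Ici s) s :=
        (hΔ s ⟨hs.1, hs.2.le⟩).mono_of_mem_nhdsWithin hnhds
      refine intervalIntegral.integral_hasDerivWithinAt_right (s := Ici s) (t := Ioi s)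
        (hΔi.mono_set ?_) ?_ (hcs.mono Ioi_subset_Ici_self)
      · rw [uIcc_of_le hs.1, uIcc_of_le ht']; exact Icc_subset_Icc_right hs.2.le
      · exact hΔ.stronglyMeasurableAtFilter_nhdsWithin measurableSet_Icc s |>.filter_mono
          (nhdsWithin_le_of_mem (nhdsWithin_mono s Ioi_subset_Ici_self hnhds))
    · rw [hΔD s ⟨hs.1, hs.2.le⟩, norm_mul, Real.norm_eq_abs r]
  have hfin := hΔD T ⟨ht', le_rfl⟩
  rw [hDzero, mul_zero] at hfin
  have : X T ω - X' T ω = 0 := by simpa [Δ] using hfin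
  linarith

/-- The terminal wealth is the initial wealth with interest plus the gain of the compounded
investments. -/
theorem IsItoIntegral.wealth_ae_eq (hW : IsBrownianMotion W 𝓕 P) (hI : IsItoIntegral P 𝓕 T W I)
    (hu : IsControl 𝓕 P T M u) {t : ℝ≥0} (ht : t ≤ T) (x : ℝ) :
    wealth P 𝓕 W T r μ σ t x u T =ᵐ[P] fun ω => x * Real.exp (r * ((T : ℝ) - t)) +
      (gainOp μ r σ I (seg P T t T (compoundedPath P T r u)) : Lp ℝ 2 P) ω := by
  obtain ⟨X, hX, hXT⟩ := hI.exists_isWealthProcess (μ := μ) (r := r) (σ := σ) hW hu ht x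
  have hex : ∃ X, IsWealthProcess P 𝓕 W T r μ σ t x u X := ⟨X, hX⟩
  have h1 : wealth P 𝓕 W T r μ σ t x u T =ᵐ[P] X T := by
    rw [wealth, dif_pos hex]
    exact hex.choose_spec.ae_eq hu ht hX
  set φ := seg P T t T (compoundedPath P T r u)
  have h2 : wealthL2 T r μ σ I t x u T
      = Real.exp (r * (T - t)) • constL2 P x + gainOp μ r σ I φ := by
    simp [wealthL2, φ]
  filter_upwards [h1, hXT T ⟨ht, le_rfl⟩, coeFn_constL2 (P := P) x,
    Lp.coeFn_add (Real.exp (r * (T - t)) • constL2 P x) (gainOp μ r σ I φ),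
    Lp.coeFn_smul (Real.exp (r * (T - t))) (constL2 P x)] with ω a1 a2 a3 a4 a5
  rw [a1, a2, h2, a4, Pi.add_apply, a5, Pi.smul_apply, a3, smul_eq_mul, mul_comm]

end Wealth

/-! ### The conditional mean-variance criterion -/

section MeanVariance

variable {Ω : Type*} {mΩ : MeasurableSpace Ω} {P : Measure Ω} [IsProbabilityMeasure P]
  {m : MeasurableSpace Ω} {lam : ℝ}

/-- The conditional mean-variance criterion of a square integrable random variable. -/
noncomputable def meanVar (P : Measure Ω) (lam : ℝ) (m : MeasurableSpace Ω) (Z : Lp ℝ 2 P) (ω : Ω) :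
    ℝ := (P[Z | m]) ω - lam * condVar m Z P ω

lemma stronglyMeasurable_meanVar (Z : Lp ℝ 2 P) : StronglyMeasurable[m] (meanVar P lam m Z) :=
  stronglyMeasurable_condExp.sub (stronglyMeasurable_condVar.const_mul lam)

lemma integrable_meanVar (Z : Lp ℝ 2 P) : Integrable (meanVar P lam m Z) P :=
  integrable_condExp.sub (integrable_condVar.const_mul lam)

/-- The mean-variance criterion, integrated over an event which is known. -/
lemma setIntegral_meanVar (hm : m ≤ mΩ) {A : Set Ω} (hA : MeasurableSet[m] A) (Z : Lp ℝ 2 P) :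
    ∫ ω in A, meanVar P lam m Z ω ∂P = inner ℝ (indOp P (hm A hA) (constL2 P 1)) Z
      - lam * ‖indOp P (hm A hA) (Z - condProj P hm Z)‖ ^ 2 := by
  have hZ : MemLp (Z : Ω → ℝ) 2 P := Lp.memLp Z
  have hD : (Z - condProj P hm Z : Lp ℝ 2 P) =ᵐ[P] (Z : Ω → ℝ) - P[Z | m] := by
    filter_upwards [Lp.coeFn_sub Z (condProj P hm Z), coeFn_condProj hm Z] with ω h1 h2
    rw [h1, Pi.sub_apply, Pi.sub_apply, h2]
  have hsq : Integrable (((Z : Ω → ℝ) - P[Z | m]) ^ 2) P := by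
    have h := (Lp.memLp (Z - condProj P hm Z)).integrable_sq
    refine h.congr ?_
    filter_upwards [hD] with ω h1
    rw [h1, Pi.pow_apply]
  have h1 : ∫ ω in A, (P[Z | m]) ω ∂P = ∫ ω in A, Z ω ∂P :=
    setIntegral_condExp hm (hZ.integrable one_le_two) hA
  have h2 : ∫ ω in A, condVar m Z P ω ∂P
      = ‖indOp P (hm A hA) (Z - condProj P hm Z)‖ ^ 2 := by
    rw [setIntegral_condVar (hm := hm) hsq hA, ← real_inner_self_eq_norm_sq, inner_indOp_indOp,
      inner_indOp_left]
    refine setIntegral_congr_ae (hm A hA) ?_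
    filter_upwards [hD] with ω h1 _
    rw [h1, Pi.sub_apply, sq]
  unfold meanVar
  rw [integral_sub integrable_condExp.integrableOn
    (integrable_condVar.const_mul lam).integrableOn, integral_const_mul, h1, h2, inner_indOp_one]

/-- For the penalty `max(0, y)²` the mean-risk functional with the conditional standard deviation
is the mean-variance criterion; an additive constant only shifts it. -/
lemma meanRisk_ae_eq (hm : m ≤ mΩ) {Y : Ω → ℝ} {k : ℝ} {Z : Lp ℝ 2 P}
    (hY : Y =ᵐ[P] fun ω => k + Z ω) :
    meanRisk P (fun y => y) (fun y => (max 0 y) ^ 2) lam m Y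
      =ᵐ[P] fun ω => k + meanVar P lam m Z ω := by
  have hZ : Integrable (Z : Ω → ℝ) P := (Lp.memLp Z).integrable one_le_two
  have h1 : P[Y | m] =ᵐ[P] fun ω => k + (P[Z | m]) ω := by
    have h2 : P[(fun _ => k) + (Z : Ω → ℝ) | m] =ᵐ[P] P[(fun _ : Ω => k) | m] + P[Z | m] :=
      condExp_add (integrable_const k) hZ m
    rw [condExp_const hm] at h2
    have h3 : P[Y | m] =ᵐ[P] P[(fun _ => k) + (Z : Ω → ℝ) | m] := condExp_congr_ae hY
    exact h3.trans h2
  have h2 : condVar m Y P =ᵐ[P] condVar m Z P := by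
    refine condExp_congr_ae ?_
    filter_upwards [hY, h1] with ω a1 a2
    rw [Pi.pow_apply, Pi.pow_apply, Pi.sub_apply, Pi.sub_apply, a1, a2]
    ring
  have h3 : 0 ≤ᵐ[P] condVar m Y P := condExp_nonneg (ae_of_all _ fun ω => sq_nonneg _)
  filter_upwards [h1, h2, h3] with ω a1 a2 a3
  have h4 : (max 0 (condSD P m Y ω)) ^ 2 = condVar m Y P ω := by
    rw [condSD, max_eq_right (Real.sqrt_nonneg _), Real.sq_sqrt a3]
  rw [meanRisk, h4, meanVar, a2, a1]
  ring

end MeanVariance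

/-! ### Perturbed controls -/

section Perturb

variable {Ω : Type*} {mΩ : MeasurableSpace Ω} {P : Measure Ω} [IsProbabilityMeasure P]
  {𝓕 : Filtration ℝ≥0 mΩ} {T : ℝ≥0} {M r : ℝ} {u uhat : ℝ≥0 → Ω → ℝ}

lemma IsControl.perturb (huhat : IsControl 𝓕 P T M uhat) (hu : IsControl 𝓕 P T M u) (t h : ℝ≥0) :
    IsControl 𝓕 P T M (perturb uhat u t h) := by
  refine ⟨fun s hs => ?_, ?_, ?_, ?_⟩
  · by_cases hc : t < s ∧ s ≤ t + h
    · have h1 : MeanRisk.perturb uhat u t h s = u s := funext fun ω => if_pos hc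
      exact h1 ▸ hu.adapted s hs
    · have h1 : MeanRisk.perturb uhat u t h s = uhat s := funext fun ω => if_neg hc
      exact h1 ▸ huhat.adapted s hs
  · filter_upwards [hu.bounded, huhat.bounded] with ω h1 h2 s hs
    by_cases hc : t < s ∧ s ≤ t + h
    · simpa only [MeanRisk.perturb, hc, and_self, if_true] using h1 s hs
    · simpa only [MeanRisk.perturb, hc, if_false] using h2 s hs
  · filter_upwards [hu.left_continuous, huhat.left_continuous] with ω h1 h2 s hs0 hs
    by_cases hc : t < s ∧ s ≤ t + h
    · refine (h1 s hs0 hs).congr_of_eventuallyEq ?_ (if_pos hc)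
      filter_upwards [self_mem_nhdsWithin, mem_nhdsWithin_of_mem_nhds (Ioi_mem_nhds hc.1)]
        with τ hτ1 hτ2
      exact if_pos ⟨hτ2, le_trans hτ1 hc.2⟩
    · refine (h2 s hs0 hs).congr_of_eventuallyEq ?_ (if_neg hc)
      rcases le_or_gt s t with hst | hst
      · filter_upwards [self_mem_nhdsWithin] with τ hτ
        exact if_neg fun hτ' => not_lt.2 (le_trans hτ hst) hτ'.1
      · have hsh : t + h < s := lt_of_not_ge fun h' => hc ⟨hst, h'⟩
        filter_upwards [mem_nhdsWithin_of_mem_nhds (Ioi_mem_nhds hsh)] with τ hτ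
        exact if_neg fun hτ' => not_lt.2 hτ'.2 hτ
  · filter_upwards [hu.right_limits, huhat.right_limits] with ω h1 h2 s hs
    by_cases hc : t ≤ s ∧ s < t + h
    · obtain ⟨l, hl⟩ := h1 s hs
      refine ⟨l, hl.congr' ?_⟩
      filter_upwards [self_mem_nhdsWithin, mem_nhdsWithin_of_mem_nhds (Iio_mem_nhds hc.2)]
        with τ hτ1 hτ2
      exact (if_pos ⟨lt_of_le_of_lt hc.1 hτ1, le_of_lt hτ2⟩).symm
    · obtain ⟨l, hl⟩ := h2 s hs
      refine ⟨l, hl.congr' ?_⟩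
      rcases lt_or_ge s t with hst | hst
      · filter_upwards [mem_nhdsWithin_of_mem_nhds (Iio_mem_nhds hst)] with τ hτ
        exact (if_neg fun hτ' => lt_asymm hτ hτ'.1).symm
      · have hsh : t + h ≤ s := le_of_not_gt fun h' => hc ⟨hst, h'⟩
        filter_upwards [self_mem_nhdsWithin] with τ hτ
        exact (if_neg fun hτ' => not_lt.2 hτ'.2 (lt_of_le_of_lt hsh hτ)).symm

/-- A perturbation on `(t, t + h]` changes the compounded path by a segment over this interval. -/
lemma seg_perturb (huhat : IsControl 𝓕 P T M uhat) (hu : IsControl 𝓕 P T M u) {t h : ℝ≥0}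
    (hth : t + h ≤ T) :
    seg P T t T (compoundedPath P T r (perturb uhat u t h))
      = seg P T t T (compoundedPath P T r uhat)
        + seg P T t (t + h : ℝ≥0)
          (fun τ => compoundedPath P T r u τ - compoundedPath P T r uhat τ) := by
  have h1 : (t : ℝ) ≤ (t + h : ℝ≥0) := by exact_mod_cast le_self_add
  have h2 : ((t + h : ℝ≥0) : ℝ) ≤ T := by exact_mod_cast hth
  have ht0 := t.coe_nonneg
  have hp := (huhat.perturb hu t h).isAdaptedPath_compoundedPath (r := r)
  have hw := hu.isAdaptedPath_compoundedPath (r := r)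
  have hw' := huhat.isAdaptedPath_compoundedPath (r := r)
  rw [hp.seg_concat ht0 h1 h2 le_rfl, hw'.seg_concat ht0 h1 h2 le_rfl,
    seg_sub (hw.segMemLp ht0 h1 h2) (hw'.segMemLp ht0 h1 h2)]
  have e1 : seg P T t (t + h : ℝ≥0) (compoundedPath P T r (perturb uhat u t h))
      = seg P T t (t + h : ℝ≥0) (compoundedPath P T r u) := by
    refine seg_congr fun τ hτ => ?_
    have hc : t < τ.toNNReal ∧ τ.toNNReal ≤ t + h :=
      ⟨Real.lt_toNNReal_iff_coe_lt.2 hτ.1, Real.toNNReal_le_iff_le_coe.2 hτ.2⟩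
    have : MeanRisk.perturb uhat u t h τ.toNNReal = u τ.toNNReal := funext fun ω => if_pos hc
    rw [compoundedPath, compoundedPath, pathL2, pathL2, this]
  have e2 : seg P T (t + h : ℝ≥0) T (compoundedPath P T r (perturb uhat u t h))
      = seg P T (t + h : ℝ≥0) T (compoundedPath P T r uhat) := by
    refine seg_congr fun τ hτ => ?_
    have hc : ¬ (t < τ.toNNReal ∧ τ.toNNReal ≤ t + h) := fun hc =>
      not_lt.2 (Real.toNNReal_le_iff_le_coe.1 hc.2) hτ.1
    have : MeanRisk.perturb uhat u t h τ.toNNReal = uhat τ.toNNReal := funext fun ω => if_neg hc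
    rw [compoundedPath, compoundedPath, pathL2, pathL2, this]
  rw [e1, e2]
  abel

end Perturb

/-! ### The mean-variance criterion under a variation of the investments -/

section Variation

variable {Ω : Type*} {mΩ : MeasurableSpace Ω} {P : Measure Ω} [IsProbabilityMeasure P]
  {𝓕 : Filtration ℝ≥0 mΩ} {T : ℝ≥0} {W : ℝ≥0 → Ω → ℝ} {M r μ σ lam C : ℝ} {U : ℝ → Lp ℝ 2 P}
  {I : PathSpace P T →L[ℝ] Lp ℝ 2 P} {t : ℝ≥0}

/-- The part of a random variable which is orthogonal to the information in `m`. -/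
noncomputable def resid (P : Measure Ω) [IsProbabilityMeasure P] {m : MeasurableSpace Ω}
    (hm : m ≤ mΩ) : Lp ℝ 2 P →L[ℝ] Lp ℝ 2 P := ContinuousLinearMap.id ℝ _ - condProj P hm

lemma resid_apply {m : MeasurableSpace Ω} (hm : m ≤ mΩ) (z : Lp ℝ 2 P) :
    resid P hm z = z - condProj P hm z := rfl

lemma norm_resid_le {m : MeasurableSpace Ω} (hm : m ≤ mΩ) (z : Lp ℝ 2 P) :
    ‖resid P hm z‖ ≤ ‖z‖ := norm_sub_condProj_le hm z

lemma resid_of_meas {m : MeasurableSpace Ω} (hm : m ≤ mΩ) {z : Lp ℝ 2 P}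
    (hz : AEStronglyMeasurable[m] z P) : resid P hm z = 0 := by
  rw [resid_apply, condProj_of_meas hm hz, sub_self]

lemma resid_indOp {m : MeasurableSpace Ω} (hm : m ≤ mΩ) {A : Set Ω} (hA : MeasurableSet[m] A)
    (z : Lp ℝ 2 P) : resid P hm (indOp P (hm A hA) z) = indOp P (hm A hA) (resid P hm z) := by
  rw [resid_apply, resid_apply, map_sub, condProj_indOp (hm A hA) hm hA]

lemma norm_indOp_resid_le {m : MeasurableSpace Ω} (hm : m ≤ mΩ) {A : Set Ω}
    (hA : MeasurableSet[m] A) (z : Lp ℝ 2 P) :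
    ‖indOp P (hm A hA) (resid P hm z)‖ ≤ ‖indOp P (hm A hA) z‖ := by
  rw [← resid_indOp hm hA]
  exact norm_resid_le hm _

lemma norm_indOp_timeIntegral_le (hU : IsAdaptedPath P 𝓕 T C U) {A : Set Ω} (hA : MeasurableSet A)
    {a b : ℝ} (ha : 0 ≤ a) (hab : a ≤ b) (hb : b ≤ T) :
    ‖indOp P hA (timeIntegral P T (seg P T a b U))‖ ≤ C * √(P.real A) * (b - a) := by
  rw [hU.timeIntegral_seg ha hab hb,
    ← (indOp P hA).intervalIntegral_comp_comm (hU.intervalIntegrable ha hab hb)]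
  have h := intervalIntegral.norm_integral_le_of_norm_le_const (a := a) (b := b)
    (f := fun τ => indOp P hA (U τ)) (C := C * √(P.real A)) fun τ hτ => by
      rw [uIoc_of_le hab] at hτ
      exact hU.norm_indOp_le ⟨ha.trans hτ.1.le, hτ.2.trans hb⟩ hA
  rwa [abs_of_nonneg (sub_nonneg.2 hab)] at h

lemma norm_indPath_seg_le (hU : IsAdaptedPath P 𝓕 T C U) {A : Set Ω} (hA : MeasurableSet A)
    {a b : ℝ} (ha : 0 ≤ a) (hab : a ≤ b) (hb : b ≤ T) :
    ‖indPath P T hA (seg P T a b U)‖ ≤ C * √(P.real A) * √(b - a) := by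
  rw [indPath_seg hA (hU.segMemLp ha hab hb)]
  exact norm_seg_le ha hab hb (segMemLp_indOp hA (hU.segMemLp ha hab hb))
    (mul_nonneg hU.nonneg (Real.sqrt_nonneg _))
    fun τ hτ => hU.norm_indOp_le ⟨ha.trans hτ.1.le, hτ.2.trans hb⟩ hA

/-- The unpredictable part of the gain, given the information at time `t`. -/
noncomputable def gainResid (𝓕 : Filtration ℝ≥0 mΩ) (μ r σ : ℝ) (I : PathSpace P T →L[ℝ] Lp ℝ 2 P)
    (t : ℝ≥0) : PathSpace P T →L[ℝ] Lp ℝ 2 P :=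
  (μ - r) • (resid P (𝓕.le t)).comp (timeIntegral P T) + σ • I

lemma gainResid_apply (φ : PathSpace P T) : gainResid 𝓕 μ r σ I t φ
    = (μ - r) • resid P (𝓕.le t) (timeIntegral P T φ) + σ • I φ := rfl

lemma IsItoIntegral.gainOp_sub_condProj (hW : IsBrownianMotion W 𝓕 P)
    (hI : IsItoIntegral P 𝓕 T W I) {φ : PathSpace P T} (hφ : φ ∈ integrands P 𝓕 T t) :
    gainOp μ r σ I φ - condProj P (𝓕.le t) (gainOp μ r σ I φ) = gainResid 𝓕 μ r σ I t φ := by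
  rw [gainOp_apply, gainResid_apply, map_add, map_smul, map_smul, hI.condProj_eq_zero hW hφ,
    resid_apply, smul_zero, smul_sub]
  abel

/-- A stochastic integral from time `t` on is orthogonal to what is known at time `t`. -/
lemma IsItoIntegral.inner_eq_zero (hW : IsBrownianMotion W 𝓕 P)
    (hI : IsItoIntegral P 𝓕 T W I) {φ : PathSpace P T} (hφ : φ ∈ integrands P 𝓕 T t)
    {z : Lp ℝ 2 P} (hz : AEStronglyMeasurable[𝓕 t] z P) : inner ℝ z (I φ) = 0 := by
  rw [← condProj_of_meas (𝓕.le t) hz, inner_condProj_left, hI.condProj_eq_zero hW hφ,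
    inner_zero_right]

lemma IsItoIntegral.inner_apply (hI : IsItoIntegral P 𝓕 T W I) {φ ψ : PathSpace P T}
    (hφ : φ ∈ integrands P 𝓕 T t) (hψ : ψ ∈ integrands P 𝓕 T t) :
    inner ℝ (I φ) (I ψ) = inner ℝ φ ψ :=
  hI.isometry φ (integrands_anti zero_le hφ) ψ (integrands_anti zero_le hψ)

/-- The criterion of the gain, integrated over an event known at time `t`: the stochastic integral
does not contribute to the mean. -/
lemma IsItoIntegral.setIntegral_meanVar_gain (hW : IsBrownianMotion W 𝓕 P)
    (hI : IsItoIntegral P 𝓕 T W I) {φ : PathSpace P T} (hφ : φ ∈ integrands P 𝓕 T t) {A : Set Ω}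
    (hA : MeasurableSet[𝓕 t] A) :
    ∫ ω in A, meanVar P lam (𝓕 t) (gainOp μ r σ I φ) ω ∂P
      = (μ - r) * inner ℝ (indOp P (𝓕.le t A hA) (constL2 P 1)) (timeIntegral P T φ)
        - lam * ‖indOp P (𝓕.le t A hA) (gainResid 𝓕 μ r σ I t φ)‖ ^ 2 := by
  rw [setIntegral_meanVar (𝓕.le t) hA, hI.gainOp_sub_condProj hW hφ, gainOp_apply, inner_add_right,
    inner_smul_right, inner_smul_right, hI.inner_eq_zero hW hφ
      (aestronglyMeasurable_indOp (𝓕.le t A hA) hA (aestronglyMeasurable_constL2 1)), mul_zero,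
    add_zero]

/-- Variation of the investments by `δ` around `κ + η`, where `κ` plays the role of the equilibrium
investment: the covariance of the variation with the gain of `κ` cancels the effect on the mean. -/
lemma IsItoIntegral.setIntegral_variation (hW : IsBrownianMotion W 𝓕 P)
    (hI : IsItoIntegral P 𝓕 T W I) {c : ℝ} (hc : 2 * lam * σ ^ 2 * c = μ - r)
    {κ η δ : PathSpace P T}
    (hκ : κ ∈ integrands P 𝓕 T t) (hη : η ∈ integrands P 𝓕 T t) (hδ : δ ∈ integrands P 𝓕 T t)
    (hκr : resid P (𝓕.le t) (timeIntegral P T κ) = 0) {A : Set Ω} (hA : MeasurableSet[𝓕 t] A)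
    (hδκ : inner ℝ (indPath P T (𝓕.le t A hA) δ) κ
      = c * inner ℝ (indOp P (𝓕.le t A hA) (constL2 P 1)) (timeIntegral P T δ)) :
    ∫ ω in A, (meanVar P lam (𝓕 t) (gainOp μ r σ I (κ + η)) ω
        - meanVar P lam (𝓕 t) (gainOp μ r σ I (κ + η + δ)) ω) ∂P
      = lam * (‖indOp P (𝓕.le t A hA) (gainResid 𝓕 μ r σ I t (η + δ))‖ ^ 2
          - ‖indOp P (𝓕.le t A hA) (gainResid 𝓕 μ r σ I t η)‖ ^ 2)
        + 2 * lam * σ * (μ - r) * inner ℝ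
          (indOp P (𝓕.le t A hA) (resid P (𝓕.le t) (timeIntegral P T δ))) (I κ) := by
  have hκη := (integrands P 𝓕 T t).add_mem hκ hη
  rw [integral_sub (integrable_meanVar _).integrableOn (integrable_meanVar _).integrableOn,
    hI.setIntegral_meanVar_gain hW hκη hA,
    hI.setIntegral_meanVar_gain hW ((integrands P 𝓕 T t).add_mem hκη hδ) hA]
  set mA := indOp P (𝓕.le t A hA) with hmA
  set V := gainResid 𝓕 μ r σ I t with hV
  set S := timeIntegral P T
  have hVκ : V κ = σ • I κ := by rw [hV, gainResid_apply, hκr, smul_zero, zero_add]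
  have e1 : mA (V (κ + η)) = mA (σ • I κ) + mA (V η) := by rw [map_add, map_add, hVκ]
  have e2 : mA (V (κ + η + δ)) = mA (σ • I κ) + mA (V (η + δ)) := by
    rw [add_assoc, map_add, map_add, hVκ]
  -- by the Itô isometry and `hδκ`, the covariance of `δ` with the gain of `κ` is `c` times the mean
  have e3 : inner ℝ (mA (σ • I κ)) (mA (V (η + δ))) - inner ℝ (mA (σ • I κ)) (mA (V η))
      = σ * ((μ - r) * inner ℝ (mA (resid P (𝓕.le t) (S δ))) (I κ)
        + σ * (c * inner ℝ (mA (constL2 P 1)) (S δ))) := by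
    rw [← inner_sub_right, ← map_sub, ← map_sub, add_sub_cancel_left, hmA, inner_indOp_indOp,
      ← inner_indOp_right, inner_smul_left, hV, gainResid_apply, map_add, map_smul, map_smul,
      inner_add_right, inner_smul_right, inner_smul_right, ← hI.apply_indPath hW hA hδ,
      hI.inner_apply hκ (indPath_mem hA hδ), real_inner_comm _ κ, hδκ, real_inner_comm]
    rfl
  rw [e1, e2, norm_add_sq_real, norm_add_sq_real, map_add S (κ + η), inner_add_right]
  linear_combination 2 * lam * e3 + inner ℝ (mA (constL2 P 1)) (S δ) * hc

/-- Pairing a path with a constant path amounts to integrating it over time. -/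
lemma inner_indPath_seg_const (hU : IsAdaptedPath P 𝓕 T C U) {A : Set Ω} (hA : MeasurableSet A)
    {a b : ℝ} (ha : 0 ≤ a) (hab : a ≤ b) (hb : b ≤ T) (c : ℝ) :
    inner ℝ (indPath P T hA (seg P T a b U)) (seg P T a T (fun _ => constL2 P c))
      = c * inner ℝ (indOp P hA (constL2 P 1)) (timeIntegral P T (seg P T a b U)) := by
  have hs := hU.segMemLp ha hab hb
  have h2 : ∫ τ in a..b, inner ℝ (indOp P hA (constL2 P 1)) (U τ)
      = inner ℝ (indOp P hA (constL2 P 1)) (timeIntegral P T (seg P T a b U)) := by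
    rw [hU.timeIntegral_seg ha hab hb]
    have h := (innerSL ℝ (indOp P hA (constL2 P 1))).intervalIntegral_comp_comm
      (hU.intervalIntegrable ha hab hb)
    simpa only [innerSL_apply_apply] using h
  rw [indPath_seg hA hs, inner_seg_left ha hab hb (segMemLp_indOp hA hs), ← h2,
    ← intervalIntegral.integral_const_mul, intervalIntegral.integral_of_le hab,
    intervalIntegral.integral_of_le hab]
  apply integral_congr_ae
  have h3 : ∀ᵐ τ ∂(volume.restrict (Ioc a b)),
      seg P T a T (fun _ => constL2 P c) τ = constL2 P c :=
    ae_restrict_of_ae_restrict_of_subset (Ioc_subset_Ioc_right hb)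
      (coeFn_seg_of_mem ha le_rfl (segMemLp_const a T (constL2 P c)))
  filter_upwards [h3] with τ hτ
  have h4 : constL2 P c = c • constL2 P 1 := by rw [smul_constL2, mul_one]
  rw [hτ, h4, inner_smul_right, ← inner_indOp_right, real_inner_comm]

end Variation

/-! ### The equilibrium property -/

section Existence

variable {Ω : Type*} {mΩ : MeasurableSpace Ω} {P : Measure Ω} [IsProbabilityMeasure P]
  {𝓕 : Filtration ℝ≥0 mΩ} {T : ℝ≥0} {W : ℝ≥0 → Ω → ℝ} {M r μ σ lam C c : ℝ} {U : ℝ → Lp ℝ 2 P}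
  {I : PathSpace P T →L[ℝ] Lp ℝ 2 P} {t : ℝ≥0}

/-- The control whose compounded investments are constantly `c`. -/
noncomputable def discountedConst (Ω : Type*) (T : ℝ≥0) (r c : ℝ) (t : ℝ≥0) : Ω → ℝ :=
  fun _ => c * Real.exp (-r * ((T : ℝ) - (t : ℝ)))

lemma isControl_discountedConst (hT : 0 < T)
    (hM : ∀ t : ℝ≥0, 0 < t → t ≤ T → |c * Real.exp (-r * ((T : ℝ) - (t : ℝ)))| ≤ M) :
    IsControl 𝓕 P T M (discountedConst Ω T r c) := by
  have hcont : Continuous fun t : ℝ≥0 => c * Real.exp (-r * ((T : ℝ) - (t : ℝ))) := by fun_prop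
  refine ⟨fun t _ => measurable_const, ae_of_all _ fun ω t ht => ?_,
    ae_of_all _ fun ω t _ _ => hcont.continuousWithinAt,
    ae_of_all _ fun ω t _ => ⟨_, (hcont.tendsto t).mono_left nhdsWithin_le_nhds⟩⟩
  rcases eq_or_ne t 0 with rfl | h0
  · -- the bound at time `0` follows by continuity
    have h1 : Tendsto (fun t : ℝ≥0 => |c * Real.exp (-r * ((T : ℝ) - (t : ℝ)))|) (𝓝[>] 0)
        (𝓝 |c * Real.exp (-r * ((T : ℝ) - ((0 : ℝ≥0) : ℝ)))|) :=
      (hcont.abs.tendsto 0).mono_left nhdsWithin_le_nhds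
    refine le_of_tendsto h1 ?_
    filter_upwards [self_mem_nhdsWithin, mem_nhdsWithin_of_mem_nhds (Iio_mem_nhds hT)] with s hs hs'
    exact hM s hs (le_of_lt hs')
  · exact hM t (pos_of_ne_zero h0) ht

lemma compoundedPath_discountedConst {τ : ℝ} (hτ : 0 ≤ τ) :
    compoundedPath P T r (discountedConst Ω T r c) τ = constL2 P c := by
  have h1 : pathL2 P (discountedConst Ω T r c) τ = constL2 P (c * Real.exp (-r * (T - τ))) := by
    have h2 : discountedConst Ω T r c τ.toNNReal = fun _ => c * Real.exp (-r * (T - τ)) :=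
      funext fun _ => by simp only [discountedConst, Real.coe_toNNReal τ hτ]
    rw [pathL2, h2, constL2]
  rw [compoundedPath, h1, smul_constL2]
  congr 1
  rw [mul_left_comm, ← Real.exp_add, neg_mul, add_neg_cancel, Real.exp_zero, mul_one]

/-- `J` is, up to constants, the mean-variance criterion of the gain from the compounded
investments. -/
def IsGainCriterion (P : Measure Ω) [IsProbabilityMeasure P] (𝓕 : Filtration ℝ≥0 mΩ) (T : ℝ≥0)
    (M μ r σ lam : ℝ) (I : PathSpace P T →L[ℝ] Lp ℝ 2 P)
    (J : ℝ≥0 → ℝ → (ℝ≥0 → Ω → ℝ) → Ω → ℝ) : Prop :=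
  ∀ t < T, ∀ x, ∃ k : ℝ, ∀ u, IsControl 𝓕 P T M u → J t x u =ᵐ[P] fun ω =>
    k + meanVar P lam (𝓕 t) (gainOp μ r σ I (seg P T t T (compoundedPath P T r u))) ω

lemma ae_nonneg_of_setIntegral_nonneg {m : MeasurableSpace Ω} (hm : m ≤ mΩ) {g : Ω → ℝ}
    (hg : StronglyMeasurable[m] g) (hint : Integrable g P)
    (h : ∀ A, MeasurableSet[m] A → 0 ≤ ∫ ω in A, g ω ∂P) : ∀ᵐ ω ∂P, 0 ≤ g ω := by
  refine ae_of_ae_trim hm (ae_nonneg_of_forall_setIntegral_nonneg (hint.trim hm hg) ?_)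
  intro A hA _
  rw [← setIntegral_trim hm hg hA]
  exact h A hA

lemma resid_timeIntegral_const (t : ℝ≥0) (htT : t ≤ T) (c : ℝ) :
    resid P (𝓕.le t) (timeIntegral P T (seg P T t T (fun _ => constL2 P c))) = 0 := by
  have htT' : (t : ℝ) ≤ T := by exact_mod_cast htT
  apply resid_of_meas
  rw [(isAdaptedPath_const (P := P) (𝓕 := 𝓕) (T := T) c).timeIntegral_seg t.coe_nonneg htT' le_rfl,
    intervalIntegral.integral_const]
  exact aestronglyMeasurable_L2_smul _ (aestronglyMeasurable_constL2 c)

/-- A variation over `[t, t + h]` around the constant path raises the criterion by at most the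
order `h ^ (3 / 2)`. -/
lemma IsItoIntegral.setIntegral_variation_const_ge (hW : IsBrownianMotion W 𝓕 P)
    (hI : IsItoIntegral P 𝓕 T W I) (hσ : 0 < σ) (hlam : 0 < lam)
    (hc : 2 * lam * σ ^ 2 * c = μ - r) (hU : IsAdaptedPath P 𝓕 T C U) {h : ℝ≥0} (hth : t + h ≤ T)
    {A : Set Ω} (hA : MeasurableSet[𝓕 t] A) :
    -(2 * lam * σ * |μ - r| * C * |c| * (h * √h)) * P.real A ≤
      ∫ ω in A, (meanVar P lam (𝓕 t) (gainOp μ r σ I (seg P T t T (fun _ => constL2 P c))) ω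
        - meanVar P lam (𝓕 t) (gainOp μ r σ I (seg P T t T (fun _ => constL2 P c)
            + seg P T t (t + h : ℝ≥0) U)) ω) ∂P := by
  have h1 : t ≤ t + h := le_self_add
  have htT : t ≤ T := h1.trans hth
  have h1' : (t : ℝ) ≤ (t + h : ℝ≥0) := by exact_mod_cast h1
  have h2' : ((t + h : ℝ≥0) : ℝ) ≤ T := by exact_mod_cast hth
  have hcp := isAdaptedPath_const (P := P) (𝓕 := 𝓕) (T := T) c
  set κ := seg P T t T (fun _ => constL2 P c) with hκ
  set δ := seg P T t (t + h : ℝ≥0) U with hδ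
  have hκm : κ ∈ integrands P 𝓕 T t := hcp.seg_mem le_rfl htT le_rfl
  have hδm : δ ∈ integrands P 𝓕 T t := hU.seg_mem le_rfl h1 hth
  have hvar := hI.setIntegral_variation hW hc hκm (zero_mem _) hδm
    (resid_timeIntegral_const t htT c) hA
    (inner_indPath_seg_const hU (𝓕.le t A hA) t.coe_nonneg h1' h2' c)
  rw [add_zero, zero_add, map_zero, map_zero, norm_zero] at hvar
  rw [hvar]
  set mA := indOp P (𝓕.le t A hA) with hmA
  set z := mA (resid P (𝓕.le t) (timeIntegral P T δ)) with hz
  -- only the integral of the constant over `[t, t + h]` is correlated with the variation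
  have hzm : AEStronglyMeasurable[𝓕 (t + h)] z P := by
    refine aestronglyMeasurable_indOp (𝓕.le t A hA) (𝓕.mono h1 A hA) ?_
    rw [resid_apply, sub_eq_add_neg, ← neg_one_smul ℝ (condProj _ _ _)]
    exact aestronglyMeasurable_L2_add (hU.aestronglyMeasurable_timeIntegral h1 hth le_rfl)
      (aestronglyMeasurable_L2_smul _
        ((aestronglyMeasurable_condProj (𝓕.le t) _).mono (𝓕.mono h1)))
  have hsplit : inner ℝ z (I κ) = inner ℝ z
      (I (indPath P T (𝓕.le t A hA) (seg P T t (t + h : ℝ≥0) (fun _ => constL2 P c)))) := by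
    rw [hκ, hcp.seg_concat t.coe_nonneg h1' h2' le_rfl, map_add, inner_add_right,
      hI.inner_eq_zero hW (hcp.seg_mem le_rfl hth le_rfl) hzm, add_zero,
      hI.apply_indPath hW hA (hcp.seg_mem le_rfl h1 hth), inner_indOp_right, hz, hmA, indOp_indOp]
  have hh : ((t + h : ℝ≥0) : ℝ) - t = h := by push_cast; ring
  have hz1 : ‖z‖ ≤ C * √(P.real A) * h := by
    refine (norm_indOp_resid_le (𝓕.le t) hA _).trans ?_
    have h3 := norm_indOp_timeIntegral_le hU (𝓕.le t A hA) t.coe_nonneg h1' h2'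
    rwa [hh] at h3
  have hz2 : ‖I (indPath P T (𝓕.le t A hA) (seg P T t (t + h : ℝ≥0) (fun _ => constL2 P c)))‖
      ≤ |c| * √(P.real A) * √h := by
    rw [hI.norm_apply (indPath_mem hA (hcp.seg_mem le_rfl h1 hth))]
    have h3 := norm_indPath_seg_le hcp (𝓕.le t A hA) t.coe_nonneg h1' h2'
    rwa [hh] at h3
  have hin : |inner ℝ z (I κ)| ≤ C * |c| * (h * √h) * P.real A := by
    rw [hsplit]
    refine (abs_real_inner_le_norm _ _).trans ((mul_le_mul hz1 hz2 (norm_nonneg _)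
      ((norm_nonneg _).trans hz1)).trans_eq ?_)
    have h4 : √(P.real A) * √(P.real A) = P.real A := Real.mul_self_sqrt measureReal_nonneg
    linear_combination C * |c| * (h * √h) * h4
  have h5 : |(μ - r) * inner ℝ z (I κ)| ≤ |μ - r| * (C * |c| * (h * √h) * P.real A) := by
    rw [abs_mul]
    exact mul_le_mul_of_nonneg_left hin (abs_nonneg _)
  have h6 := mul_le_mul_of_nonneg_left ((abs_le.1 h5).1) (by positivity : 0 ≤ 2 * lam * σ)
  have h7 : 0 ≤ lam * (‖mA (gainResid 𝓕 μ r σ I t δ)‖ ^ 2 - 0 ^ 2) := by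
    rw [zero_pow two_ne_zero, sub_zero]
    positivity
  linarith

theorem IsItoIntegral.isNashEquilibrium_discountedConst (hW : IsBrownianMotion W 𝓕 P)
    (hI : IsItoIntegral P 𝓕 T W I) (hσ : 0 < σ) (hlam : 0 < lam)
    (hc : 2 * lam * σ ^ 2 * c = μ - r) (hcc : IsControl 𝓕 P T M (discountedConst Ω T r c))
    {J : ℝ≥0 → ℝ → (ℝ≥0 → Ω → ℝ) → Ω → ℝ} (hJ : IsGainCriterion P 𝓕 T M μ r σ lam I J) :
    IsNashEquilibrium P 𝓕 T M J (discountedConst Ω T r c) := by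
  refine ⟨hcc, fun t ht x u hu h hpos hlim => ?_⟩
  obtain ⟨k, hk⟩ := hJ t ht x
  have hU := (hu.isAdaptedPath_compoundedPath (r := r)).sub
    (hcc.isAdaptedPath_compoundedPath (r := r))
  set C := Real.exp (|r| * T) * M + Real.exp (|r| * T) * M
  set D := 2 * lam * σ * |μ - r| * C * |c| with hD
  have hmain : ∀ᵐ ω ∂P, ∀ n, t + h n ≤ T → -(D * √(h n)) ≤
      (J t x (discountedConst Ω T r c) ω - J t x (perturb (discountedConst Ω T r c) u t (h n)) ω)
        / (h n : ℝ) := by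
    refine ae_all_iff.2 fun n => ?_
    by_cases hth : t + h n ≤ T
    swap
    · exact ae_of_all _ fun ω h' => absurd h' hth
    have e1 : seg P T t T (compoundedPath P T r (discountedConst Ω T r c))
        = seg P T t T (fun _ => constL2 P c) :=
      seg_congr fun τ hτ => compoundedPath_discountedConst (t.coe_nonneg.trans hτ.1.le)
    set Z1 := gainOp μ r σ I (seg P T t T (fun _ => constL2 P c)) with hZ1
    set Z2 := gainOp μ r σ I (seg P T t T (fun _ => constL2 P c) + seg P T t (t + h n : ℝ≥0)
      (fun τ => compoundedPath P T r u τ - compoundedPath P T r (discountedConst Ω T r c) τ))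
      with hZ2
    have hint : Integrable (fun ω => meanVar P lam (𝓕 t) Z1 ω - meanVar P lam (𝓕 t) Z2 ω) P :=
      (integrable_meanVar Z1).sub (integrable_meanVar Z2)
    have hnn : ∀ᵐ ω ∂P, 0 ≤ meanVar P lam (𝓕 t) Z1 ω - meanVar P lam (𝓕 t) Z2 ω
        + D * ((h n : ℝ) * √(h n)) := by
      refine ae_nonneg_of_setIntegral_nonneg (𝓕.le t)
        (((stronglyMeasurable_meanVar Z1).sub (stronglyMeasurable_meanVar Z2)).add
          stronglyMeasurable_const)
        (hint.add (integrable_const _))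
        fun A hA => ?_
      have h1 := hI.setIntegral_variation_const_ge hW hσ hlam hc hU hth hA
      rw [integral_add hint.integrableOn (integrable_const _).integrableOn, setIntegral_const,
        smul_eq_mul]
      linarith
    filter_upwards [hnn, hk _ hcc, hk _ (hcc.perturb hu t (h n))] with ω a1 a2 a3 _
    have hn : (0 : ℝ) < h n := by exact_mod_cast hpos n
    rw [le_div_iff₀ hn, a2, a3, seg_perturb hcc hu hth, e1]
    linarith
  filter_upwards [hmain] with ω hω
  have hlim' : Tendsto (fun n => ((-(D * √(h n)) : ℝ) : EReal)) atTop (𝓝 0) := by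
    have h1 : Continuous fun s : ℝ≥0 => ((-(D * √(s : ℝ)) : ℝ) : EReal) :=
      continuous_coe_real_ereal.comp (by fun_prop)
    have h2 := (h1.tendsto 0).comp hlim
    simpa [Function.comp_def] using h2
  rw [← hlim'.liminf_eq]
  refine liminf_le_liminf ?_
  have hev : ∀ᶠ n in atTop, t + h n ≤ T := by
    have h1 : Tendsto (fun n => t + h n) atTop (𝓝 (t + 0)) := hlim.const_add t
    rw [add_zero] at h1
    exact (h1.eventually (gt_mem_nhds ht)).mono fun n hn => hn.le
  filter_upwards [hev] with n hn
  exact EReal.coe_le_coe_iff.2 (hω n hn)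

end Existence

/-! ### Switching off a deviation over a short period -/

section Expansion

variable {Ω : Type*} {mΩ : MeasurableSpace Ω} {P : Measure Ω} [IsProbabilityMeasure P]
  {𝓕 : Filtration ℝ≥0 mΩ} {T : ℝ≥0} {W : ℝ≥0 → Ω → ℝ} {M r μ σ lam C c : ℝ} {Y : ℝ → Lp ℝ 2 P}
  {I : PathSpace P T →L[ℝ] Lp ℝ 2 P} {t : ℝ≥0}

/-- An adapted path is nearly known in advance over short periods. -/
lemma norm_resid_timeIntegral_le (hY : IsAdaptedPath P 𝓕 T C Y) {h : ℝ≥0} (hth : t + h ≤ T) :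
    ‖resid P (𝓕.le t) (timeIntegral P T (seg P T t (t + h : ℝ≥0) Y))‖
      ≤ ∫ τ in (t : ℝ)..(t + h : ℝ≥0), ‖Y τ - Y t‖ := by
  have h1 : t ≤ t + h := le_self_add
  have h1' : (t : ℝ) ≤ (t + h : ℝ≥0) := by exact_mod_cast h1
  have h2' : ((t + h : ℝ≥0) : ℝ) ≤ T := by exact_mod_cast hth
  have hi := hY.intervalIntegrable t.coe_nonneg h1' h2'
  have hYt : AEStronglyMeasurable[𝓕 t] (Y t) P := hY.aestronglyMeasurable (h1.trans hth) le_rfl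
  have h3 : timeIntegral P T (seg P T t (t + h : ℝ≥0) Y)
      = (∫ τ in (t : ℝ)..(t + h : ℝ≥0), (Y τ - Y t)) + (((t + h : ℝ≥0) : ℝ) - t) • Y t := by
    rw [hY.timeIntegral_seg t.coe_nonneg h1' h2',
      intervalIntegral.integral_sub hi intervalIntegrable_const, intervalIntegral.integral_const,
      sub_add_cancel]
  rw [h3, map_add, map_smul, resid_of_meas (𝓕.le t) hYt, smul_zero, add_zero]
  exact (norm_resid_le (𝓕.le t) _).trans (intervalIntegral.norm_integral_le_integral_norm h1')

/-- Over a short period, the pairing of an adapted path with another path is determined by the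
values at the left endpoint, uniformly over events. -/
lemma abs_inner_indPath_sub_le (hY : IsAdaptedPath P 𝓕 T C Y) {A : Set Ω} (hA : MeasurableSet A)
    {h : ℝ≥0} (hth : t + h ≤ T) (φ : PathSpace P T) :
    |inner ℝ (indPath P T hA (seg P T t (t + h : ℝ≥0) Y)) φ
        - h * inner ℝ (indOp P hA (Y t)) (φ t)|
      ≤ C * (∫ τ in (t : ℝ)..(t + h : ℝ≥0), ‖φ τ - φ t‖)
        + ‖φ t‖ * ∫ τ in (t : ℝ)..(t + h : ℝ≥0), ‖Y τ - Y t‖ := by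
  have h1 : t ≤ t + h := le_self_add
  have h1' : (t : ℝ) ≤ (t + h : ℝ≥0) := by exact_mod_cast h1
  have h2' : ((t + h : ℝ≥0) : ℝ) ≤ T := by exact_mod_cast hth
  have hs := hY.segMemLp t.coe_nonneg h1' h2'
  have hsA := segMemLp_indOp hA hs
  have hYi := hY.intervalIntegrable t.coe_nonneg h1' h2'
  have hsub : Ioc (t : ℝ) (t + h : ℝ≥0) ⊆ Ioc 0 (T : ℝ) := Ioc_subset_Ioc t.coe_nonneg h2'
  have hφi : IntervalIntegrable φ volume (t : ℝ) (t + h : ℝ≥0) := by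
    rw [intervalIntegrable_iff_integrableOn_Ioc_of_le h1']
    exact IntegrableOn.mono_set (s := Ioc (t : ℝ) (t + h : ℝ≥0)) (t := Ioc 0 (T : ℝ))
      ((Lp.memLp φ).integrable one_le_two) hsub
  have hYn : IntervalIntegrable (fun τ => ‖Y τ - Y t‖) volume (t : ℝ) (t + h : ℝ≥0) :=
    (hYi.sub intervalIntegrable_const).norm
  have hφn : IntervalIntegrable (fun τ => ‖φ τ - φ t‖) volume (t : ℝ) (t + h : ℝ≥0) :=
    (hφi.sub intervalIntegrable_const).norm
  have hint : IntervalIntegrable (fun τ => inner ℝ (indOp P hA (Y τ)) (φ τ)) volume (t : ℝ)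
      (t + h : ℝ≥0) := by
    rw [intervalIntegrable_iff_integrableOn_Ioc_of_le h1']
    have h3 : Integrable (fun τ => inner ℝ
        (seg P T t (t + h : ℝ≥0) (fun τ => indOp P hA (Y τ)) τ) (φ τ))
        (volume.restrict (Ioc (t : ℝ) (t + h : ℝ≥0))) :=
      IntegrableOn.mono_set (L2.integrable_inner (𝕜 := ℝ) _ φ) hsub
    refine h3.congr ?_
    filter_upwards [coeFn_seg_of_mem t.coe_nonneg h2' hsA] with τ hτ
    rw [hτ]
  have hh : ((t + h : ℝ≥0) : ℝ) - t = h := by push_cast; ring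
  have hconst : h * inner ℝ (indOp P hA (Y t)) (φ t)
      = ∫ _ in (t : ℝ)..(t + h : ℝ≥0), inner ℝ (indOp P hA (Y t)) (φ t) := by
    rw [intervalIntegral.integral_const, hh, smul_eq_mul]
  rw [indPath_seg hA hs, inner_seg_left t.coe_nonneg h1' h2' hsA, hconst,
    ← intervalIntegral.integral_sub hint intervalIntegrable_const,
    ← intervalIntegral.integral_const_mul, ← intervalIntegral.integral_const_mul,
    ← intervalIntegral.integral_add (hφn.const_mul C) (hYn.const_mul _), ← Real.norm_eq_abs]
  refine intervalIntegral.norm_integral_le_of_norm_le h1' (ae_of_all _ fun τ hτ => ?_)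
    ((hφn.const_mul C).add (hYn.const_mul _))
  have h4 : inner ℝ (indOp P hA (Y τ)) (φ τ) - inner ℝ (indOp P hA (Y t)) (φ t)
      = inner ℝ (indOp P hA (Y τ)) (φ τ - φ t) + inner ℝ (indOp P hA (Y τ - Y t)) (φ t) := by
    rw [map_sub, inner_sub_left, inner_sub_right]
    ring
  have h5 : ‖indOp P hA (Y τ)‖ ≤ C := (norm_indOp_le hA _).trans
    (hY.norm_le ⟨t.coe_nonneg.trans hτ.1.le, hτ.2.trans h2'⟩)
  rw [h4]
  refine (norm_add_le _ _).trans (add_le_add ?_ ?_)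
  · exact (norm_inner_le_norm _ _).trans (mul_le_mul_of_nonneg_right h5 (norm_nonneg _))
  · rw [mul_comm]
    exact (norm_inner_le_norm _ _).trans
      (mul_le_mul_of_nonneg_right (norm_indOp_le hA _) (norm_nonneg _))

/-- The variation of the criterion when a deviation `Y` from the constant path is switched off over
`(t, t + h]`, up to terms which vanish with the unpredictable part of `∫ Y dτ`. -/
lemma IsItoIntegral.setIntegral_switch_off (hW : IsBrownianMotion W 𝓕 P)
    (hI : IsItoIntegral P 𝓕 T W I) (hc : 2 * lam * σ ^ 2 * c = μ - r)
    (hY : IsAdaptedPath P 𝓕 T C Y) {a h : ℝ≥0} (hat : a ≤ t) (hth : t + h ≤ T)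
    {A : Set Ω} (hA : MeasurableSet[𝓕 t] A) :
    ∫ ω in A, (meanVar P lam (𝓕 t)
          (gainOp μ r σ I (seg P T t T (fun _ => constL2 P c) + seg P T t T Y)) ω
        - meanVar P lam (𝓕 t) (gainOp μ r σ I (seg P T t T (fun _ => constL2 P c) + seg P T t T Y
            + -seg P T t (t + h : ℝ≥0) Y)) ω) ∂P
      = -lam * (σ ^ 2 * inner ℝ (indPath P T (𝓕.le t A hA) (seg P T t (t + h : ℝ≥0) Y))
            (seg P T 0 T Y)
          + 2 * σ * (μ - r) * inner ℝ (indPath P T (𝓕.le t A hA) (seg P T t (t + h : ℝ≥0) Y))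
            (ContinuousLinearMap.adjoint I (timeIntegral P T (seg P T a T Y))))
        + lam * inner ℝ (indOp P (𝓕.le t A hA)
            (resid P (𝓕.le t) (timeIntegral P T (seg P T t (t + h : ℝ≥0) Y))))
          ((μ - r) ^ 2 • resid P (𝓕.le t) (timeIntegral P T (seg P T t (t + h : ℝ≥0) Y))
            + (2 * (μ - r) * σ) • I (seg P T t (t + h : ℝ≥0) Y)
            - (2 * (μ - r) ^ 2) • resid P (𝓕.le t) (timeIntegral P T (seg P T t T Y))
            - (2 * (μ - r) * σ) • I (seg P T t T Y)
            - (2 * (μ - r) * σ) • I (seg P T t T (fun _ => constL2 P c))) := by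
  have h1 : t ≤ t + h := le_self_add
  have htT : t ≤ T := h1.trans hth
  have h1' : (t : ℝ) ≤ (t + h : ℝ≥0) := by exact_mod_cast h1
  have h2' : ((t + h : ℝ≥0) : ℝ) ≤ T := by exact_mod_cast hth
  have hat' : (a : ℝ) ≤ t := by exact_mod_cast hat
  have htT' : (t : ℝ) ≤ T := by exact_mod_cast htT
  have hcp := isAdaptedPath_const (P := P) (𝓕 := 𝓕) (T := T) c
  set κ := seg P T t T (fun _ => constL2 P c) with hκ
  set η := seg P T t T Y with hη
  set ε := seg P T t (t + h : ℝ≥0) Y with hε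
  have hκm : κ ∈ integrands P 𝓕 T t := hcp.seg_mem le_rfl htT le_rfl
  have hηm : η ∈ integrands P 𝓕 T t := hY.seg_mem le_rfl htT le_rfl
  have hεm : ε ∈ integrands P 𝓕 T t := hY.seg_mem le_rfl h1 hth
  have hεκ : inner ℝ (indPath P T (𝓕.le t A hA) (-ε)) κ
      = c * inner ℝ (indOp P (𝓕.le t A hA) (constL2 P 1)) (timeIntegral P T (-ε)) := by
    rw [map_neg, map_neg, inner_neg_left, inner_neg_right,
      inner_indPath_seg_const hY (𝓕.le t A hA) t.coe_nonneg h1' h2' c, mul_neg]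
  rw [hI.setIntegral_variation hW hc hκm hηm (neg_mem hεm) (resid_timeIntegral_const t htT c) hA
    hεκ]
  have hpair : ∀ (φ φ' : PathSpace P T), (∀ᵐ τ ∂(volume.restrict (Ioc (t : ℝ) (t + h : ℝ≥0))),
      φ τ = φ' τ) → inner ℝ (indPath P T (𝓕.le t A hA) ε) φ
        = inner ℝ (indPath P T (𝓕.le t A hA) ε) φ' := by
    intro φ φ' hφ
    have hs := hY.segMemLp t.coe_nonneg h1' h2'
    rw [hε, indPath_seg _ hs, inner_seg_left t.coe_nonneg h1' h2' (segMemLp_indOp _ hs),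
      inner_seg_left t.coe_nonneg h1' h2' (segMemLp_indOp _ hs),
      intervalIntegral.integral_of_le h1', intervalIntegral.integral_of_le h1']
    apply integral_congr_ae
    filter_upwards [hφ] with τ hτ
    rw [hτ]
  have hYε := coeFn_seg_of_mem t.coe_nonneg h2' (hY.segMemLp t.coe_nonneg h1' h2')
  have hYη : ∀ᵐ τ ∂(volume.restrict (Ioc (t : ℝ) (t + h : ℝ≥0))), η τ = Y τ :=
    ae_restrict_of_ae_restrict_of_subset (Ioc_subset_Ioc_right h2')
      (coeFn_seg_of_mem t.coe_nonneg le_rfl (hY.segMemLp t.coe_nonneg htT' le_rfl))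
  have hY0 : ∀ᵐ τ ∂(volume.restrict (Ioc (t : ℝ) (t + h : ℝ≥0))), seg P T 0 T Y τ = Y τ :=
    ae_restrict_of_ae_restrict_of_subset (Ioc_subset_Ioc t.coe_nonneg h2')
      (coeFn_seg_of_mem le_rfl le_rfl (hY.segMemLp le_rfl T.coe_nonneg le_rfl))
  have p1 : inner ℝ (indPath P T (𝓕.le t A hA) ε) ε
      = inner ℝ (indPath P T (𝓕.le t A hA) ε) (seg P T 0 T Y) := hpair _ _ (by
    filter_upwards [hYε, hY0] with τ e1 e2
    rw [e1, e2])
  have p2 : inner ℝ (indPath P T (𝓕.le t A hA) ε) η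
      = inner ℝ (indPath P T (𝓕.le t A hA) ε) (seg P T 0 T Y) := hpair _ _ (by
    filter_upwards [hYη, hY0] with τ e1 e2
    rw [e1, e2])
  -- what is known at time `t` does not contribute to the covariance with the stochastic integral
  have p3 : inner ℝ (I (indPath P T (𝓕.le t A hA) ε)) (resid P (𝓕.le t) (timeIntegral P T η))
      = inner ℝ (indPath P T (𝓕.le t A hA) ε)
        (ContinuousLinearMap.adjoint I (timeIntegral P T (seg P T a T Y))) := by
    have hm := indPath_mem hA hεm
    rw [ContinuousLinearMap.adjoint_inner_right, hY.seg_concat a.coe_nonneg hat' htT' le_rfl,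
      map_add, inner_add_right, resid_apply, inner_sub_right,
      real_inner_comm (condProj P (𝓕.le t) (timeIntegral P T η)),
      hI.inner_eq_zero hW hm (aestronglyMeasurable_condProj (𝓕.le t) _),
      real_inner_comm (timeIntegral P T (seg P T a t Y)),
      hI.inner_eq_zero hW hm (hY.aestronglyMeasurable_timeIntegral hat htT le_rfl), sub_zero,
      zero_add]
  set mA := indOp P (𝓕.le t A hA) with hmA
  set V := gainResid 𝓕 μ r σ I t with hV
  set S := timeIntegral P T
  set R := resid P (𝓕.le t)
  have q1 : inner ℝ (mA (I ε)) (I ε) = inner ℝ (indPath P T (𝓕.le t A hA) ε) (seg P T 0 T Y) := by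
    rw [← p1, ← hI.inner_apply (indPath_mem hA hεm) hεm, hI.apply_indPath hW hA hεm]
  have q2 : inner ℝ (mA (I ε)) (I η) = inner ℝ (indPath P T (𝓕.le t A hA) ε) (seg P T 0 T Y) := by
    rw [← p2, ← hI.inner_apply (indPath_mem hA hεm) hηm, hI.apply_indPath hW hA hεm]
  rw [hI.apply_indPath hW hA hεm] at p3
  have e1 : mA (V (η + -ε)) = mA (V η) - mA (V ε) := by
    rw [map_add, map_neg, map_add, map_neg, sub_eq_add_neg]
  have e2 : inner ℝ (mA (V η)) (mA (V ε)) = inner ℝ (mA (V ε)) (V η) := by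
    rw [real_inner_comm, inner_indOp_indOp]
  have e3 : ‖mA (V ε)‖ ^ 2 = inner ℝ (mA (V ε)) (V ε) := by
    rw [← real_inner_self_eq_norm_sq, inner_indOp_indOp]
  have e4 : inner ℝ (mA (I ε)) (R (S ε)) = inner ℝ (mA (R (S ε))) (I ε) := by
    rw [← inner_indOp_right, real_inner_comm]
  rw [e1, norm_sub_sq_real, e2, e3, hV, gainResid_apply, gainResid_apply]
  simp only [map_add, map_smul, map_neg, inner_add_left, inner_add_right, inner_sub_right,
    inner_smul_left, inner_smul_right, inner_neg_left, conj_trivial]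
  rw [q1, q2, p3, e4]
  ring

end Expansion

section Uniqueness

variable {Ω : Type*} {mΩ : MeasurableSpace Ω} {P : Measure Ω} [IsProbabilityMeasure P]
  {𝓕 : Filtration ℝ≥0 mΩ} {T : ℝ≥0} {W : ℝ≥0 → Ω → ℝ} {M r μ σ lam C c : ℝ} {Y : ℝ → Lp ℝ 2 P}
  {I : PathSpace P T →L[ℝ] Lp ℝ 2 P} {t : ℝ≥0}

/-- The one-sided Lebesgue differentiation theorem for elements of the path space. -/
lemma ae_tendsto_average_pathSpace (φ : PathSpace P T) :
    ∀ᵐ (t : ℝ) ∂(volume.restrict (Ioc 0 (T : ℝ))), t < T →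
      Tendsto (fun h : ℝ => h⁻¹ * ∫ τ in t..(t + h), ‖φ τ - φ t‖) (𝓝[>] 0) (𝓝 0) := by
  set f : ℝ → Lp ℝ 2 P := (Ioc 0 (T : ℝ)).indicator φ with hf
  have hφ : IntegrableOn φ (Ioc 0 (T : ℝ)) := (Lp.memLp φ).integrable one_le_two
  have hfl : LocallyIntegrable f volume :=
    ((integrable_indicator_iff measurableSet_Ioc).2 hφ).locallyIntegrable
  set v := IsUnifLocDoublingMeasure.vitaliFamily (volume : Measure ℝ) 1
  have h1 := v.ae_tendsto_average_norm_sub hfl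
  filter_upwards [ae_restrict_of_ae h1, ae_restrict_mem measurableSet_Ioc] with t ht hm htT
  have h2 : Tendsto (fun h : ℝ => t + h) (𝓝[>] 0) (𝓝[>] t) := by
    refine tendsto_nhdsWithin_iff.2 ⟨?_, ?_⟩
    · have h : Tendsto (fun h : ℝ => t + h) (𝓝 0) (𝓝 (t + 0)) := tendsto_id.const_add t
      rw [add_zero] at h
      exact h.mono_left nhdsWithin_le_nhds
    · filter_upwards [self_mem_nhdsWithin] with h hh
      exact lt_add_of_pos_right t hh
  have h3 := ht.comp ((Real.tendsto_Icc_vitaliFamily_right t).comp h2)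
  refine h3.congr' ?_
  have h4 : Iio ((T : ℝ) - t) ∈ 𝓝 (0 : ℝ) := Iio_mem_nhds (sub_pos.2 htT)
  filter_upwards [self_mem_nhdsWithin, mem_nhdsWithin_of_mem_nhds h4] with h hh hh'
  have hh0 : (0 : ℝ) < h := hh
  have hhT : h < T - t := hh'
  have hle : t ≤ t + h := by linarith
  simp only [Function.comp_apply]
  rw [setAverage_eq, measureReal_def, Real.volume_Icc, add_sub_cancel_left,
    ENNReal.toReal_ofReal hh0.le, smul_eq_mul, integral_Icc_eq_integral_Ioc,
    intervalIntegral.integral_of_le hle]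
  congr 1
  refine setIntegral_congr_fun measurableSet_Ioc fun τ hτ => ?_
  have hτm : τ ∈ Ioc 0 (T : ℝ) := ⟨hm.1.trans hτ.1, by linarith [hτ.2]⟩
  simp only [hf, indicator_of_mem hτm, indicator_of_mem hm]

/-- The first-order upper bound for the loss from switching off a deviation `Y` from the constant
path over `(t, t + h]`, uniformly over the events known at time `t`. -/
lemma IsItoIntegral.setIntegral_switch_off_le (hW : IsBrownianMotion W 𝓕 P)
    (hI : IsItoIntegral P 𝓕 T W I) (hσ : 0 < σ) (hlam : 0 < lam)
    (hc : 2 * lam * σ ^ 2 * c = μ - r)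
    (hY : IsAdaptedPath P 𝓕 T C Y) {a : ℝ≥0} (hat : a ≤ t) {φ ψ : PathSpace P T}
    (hφ : φ = seg P T 0 T Y) (hφt : φ t = Y t)
    (hψ : ψ = ContinuousLinearMap.adjoint I (timeIntegral P T (seg P T a T Y))) :
    ∃ K : ℝ, ∀ h : ℝ≥0, t + h ≤ T → ∀ (A : Set Ω) (hA : MeasurableSet[𝓕 t] A),
      ∫ ω in A, (meanVar P lam (𝓕 t)
          (gainOp μ r σ I (seg P T t T (fun _ => constL2 P c) + seg P T t T Y)) ω
        - meanVar P lam (𝓕 t) (gainOp μ r σ I (seg P T t T (fun _ => constL2 P c) + seg P T t T Y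
            + -seg P T t (t + h : ℝ≥0) Y)) ω) ∂P
      ≤ -lam * h * (σ ^ 2 * inner ℝ (indOp P (𝓕.le t A hA) (Y t)) (Y t)
          + 2 * σ * (μ - r) * inner ℝ (indOp P (𝓕.le t A hA) (Y t)) (ψ t))
        + K * ((∫ τ in (t : ℝ)..(t + h), ‖φ τ - φ t‖) + ∫ τ in (t : ℝ)..(t + h), ‖ψ τ - ψ t‖) := by
  have hC := hY.nonneg
  set S := timeIntegral P T
  set R := resid P (𝓕.le t)
  set L := (μ - r) ^ 2 • R.comp S + (2 * (μ - r) * σ) • I with hL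
  set w := (2 * (μ - r) ^ 2) • R (S (seg P T t T Y)) + (2 * (μ - r) * σ) • I (seg P T t T Y)
    + (2 * (μ - r) * σ) • I (seg P T t T (fun _ => constL2 P c)) with hw
  set B := ‖L‖ * (C * √T) + ‖w‖ with hB
  -- `L ε - w` collects the factors paired with the unpredictable part of `∫ Y dτ`
  refine ⟨lam * (σ ^ 2 * (C + ‖Y t‖) + 2 * σ * |μ - r| * (C + ‖ψ t‖) + B), fun h hth A hA => ?_⟩
  have h1 : t ≤ t + h := le_self_add
  have h1' : (t : ℝ) ≤ (t + h : ℝ≥0) := by exact_mod_cast h1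
  have h2' : ((t + h : ℝ≥0) : ℝ) ≤ T := by exact_mod_cast hth
  have hcast : ((t + h : ℝ≥0) : ℝ) = t + h := NNReal.coe_add t h
  have hYφ : ∫ τ in (t : ℝ)..(t + h : ℝ≥0), ‖Y τ - Y t‖
      = ∫ τ in (t : ℝ)..(t + h : ℝ≥0), ‖φ τ - φ t‖ := by
    rw [intervalIntegral.integral_of_le h1', intervalIntegral.integral_of_le h1']
    apply integral_congr_ae
    have h3 : ∀ᵐ τ ∂(volume.restrict (Ioc (t : ℝ) (t + h : ℝ≥0))), φ τ = Y τ := by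
      rw [hφ]
      exact ae_restrict_of_ae_restrict_of_subset (Ioc_subset_Ioc t.coe_nonneg h2')
        (coeFn_seg_of_mem le_rfl le_rfl (hY.segMemLp le_rfl T.coe_nonneg le_rfl))
    filter_upwards [h3] with τ hτ
    rw [hτ, hφt]
  have b1 := abs_inner_indPath_sub_le hY (𝓕.le t A hA) hth φ
  have b2 := abs_inner_indPath_sub_le hY (𝓕.le t A hA) hth ψ
  have b3 := norm_resid_timeIntegral_le hY hth
  rw [hYφ] at b1 b2 b3
  have heq := hI.setIntegral_switch_off hW hc hY (r := r) (μ := μ) hat hth hA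
  rw [← hφ, ← hψ] at heq
  rw [heq, ← hcast]
  set ε := seg P T t (t + h : ℝ≥0) Y with hε
  set mA := indOp P (𝓕.le t A hA)
  set ρ1 := ∫ τ in (t : ℝ)..(t + h : ℝ≥0), ‖φ τ - φ t‖ with hρ1
  set ρ2 := ∫ τ in (t : ℝ)..(t + h : ℝ≥0), ‖ψ τ - ψ t‖ with hρ2
  have hρ1n : 0 ≤ ρ1 := intervalIntegral.integral_nonneg h1' fun _ _ => norm_nonneg _
  have hρ2n : 0 ≤ ρ2 := intervalIntegral.integral_nonneg h1' fun _ _ => norm_nonneg _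
  have hv : (μ - r) ^ 2 • R (S ε) + (2 * (μ - r) * σ) • I ε
      - (2 * (μ - r) ^ 2) • R (S (seg P T t T Y)) - (2 * (μ - r) * σ) • I (seg P T t T Y)
      - (2 * (μ - r) * σ) • I (seg P T t T (fun _ => constL2 P c)) = L ε - w := by
    have hLε : L ε = (μ - r) ^ 2 • R (S ε) + (2 * (μ - r) * σ) • I ε := rfl
    rw [hLε, hw]
    abel
  have hεn : ‖ε‖ ≤ C * √T := by
    refine (hY.norm_seg_le t.coe_nonneg h1' h2').trans ?_
    gcongr
    have := t.coe_nonneg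
    linarith
  have hvn : ‖L ε - w‖ ≤ B := (norm_sub_le _ _).trans
    (add_le_add_left ((L.le_opNorm ε).trans (mul_le_mul_of_nonneg_left hεn (norm_nonneg _))) _)
  rw [hv]
  have b4 : inner ℝ (mA (R (S ε))) (L ε - w) ≤ ρ1 * B :=
    (real_inner_le_norm _ _).trans (mul_le_mul ((norm_indOp_le _ _).trans b3) hvn (norm_nonneg _)
      hρ1n)
  rw [hφt] at b1
  have b1' := (abs_le.1 b1).1
  have b2' := abs_le.1 b2
  set x1 := inner ℝ (indPath P T (𝓕.le t A hA) ε) φ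
  set x2 := inner ℝ (indPath P T (𝓕.le t A hA) ε) ψ
  set y1 := inner ℝ (mA (Y t)) (Y t)
  set y2 := inner ℝ (mA (Y t)) (ψ t)
  have c1 : -(σ ^ 2 * (x1 - h * y1)) ≤ σ ^ 2 * ((C + ‖Y t‖) * (ρ1 + ρ2)) := by
    rw [← mul_neg]
    refine mul_le_mul_of_nonneg_left ?_ (sq_nonneg σ)
    have := mul_nonneg (add_nonneg hC (norm_nonneg (Y t))) hρ2n
    linarith
  have c2 : -(2 * σ * (μ - r) * (x2 - h * y2))
      ≤ 2 * σ * (|μ - r| * ((C + ‖ψ t‖) * (ρ1 + ρ2))) := by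
    have h5 : |(μ - r) * (x2 - h * y2)| ≤ |μ - r| * ((C + ‖ψ t‖) * (ρ1 + ρ2)) := by
      rw [abs_mul]
      refine mul_le_mul_of_nonneg_left (b2.trans ?_) (abs_nonneg _)
      have e1 := mul_nonneg hC hρ1n
      have e2 := mul_nonneg (norm_nonneg (ψ t)) hρ2n
      linarith
    have h6 := mul_le_mul_of_nonneg_left (abs_le.1 h5).1 (by positivity : 0 ≤ 2 * σ)
    linarith
  have hBn : 0 ≤ B := (norm_nonneg _).trans hvn
  have c3 : inner ℝ (mA (R (S ε))) (L ε - w) ≤ B * (ρ1 + ρ2) := by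
    have := mul_nonneg hBn hρ2n
    linarith
  have c4 := mul_le_mul_of_nonneg_left (add_le_add (add_le_add c1 c2) c3) hlam.le
  linarith

end Uniqueness

/-! ### Uniqueness -/

section Uniqueness

variable {Ω : Type*} {mΩ : MeasurableSpace Ω} {P : Measure Ω} [IsProbabilityMeasure P]
  {𝓕 : Filtration ℝ≥0 mΩ} {T : ℝ≥0} {W : ℝ≥0 → Ω → ℝ} {M r μ σ lam C c : ℝ} {Y : ℝ → Lp ℝ 2 P}
  {I : PathSpace P T →L[ℝ] Lp ℝ 2 P} {t : ℝ≥0} {uhat : ℝ≥0 → Ω → ℝ}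
  {J : ℝ≥0 → ℝ → (ℝ≥0 → Ω → ℝ) → Ω → ℝ}

/-- The deviation of the compounded investments of a control from the constant `c`. -/
noncomputable def deviation (P : Measure Ω) (T : ℝ≥0) (r c : ℝ) (uhat : ℝ≥0 → Ω → ℝ) (τ : ℝ) :
    Lp ℝ 2 P := compoundedPath P T r uhat τ - constL2 P c

lemma IsControl.isAdaptedPath_deviation (hu : IsControl 𝓕 P T M uhat)
    (c : ℝ) : IsAdaptedPath P 𝓕 T (Real.exp (|r| * T) * M + |c|) (deviation P T r c uhat) :=
  hu.isAdaptedPath_compoundedPath.sub (isAdaptedPath_const c)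

/-- The first-order condition of an equilibrium, tested against switching to the constant `c` over
a short period after `t`, when `t` is a Lebesgue point. -/
theorem IsItoIntegral.first_order_condition (hW : IsBrownianMotion W 𝓕 P)
    (hI : IsItoIntegral P 𝓕 T W I) (hσ : 0 < σ) (hlam : 0 < lam)
    (hc : 2 * lam * σ ^ 2 * c = μ - r) (hcc : IsControl 𝓕 P T M (discountedConst Ω T r c))
    (hJ : IsGainCriterion P 𝓕 T M μ r σ lam I J) (hN : IsNashEquilibrium P 𝓕 T M J uhat)
    {a : ℝ≥0} (hat : a ≤ t) (htT : t < T) {φ ψ : PathSpace P T}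
    (hφ : φ = seg P T 0 T (deviation P T r c uhat)) (hφt : φ t = deviation P T r c uhat t)
    (hψ : ψ = ContinuousLinearMap.adjoint I
      (timeIntegral P T (seg P T a T (deviation P T r c uhat))))
    (lφ : Tendsto (fun h : ℝ => h⁻¹ * ∫ τ in (t : ℝ)..(t + h), ‖φ τ - φ t‖) (𝓝[>] 0) (𝓝 0))
    (lψ : Tendsto (fun h : ℝ => h⁻¹ * ∫ τ in (t : ℝ)..(t + h), ‖ψ τ - ψ t‖) (𝓝[>] 0) (𝓝 0)) :
    inner ℝ (deviation P T r c uhat t)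
      (σ • deviation P T r c uhat t + (2 * (μ - r)) • ψ t) ≤ 0 := by
  have huc := hN.isControl
  set Y := deviation P T r c uhat with hYdef
  have hY := huc.isAdaptedPath_deviation (r := r) c
  obtain ⟨K, hK⟩ := hI.setIntegral_switch_off_le hW hσ hlam hc hY hat hφ hφt hψ
  -- a sequence of periods that shrinks to zero
  set h : ℕ → ℝ≥0 := fun n => (T - t) / (n + 1) with hh
  have hTt : 0 < T - t := tsub_pos_of_lt htT
  have hpos : ∀ n, 0 < h n := fun n => div_pos hTt (by positivity)
  have hle : ∀ n, t + h n ≤ T := fun n => by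
    have h1 : h n ≤ T - t := div_le_self zero_le (by simp)
    exact (add_le_add_right h1 t).trans_eq (add_tsub_cancel_of_le htT.le)
  have hlim0 : Tendsto (fun n => (h n : ℝ)) atTop (𝓝 0) := by
    have h1 := tendsto_one_div_add_atTop_nhds_zero_nat (𝕜 := ℝ).const_mul ((T - t : ℝ≥0) : ℝ)
    rw [mul_zero] at h1
    refine h1.congr fun n => ?_
    simp only [hh]
    push_cast
    ring
  have hlim : Tendsto h atTop (𝓝 0) := NNReal.tendsto_coe.1 (by simpa using hlim0)
  have hlimR : Tendsto (fun n => (h n : ℝ)) atTop (𝓝[>] 0) := by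
    refine tendsto_nhdsWithin_iff.2 ⟨hlim0, Eventually.of_forall fun n => ?_⟩
    exact NNReal.coe_pos.2 (hpos n)
  set κ := seg P T t T (fun _ => constL2 P c) with hκ
  set η := seg P T t T Y with hη
  have ht0 := t.coe_nonneg
  have htT' : (t : ℝ) ≤ T := by exact_mod_cast htT.le
  set g : ℕ → Ω → ℝ := fun n ω => meanVar P lam (𝓕 t) (gainOp μ r σ I (κ + η)) ω
    - meanVar P lam (𝓕 t) (gainOp μ r σ I (κ + η + -seg P T t (t + h n : ℝ≥0) Y)) ω with hg
  have hgm : ∀ n, StronglyMeasurable[𝓕 t] (g n) := fun n =>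
    (stronglyMeasurable_meanVar _).sub (stronglyMeasurable_meanVar _)
  have hgi : ∀ n, Integrable (g n) P := fun n =>
    (integrable_meanVar _).sub (integrable_meanVar _)
  -- the equilibrium condition in terms of `g`
  have hcp := isAdaptedPath_const (P := P) (𝓕 := 𝓕) (T := T) c
  have hw := huc.isAdaptedPath_compoundedPath (r := r)
  have hκη : seg P T t T (compoundedPath P T r uhat) = κ + η := by
    rw [hη, hYdef]
    unfold deviation
    rw [seg_sub (hw.segMemLp ht0 htT' le_rfl) (hcp.segMemLp ht0 htT' le_rfl)]
    abel
  have hneg : ∀ n, seg P T t (t + h n : ℝ≥0) (fun τ =>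
      compoundedPath P T r (discountedConst Ω T r c) τ - compoundedPath P T r uhat τ)
      = -seg P T t (t + h n : ℝ≥0) Y := by
    intro n
    have h1' : (t : ℝ) ≤ (t + h n : ℝ≥0) := by exact_mod_cast le_self_add
    have h2' : ((t + h n : ℝ≥0) : ℝ) ≤ T := by exact_mod_cast hle n
    rw [← neg_one_smul ℝ, ← seg_smul _ (hY.segMemLp ht0 h1' h2')]
    refine seg_congr fun τ hτ => ?_
    rw [compoundedPath_discountedConst (ht0.trans hτ.1.le), neg_one_smul]
    exact (neg_sub _ _).symm
  have hliminf : ∀ᵐ ω ∂P,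
      (0 : EReal) ≤ liminf (fun n => ((g n ω / (h n : ℝ) : ℝ) : EReal)) atTop := by
    obtain ⟨k, hk⟩ := hJ t htT 0
    have h3 : ∀ᵐ ω ∂P, ∀ n, J t 0 uhat ω - J t 0 (perturb uhat (discountedConst Ω T r c) t (h n)) ω
        = g n ω := by
      refine ae_all_iff.2 fun n => ?_
      filter_upwards [hk _ huc, hk _ (huc.perturb hcc t (h n))] with ω a1 a2
      rw [a1, a2, seg_perturb huc hcc (hle n), hκη, hneg n, hg]
      ring
    filter_upwards [hN.equilibrium t htT 0 _ hcc h hpos hlim, h3] with ω a1 a2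
    simpa only [a2] using a1
  set v : Lp ℝ 2 P := σ ^ 2 • Y t + (2 * σ * (μ - r)) • ψ t with hv
  have hYv : Integrable (fun ω => Y t ω * v ω) P := (Lp.memLp (Y t)).integrable_mul (Lp.memLp v)
  have hmain : ∀ e : ℝ, 0 < e → lam * inner ℝ (Y t) v ≤ e := by
    intro e he
    -- the events on which the equilibrium condition nearly holds exhaust the space
    set A : ℕ → Set Ω := fun n => {ω | -e * h n ≤ g n ω} with hA
    have hAm : ∀ n, MeasurableSet[𝓕 t] (A n) := fun n =>
      (hgm n).measurable measurableSet_Ici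
    have hev : ∀ᵐ ω ∂P, ∀ᶠ n in atTop, ω ∈ A n := by
      filter_upwards [hliminf] with ω hω
      have h4 : ((-e : ℝ) : EReal) < 0 := by exact_mod_cast neg_lt_zero.2 he
      filter_upwards [eventually_lt_of_lt_liminf (h4.trans_le hω)] with n hn
      have h5 := EReal.coe_lt_coe_iff.1 hn
      exact ((lt_div_iff₀ (NNReal.coe_pos.2 (hpos n))).1 h5).le
    have hlimA : Tendsto (fun n => ∫ ω in A n, Y t ω * v ω ∂P) atTop
        (𝓝 (inner ℝ (Y t) v)) := by
      rw [inner_eq_integral]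
      have e1 : (fun n => ∫ ω in A n, Y t ω * v ω ∂P)
          = fun n => ∫ ω, (A n).indicator (fun ω => Y t ω * v ω) ω ∂P :=
        funext fun n => (integral_indicator (𝓕.le t _ (hAm n))).symm
      rw [e1]
      refine tendsto_integral_of_dominated_convergence (fun ω => ‖Y t ω * v ω‖)
        (fun n => hYv.aestronglyMeasurable.indicator (𝓕.le t _ (hAm n))) hYv.norm
        (fun n => ae_of_all _ fun ω => norm_indicator_le_norm_self (fun ω => Y t ω * v ω) ω) ?_
      filter_upwards [hev] with ω hω
      refine tendsto_const_nhds.congr' ?_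
      filter_upwards [hω] with n hn
      exact (indicator_of_mem (f := fun ω => Y t ω * v ω) hn).symm
    have hbound : ∀ n, lam * ∫ ω in A n, Y t ω * v ω ∂P
        ≤ e + K * ((h n : ℝ)⁻¹ * (∫ τ in (t : ℝ)..(t + h n), ‖φ τ - φ t‖)
          + (h n : ℝ)⁻¹ * ∫ τ in (t : ℝ)..(t + h n), ‖ψ τ - ψ t‖) := by
      intro n
      have hn : (0 : ℝ) < h n := NNReal.coe_pos.2 (hpos n)
      have h6 := hK (h n) (hle n) (A n) (hAm n)
      have h7 : -e * h n ≤ ∫ ω in A n, g n ω ∂P := by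
        have h8 : ∫ _ in A n, (-e * h n) ∂P ≤ ∫ ω in A n, g n ω ∂P :=
          setIntegral_mono_on (integrable_const _).integrableOn (hgi n).integrableOn
            (𝓕.le t _ (hAm n)) fun ω hω => hω
        rw [setIntegral_const, smul_eq_mul] at h8
        refine le_trans ?_ h8
        have h9 : P.real (A n) ≤ 1 := measureReal_le_one
        have h10 : 0 ≤ e * h n := by positivity
        nlinarith
      have h8 : ∫ ω in A n, Y t ω * v ω ∂P
          = σ ^ 2 * inner ℝ (indOp P (𝓕.le t _ (hAm n)) (Y t)) (Y t)
          + 2 * σ * (μ - r) * inner ℝ (indOp P (𝓕.le t _ (hAm n)) (Y t)) (ψ t) := by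
        rw [← inner_indOp_left (𝓕.le t _ (hAm n)), hv, inner_add_right, inner_smul_right,
          inner_smul_right]
      rw [← h8] at h6
      have h9 := h7.trans h6
      rw [← mul_add, mul_left_comm, ← sub_le_iff_le_add', inv_mul_eq_div, sub_le_iff_le_add',
        ← sub_le_iff_le_add', le_div_iff₀ hn]
      linarith
    have hlim2 : Tendsto (fun n => e + K * ((h n : ℝ)⁻¹ * (∫ τ in (t : ℝ)..(t + h n), ‖φ τ - φ t‖)
          + (h n : ℝ)⁻¹ * ∫ τ in (t : ℝ)..(t + h n), ‖ψ τ - ψ t‖)) atTop (𝓝 e) := by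
      have h10 := (((lφ.comp hlimR).add (lψ.comp hlimR)).const_mul K).const_add e
      rw [add_zero, mul_zero, add_zero] at h10
      exact h10
    exact le_of_tendsto_of_tendsto' (hlimA.const_mul lam) hlim2 hbound
  -- divide by `lam` and by one of the factors `σ`
  have hle0 : lam * inner ℝ (Y t) v ≤ 0 := le_of_forall_pos_le_add fun e he => by
    rw [zero_add]; exact hmain e he
  have hv2 : v = σ • (σ • Y t + (2 * (μ - r)) • ψ t) := by
    rw [hv, smul_add, smul_smul, smul_smul, sq]
    congr 2
    ring
  rw [hv2, inner_smul_right] at hle0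
  have h11 := nonpos_of_mul_nonpos_right hle0 hlam
  exact nonpos_of_mul_nonpos_right h11 hσ

end Uniqueness

section Uniqueness

variable {Ω : Type*} {mΩ : MeasurableSpace Ω} {P : Measure Ω} [IsProbabilityMeasure P]
  {𝓕 : Filtration ℝ≥0 mΩ} {T : ℝ≥0} {W : ℝ≥0 → Ω → ℝ} {M r μ σ lam C c : ℝ} {Y : ℝ → Lp ℝ 2 P}
  {I : PathSpace P T →L[ℝ] Lp ℝ 2 P} {uhat : ℝ≥0 → Ω → ℝ}
  {J : ℝ≥0 → ℝ → (ℝ≥0 → Ω → ℝ) → Ω → ℝ}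

/-- The Cauchy–Schwarz inequality in time. -/
lemma norm_timeIntegral_seg_le (hY : IsAdaptedPath P 𝓕 T C Y) {a b : ℝ} (ha : 0 ≤ a) (hab : a ≤ b)
    (hb : b ≤ T) : ‖timeIntegral P T (seg P T a b Y)‖ ≤ √(b - a) * ‖seg P T a b Y‖ := by
  have hs := hY.segMemLp ha hab hb
  set z := timeIntegral P T (seg P T a b Y) with hz
  have h1 : ‖z‖ ^ 2 = inner ℝ (seg P T a b Y) (seg P T a b (fun _ => z)) := by
    rw [inner_seg_seg ha hab hb hs (segMemLp_const a b z), ← real_inner_self_eq_norm_sq]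
    have h := (innerSL ℝ z).intervalIntegral_comp_comm (hY.intervalIntegrable ha hab hb)
    simp only [innerSL_apply_apply] at h
    rw [← hY.timeIntegral_seg ha hab hb, ← hz] at h
    rw [← h]
    exact intervalIntegral.integral_congr fun τ _ => real_inner_comm _ _
  have h2 : ‖seg P T a b (fun _ => z)‖ ≤ ‖z‖ * √(b - a) :=
    norm_seg_le ha hab hb (segMemLp_const a b z) (norm_nonneg z) fun _ _ => le_rfl
  have h3 : ‖z‖ ^ 2 ≤ ‖z‖ * (√(b - a) * ‖seg P T a b Y‖) := by
    rw [h1]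
    refine (real_inner_le_norm _ _).trans
      ((mul_le_mul_of_nonneg_left h2 (norm_nonneg _)).trans_eq ?_)
    ring
  rcases eq_or_lt_of_le (norm_nonneg z) with h0 | h0
  · rw [← h0]; positivity
  · rw [sq] at h3
    exact le_of_mul_le_mul_left h3 h0

/-- A deviation that vanishes after time `b` vanishes already after time `a`, if `[a, b]` is short
enough for the first-order condition to be coercive. -/
theorem IsItoIntegral.seg_deviation_eq_zero_step (hW : IsBrownianMotion W 𝓕 P)
    (hI : IsItoIntegral P 𝓕 T W I) (hσ : 0 < σ) (hlam : 0 < lam)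
    (hc : 2 * lam * σ ^ 2 * c = μ - r) (hcc : IsControl 𝓕 P T M (discountedConst Ω T r c))
    (hJ : IsGainCriterion P 𝓕 T M μ r σ lam I J) (hN : IsNashEquilibrium P 𝓕 T M J uhat)
    {a b : ℝ≥0} (hab : a ≤ b) (hbT : b ≤ T) (hb : seg P T b T (deviation P T r c uhat) = 0)
    (hd : 2 * |μ - r| * √((b : ℝ) - a) < σ) : seg P T a T (deviation P T r c uhat) = 0 := by
  have hab' : (a : ℝ) ≤ b := by exact_mod_cast hab
  have hbT' : (b : ℝ) ≤ T := by exact_mod_cast hbT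
  have haT' := hab'.trans hbT'
  have ha0 := a.coe_nonneg
  have hY := hN.isControl.isAdaptedPath_deviation (r := r) c
  set Y := deviation P T r c uhat with hYdef
  set η := seg P T a T Y with hη
  have hηm : η ∈ integrands P 𝓕 T a := hY.seg_mem le_rfl (hab.trans hbT) le_rfl
  set ψ := ContinuousLinearMap.adjoint I (timeIntegral P T η) with hψ
  set φ := seg P T 0 T Y with hφ
  have hsub : Ioc (a : ℝ) T ⊆ Ioc 0 (T : ℝ) := Ioc_subset_Ioc_left ha0
  have hpt : ∀ᵐ τ ∂(volume.restrict (Ioc (a : ℝ) T)),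
      inner ℝ (Y τ) ((σ • φ + (2 * (μ - r)) • ψ : PathSpace P T) τ) ≤ 0 := by
    have l1 := ae_restrict_of_ae_restrict_of_subset hsub (ae_tendsto_average_pathSpace φ)
    have l2 := ae_restrict_of_ae_restrict_of_subset hsub (ae_tendsto_average_pathSpace ψ)
    have l3 := ae_restrict_of_ae_restrict_of_subset hsub
      (coeFn_seg_of_mem le_rfl le_rfl (hY.segMemLp le_rfl T.coe_nonneg le_rfl))
    have l4 : ∀ᵐ τ ∂(volume.restrict (Ioc (a : ℝ) T)),
        (σ • φ + (2 * (μ - r)) • ψ : PathSpace P T) τ = σ • φ τ + (2 * (μ - r)) • ψ τ := by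
      refine ae_restrict_of_ae_restrict_of_subset hsub ?_
      filter_upwards [Lp.coeFn_add (σ • φ) ((2 * (μ - r)) • ψ), Lp.coeFn_smul σ φ,
        Lp.coeFn_smul (2 * (μ - r)) ψ] with τ e1 e2 e3
      rw [e1, Pi.add_apply, e2, e3, Pi.smul_apply, Pi.smul_apply]
    have l5 : ∀ᵐ (τ : ℝ) ∂(volume.restrict (Ioc (a : ℝ) T)), τ ≠ T :=
      ae_restrict_of_ae (Measure.ae_ne volume (T : ℝ))
    filter_upwards [l1, l2, l3, l4, l5, ae_restrict_mem measurableSet_Ioc] with τ e1 e2 e3 e4 e5 hm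
    have hτT : τ < T := lt_of_le_of_ne hm.2 e5
    lift τ to ℝ≥0 using ha0.trans hm.1.le
    have haτ : a ≤ τ := by exact_mod_cast hm.1.le
    rw [e4, e3]
    exact hI.first_order_condition hW hσ hlam hc hcc hJ hN haτ (by exact_mod_cast hτT) hφ e3 hψ
      (e1 hτT) (e2 hτT)
  have hint : inner ℝ η (σ • φ + (2 * (μ - r)) • ψ) ≤ 0 := by
    rw [hη, inner_seg_left ha0 haT' le_rfl (hY.segMemLp ha0 haT' le_rfl),
      intervalIntegral.integral_of_le haT']
    exact integral_nonpos_of_ae hpt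
  have hηφ : inner ℝ η φ = ‖η‖ ^ 2 := by
    rw [← real_inner_self_eq_norm_sq, hη,
      inner_seg_left ha0 haT' le_rfl (hY.segMemLp ha0 haT' le_rfl),
      inner_seg_left ha0 haT' le_rfl (hY.segMemLp ha0 haT' le_rfl),
      intervalIntegral.integral_of_le haT', intervalIntegral.integral_of_le haT']
    apply integral_congr_ae
    filter_upwards [coeFn_seg_of_mem ha0 le_rfl (hY.segMemLp ha0 haT' le_rfl),
      ae_restrict_of_ae_restrict_of_subset hsub
        (coeFn_seg_of_mem le_rfl le_rfl (hY.segMemLp le_rfl T.coe_nonneg le_rfl))] with τ e1 e2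
    rw [e1, hφ, e2]
  have hS : ‖timeIntegral P T η‖ ≤ √((b : ℝ) - a) * ‖η‖ := by
    have h1 : η = seg P T a b Y := by
      rw [hη, hY.seg_concat ha0 hab' hbT' le_rfl, hb, add_zero]
    rw [h1]
    exact norm_timeIntegral_seg_le hY ha0 hab' hbT'
  have hηψ : |inner ℝ η ψ| ≤ √((b : ℝ) - a) * ‖η‖ ^ 2 := by
    rw [hψ, ContinuousLinearMap.adjoint_inner_right]
    refine (abs_real_inner_le_norm _ _).trans ?_
    rw [hI.norm_apply hηm]
    refine (mul_le_mul_of_nonneg_left hS (norm_nonneg _)).trans_eq ?_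
    ring
  have h2 : |(μ - r) * inner ℝ η ψ| ≤ |μ - r| * (√((b : ℝ) - a) * ‖η‖ ^ 2) := by
    rw [abs_mul]
    exact mul_le_mul_of_nonneg_left hηψ (abs_nonneg _)
  have h3 := (abs_le.1 h2).1
  rw [inner_add_right, inner_smul_right, inner_smul_right, hηφ] at hint
  -- the interval is so short that the first-order condition is coercive
  have h4 : (σ - 2 * |μ - r| * √((b : ℝ) - a)) * ‖η‖ ^ 2 ≤ 0 := by linarith
  have h5 : ‖η‖ ^ 2 ≤ 0 := nonpos_of_mul_nonpos_right h4 (sub_pos.2 hd)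
  exact norm_eq_zero.1 (pow_eq_zero_iff two_ne_zero |>.1 (le_antisymm h5 (sq_nonneg _)))

/-- Backward induction over short intervals. -/
theorem IsItoIntegral.seg_deviation_eq_zero (hW : IsBrownianMotion W 𝓕 P)
    (hI : IsItoIntegral P 𝓕 T W I) (hσ : 0 < σ) (hlam : 0 < lam)
    (hc : 2 * lam * σ ^ 2 * c = μ - r) (hcc : IsControl 𝓕 P T M (discountedConst Ω T r c))
    (hJ : IsGainCriterion P 𝓕 T M μ r σ lam I J) (hN : IsNashEquilibrium P 𝓕 T M J uhat) :
    seg P T 0 T (deviation P T r c uhat) = 0 := by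
  -- intervals of length `ρ ^ 2` are short enough
  set ρ := σ / (2 * (2 * |μ - r| + 1)) with hρ
  have hρpos : 0 < ρ := by positivity
  have hρσ : 2 * |μ - r| * ρ < σ := by
    have h1 : 2 * (2 * |μ - r| + 1) * ρ = σ := by rw [hρ]; field_simp
    have h2 : 0 ≤ |μ - r| * ρ := by positivity
    linarith
  set d : ℝ≥0 := ⟨ρ ^ 2, sq_nonneg ρ⟩ with hd
  have key : ∀ n : ℕ, ∀ a : ℝ≥0, a ≤ T → T ≤ a + n * d →
      seg P T a T (deviation P T r c uhat) = 0 := by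
    intro n
    induction n with
    | zero =>
      intro a haT hTa
      have h1 : a = T := le_antisymm haT (by simpa using hTa)
      rw [h1, seg_self]
    | succ n ih =>
      intro a haT hTa
      set b := min (a + d) T with hb
      have hab : a ≤ b := le_min le_self_add haT
      have hTb : T ≤ b + n * d := by
        rcases le_total (a + d) T with h | h
        · rw [hb, min_eq_left h]
          push_cast at hTa
          exact hTa.trans_eq (by ring)
        · rw [hb, min_eq_right h]
          exact le_self_add
      refine hI.seg_deviation_eq_zero_step hW hσ hlam hc hcc hJ hN hab (min_le_right _ _)
        (ih b (min_le_right _ _) hTb) ?_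
      have h2 : (b : ℝ) - a ≤ ρ ^ 2 := by
        have h3 : (b : ℝ) ≤ ((a + d : ℝ≥0) : ℝ) := by exact_mod_cast min_le_left (a + d) T
        have h4 : ((a + d : ℝ≥0) : ℝ) = a + ρ ^ 2 := rfl
        linarith
      have h3 : √((b : ℝ) - a) ≤ ρ := (Real.sqrt_le_sqrt h2).trans_eq (Real.sqrt_sq hρpos.le)
      exact (mul_le_mul_of_nonneg_left h3 (by positivity)).trans_lt hρσ
  have hdpos : 0 < d := by
    have : (0 : ℝ) < d := by rw [hd]; exact pow_pos hρpos 2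
    exact_mod_cast this
  obtain ⟨n, hn⟩ := exists_nat_ge (T / d)
  have h5 : T ≤ (0 : ℝ≥0) + n * d := by
    rw [zero_add]
    exact (div_le_iff₀ hdpos).1 hn
  exact key n 0 zero_le h5

/-- A left-continuous path whose class in the path space is zero vanishes everywhere on
`(0, T]`. -/
lemma IsAdaptedPath.eq_zero_of_seg_eq_zero (hY : IsAdaptedPath P 𝓕 T C Y)
    (h : seg P T 0 T Y = 0) {τ : ℝ} (hτ : τ ∈ Ioc 0 (T : ℝ)) : Y τ = 0 := by
  by_contra hne
  have h1 := hY.leftCont τ hτ (isOpen_compl_singleton.mem_nhds hne)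
  obtain ⟨l, hl, hsub⟩ := (mem_nhdsLE_iff_exists_Ioc_subset).1 h1
  have h2 : ∀ᵐ s ∂(volume.restrict (Ioc 0 (T : ℝ))), Y s = 0 := by
    filter_upwards [coeFn_seg_of_mem le_rfl le_rfl (hY.segMemLp le_rfl T.coe_nonneg le_rfl),
      h ▸ Lp.coeFn_zero (Lp ℝ 2 P) 2 (timeMeasure T)] with s e1 e2
    rw [← e1, e2, Pi.zero_apply]
  have hm : max l 0 < τ := max_lt hl hτ.1
  have h3 := ae_restrict_of_ae_restrict_of_subset
    (Ioc_subset_Ioc (le_max_right l 0) hτ.2) h2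
  have h4 : ∀ᵐ s ∂(volume.restrict (Ioc (max l 0) τ)), False := by
    filter_upwards [h3, ae_restrict_mem measurableSet_Ioc] with s e1 hs
    exact hsub ⟨(le_max_left l 0).trans_lt hs.1, hs.2⟩ e1
  rw [ae_iff] at h4
  simp only [not_false_eq_true, ofPred_true, Measure.restrict_apply MeasurableSet.univ, univ_inter,
    Real.volume_Ioc, ENNReal.ofReal_eq_zero] at h4
  linarith

/-- Two left-continuous processes that agree almost surely at each time are indistinguishable. -/
lemma IsControl.indistinguishable {u u' : ℝ≥0 → Ω → ℝ} (hu : IsControl 𝓕 P T M u)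
    (hu' : IsControl 𝓕 P T M u') (h : ∀ t, 0 < t → t ≤ T → u t =ᵐ[P] u' t) :
    ∀ᵐ ω ∂P, ∀ t, 0 < t → t ≤ T → u t ω = u' t ω := by
  obtain ⟨S, hSc, hSd⟩ := TopologicalSpace.exists_countable_dense ℝ≥0
  have h1 : ∀ᵐ ω ∂P, ∀ s ∈ S, 0 < s → s ≤ T → u s ω = u' s ω := by
    refine (ae_ball_iff hSc).2 fun s _ => ?_
    by_cases hs : 0 < s ∧ s ≤ T
    · filter_upwards [h s hs.1 hs.2] with ω hω _ _ using hω
    · exact ae_of_all _ fun ω h0 hT => absurd ⟨h0, hT⟩ hs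
  filter_upwards [h1, hu.left_continuous, hu'.left_continuous] with ω a1 a2 a3 t ht0 htT
  have hcl : t ∈ closure (Ioo 0 t ∩ S) := by
    have h2 := closure_mono (hSd.open_subset_closure_inter (isOpen_Ioo (a := (0 : ℝ≥0)) (b := t)))
    rw [closure_Ioo ht0.ne, closure_closure] at h2
    exact h2 ⟨ht0.le, le_rfl⟩
  have hsub : Ioo 0 t ∩ S ⊆ Iic t := fun s hs => hs.1.2.le
  have hne : (𝓝[Ioo 0 t ∩ S] t).NeBot := mem_closure_iff_nhdsWithin_neBot.1 hcl
  refine tendsto_nhds_unique_of_eventuallyEq ((a2 t ht0 htT).mono hsub)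
    ((a3 t ht0 htT).mono hsub) ?_
  filter_upwards [self_mem_nhdsWithin] with s hs
  exact a1 s hs.2 hs.1.1 (hs.1.2.le.trans htT)

theorem IsItoIntegral.isUniqueNashEquilibrium (hW : IsBrownianMotion W 𝓕 P)
    (hI : IsItoIntegral P 𝓕 T W I) (hσ : 0 < σ) (hlam : 0 < lam)
    (hc : 2 * lam * σ ^ 2 * c = μ - r) (hcc : IsControl 𝓕 P T M (discountedConst Ω T r c))
    (hJ : IsGainCriterion P 𝓕 T M μ r σ lam I J) :
    IsUniqueNashEquilibrium P 𝓕 T M J (discountedConst Ω T r c) := by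
  refine ⟨hI.isNashEquilibrium_discountedConst hW hσ hlam hc hcc hJ, fun u hu => ?_⟩
  refine hu.isControl.indistinguishable hcc fun t ht0 htT => ?_
  have hY := hu.isControl.isAdaptedPath_deviation (r := r) c
  have ht : (t : ℝ) ∈ Ioc 0 (T : ℝ) := ⟨by exact_mod_cast ht0, by exact_mod_cast htT⟩
  have h1 := hY.eq_zero_of_seg_eq_zero (hI.seg_deviation_eq_zero hW hσ hlam hc hcc hJ hu) ht
  have h2 : pathL2 P u t = pathL2 P (discountedConst Ω T r c) t := by
    rw [pathL2_eq_smul_compoundedPath (T := T) (r := r),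
      pathL2_eq_smul_compoundedPath (T := T) (r := r), compoundedPath_discountedConst ht.1.le,
      sub_eq_zero.1 h1]
  have h3 := coeFn_pathL2 hu.isControl ht.2
  have h4 := coeFn_pathL2 hcc ht.2
  rw [h2] at h3
  rw [Real.toNNReal_coe] at h3 h4
  exact h3.symm.trans h4

/-- The functional for gains and losses subtracts the initial wealth with interest, so what remains
is the gain. -/
lemma IsItoIntegral.isGainCriterion_gains (hW : IsBrownianMotion W 𝓕 P)
    (hI : IsItoIntegral P 𝓕 T W I) : IsGainCriterion P 𝓕 T M μ r σ lam I
      (gainsFunctional P 𝓕 W T r μ σ (fun y => y) (fun y => (max 0 y) ^ 2) lam) := by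
  refine fun t ht x => ⟨0, fun u hu => meanRisk_ae_eq (𝓕.le t) ?_⟩
  filter_upwards [hI.wealth_ae_eq (μ := μ) (r := r) (σ := σ) hW hu ht.le x] with ω hω
  rw [hω]
  ring

lemma IsItoIntegral.isGainCriterion_terminalWealth (hW : IsBrownianMotion W 𝓕 P)
    (hI : IsItoIntegral P 𝓕 T W I) : IsGainCriterion P 𝓕 T M μ r σ lam I
      (terminalWealthFunctional P 𝓕 W T r μ σ (fun y => y) (fun y => (max 0 y) ^ 2) lam) :=
  fun t ht x => ⟨x * Real.exp (r * ((T : ℝ) - t)), fun _ hu => meanRisk_ae_eq (𝓕.le t)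
    (hI.wealth_ae_eq (μ := μ) (r := r) (σ := σ) hW hu ht.le x)⟩

end Uniqueness

end MeanRisk

theorem theorem6p6 {Ω : Type*} {mΩ : MeasurableSpace Ω} (P : Measure Ω) [IsProbabilityMeasure P]
    (𝓕 : Filtration ℝ≥0 mΩ) (W : ℝ≥0 → Ω → ℝ) (hW : MeanRisk.IsBrownianMotion W 𝓕 P)
    (T : ℝ≥0) (hT : 0 < T) (r μ σ lam M : ℝ) (hσ : 0 < σ) (hlam : 0 < lam)
    (hM : ∀ t : ℝ≥0, 0 < t → t ≤ T →
      |(μ - r) / (2 * lam * σ ^ 2) * Real.exp (-r * ((T : ℝ) - (t : ℝ)))| ≤ M) :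
    MeanRisk.IsUniqueNashEquilibrium P 𝓕 T M
        (MeanRisk.gainsFunctional P 𝓕 W T r μ σ (fun y => y) (fun y => (max 0 y) ^ 2) lam)
        (fun t _ => (μ - r) / (2 * lam * σ ^ 2) * Real.exp (-r * ((T : ℝ) - (t : ℝ)))) ∧
      MeanRisk.IsUniqueNashEquilibrium P 𝓕 T M
        (MeanRisk.terminalWealthFunctional P 𝓕 W T r μ σ
          (fun y => y) (fun y => (max 0 y) ^ 2) lam)
        (fun t _ => (μ - r) / (2 * lam * σ ^ 2) * Real.exp (-r * ((T : ℝ) - (t : ℝ)))) := by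
  obtain ⟨I, hI⟩ := hW.exists_isItoIntegral T
  have hc : 2 * lam * σ ^ 2 * ((μ - r) / (2 * lam * σ ^ 2)) = μ - r :=
    mul_div_cancel₀ _ (by positivity)
  have hcc := MeanRisk.isControl_discountedConst (P := P) (𝓕 := 𝓕) hT hM
  exact ⟨hI.isUniqueNashEquilibrium hW hσ hlam hc hcc (hI.isGainCriterion_gains hW),
    hI.isUniqueNashEquilibrium hW hσ hlam hc hcc (hI.isGainCriterion_terminalWealth hW)⟩
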